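/- **Setting.** Let $T>0$ and let $(\Omega,\mathcal F,(\mathcal F_t)_{0\le t\le T},\mathbb P)$ be a filtered probability space satisfying the usual conditions; $E_t$ denotes conditional expectation given $\mathcal F_t$. Let $P=L+A$ be a càdlàg special semimartingale with canonical decomposition into a local martingale $L$ and a predictable finite-variation process $A$, $A_0=0$, such that $P_0$ is integrable and $E[\langle L\rangle_T]+E[(\int_0^T|dA_s|)^2]<\infty$ (where $\langle L\rangle$ is the predictable compensator of $(L-L_0)^2$, so $\langle L\rangle_0=0$). Let $N\ge 1$, let $\lambda,\gamma,\kappa,\rho,\varrho,\phi,y>0$ and $x^1,\dots,x^N\in\mathbb R$, $\bar x=\frac1N\sum_i x^i$. Let $\mathcal A$ be the set of progressively measurable $v$ with $E[\int_0^Tv_s^2ds]<\infty$. For $u=(u^1,\dots,u^N)\in\mathcal A^N$ put $X^{u^i}_t=x^i-\int_0^tu^i_sds$, $Y^u_t=e^{-\rho t}y+\gamma\int_0^te^{-\rho(t-s)}\frac1N\sum_{j}u^j_s\,ds$ and $$J^i(u^i;u^{-i})=E\Big[\int_0^T(P_t-\kappa Y^u_t)u^i_t\,dt-\lambda\int_0^T(u^i_t)^2dt-\phi\int_0^T(X^{u^i}_t)^2dt+X^{u^i}_T(P_T-\varrho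 X^{u^i}_T)\Big].$$ A profile $\hat u\in\mathcal A^N$ is an open-loop Nash equilibrium if $J^i(\hat u^i;\hat u^{-i})\ge J^i(v;\hat u^{-i})$ for all $i$ and all $v\in\mathcal A$. **Matrices.** Let $$\overline F=\begin{pmatrix}0&0&-1&0\\0&-\rho&\gamma&0\\-\frac\phi\lambda&\frac{\kappa\rho}{2\lambda}&-\frac{\kappa\gamma(N-1)}{2\lambda N}&\frac\rho{2\lambda}\\0&0&\frac{\kappa\gamma}N&\rho\end{pmatrix},\qquad F=\begin{pmatrix}0&-1&0\\-\frac\phi\lambda&\frac{\kappa\gamma}{2\lambda N}&\frac\rho{2\lambda}\\0&\frac{\kappa\gamma}N&\rho\end{pmatrix},$$ $\overline G(t)=(\frac\varrho\lambda,-\frac\kappa{2\lambda},-1,0)e^{\overline Ft}$, $\overline H(t)=(0,0,0,1)e^{\overline Ft}$, $G(t)=(\frac\varrho\lambda,-1,0)e^{Ft}$, $H(t)=(0,0,1)e^{Ft}$, and $$v_0=\Big(1-\frac{G_3}{G_2}\frac{H_2}{H_3}\Big)^{-1},\qquad v_1=\frac{G_3}{G_2}\frac{H_1}{H_3}-\frac{G_1}{G_2},\qquad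 v_2=\frac{G_3}{G_2}.$$ Assume that $|\overline G_3\overline H_4-\overline G_4\overline H_3|$, $|\overline G_3|$, $|\overline H_4|$, $|G_2H_3-G_3H_2|$, $|G_2|$ and $|H_3|$ all have strictly positive infimum over $[0,T]$, and that the four eigenvalues of $\overline F$ are real and distinct. **Theorem.** (a) The linear FBSDE on $[0,T]$ $$\begin{aligned}d\overline X_t&=-\bar u_tdt,\quad \overline X_0=\bar x,\\ d\overline Y_t&=-\rho\overline Y_tdt+\gamma\bar u_tdt,\quad \overline Y_0=y,\\ d\bar u_t&=\tfrac{dP_t}{2\lambda}+\tfrac{\kappa\rho}{2\lambda}\overline Y_tdt-\tfrac{\gamma\kappa(N-1)}{2\lambda N}\bar u_tdt-\tfrac\phi\lambda\overline X_tdt+\tfrac\rho{2\lambda}\overline Z_tdt+d\overline M_t,\quad \bar u_T=\tfrac\varrho\lambda\overline X_T-\tfrac\kappa{2\lambda}\overline Y_T,\\ d\overline Z_t&=\rho\overline Z_tdt+\tfrac{\gamma\kappa}N\bar u_tdt+d\overline K_t,\quad \overline Z_T=0,\end{aligned}$$ with $\bar u\in\mathcal A$, adapted càdlàg $\overline X,\overline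 Y,\bar u,\overline Z$ and square integrable càdlàg martingales $\overline M,\overline K$, has a solution $(\overline X,\overline Y,\bar u,\overline Z)$, unique up to indistinguishability. (b) With this $\overline Y$, for each $i$ the linear FBSDE $$\begin{aligned}dX^i_t&=-u^i_tdt,\quad X^i_0=x^i,\\ du^i_t&=\tfrac1{2\lambda}(dP_t-\kappa\,d\overline Y_t)+\tfrac{\gamma\kappa}{2\lambda N}u^i_tdt-\tfrac\phi\lambda X^i_tdt+\tfrac\rho{2\lambda}Z^i_tdt+dM^i_t,\quad u^i_T=\tfrac\varrho\lambda X^i_T-\tfrac\kappa{2\lambda}\overline Y_T,\\ dZ^i_t&=\rho Z^i_tdt+\tfrac{\gamma\kappa}Nu^i_tdt+dK^i_t,\quad Z^i_T=0,\end{aligned}$$ (same regularity conventions) has a solution $(X^i,\hat u^i,Z^i)$ with $\hat u^i\in\mathcal A$, unique up to indistinguishability, and for every $t\in(0,T)$, almost surely, $$\begin{aligned}\hat u^i_t=v_0(T-t)\Big(&v_1(T-t)X^{\hat u^i}_t+\tfrac{v_2(T-t)}{2\lambda}E_t\Big[\int_t^T\tfrac{H_2(T-s)}{H_3(T-t)}(dA_s-\kappa\,d\overline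 Y_s)\Big]\\&-\tfrac1{2\lambda}E_t\Big[\int_t^T\tfrac{G_2(T-s)}{G_2(T-t)}(dA_s-\kappa\,d\overline Y_s)-\tfrac{\kappa}{G_2(T-t)}\overline Y_T\Big]\Big),\end{aligned}$$ where the integrals are Lebesgue–Stieltjes integrals over $(t,T]$ against paths of almost surely bounded variation, and the random variables inside the conditional expectations are integrable. (c) $(\hat u^1,\dots,\hat u^N)$ is an open-loop Nash equilibrium, and it is the only one: every open-loop Nash equilibrium $w$ satisfies $w^i=\hat u^i$ $d\mathbb P\otimes dt$-a.e. on $\Omega\times[0,T]$ for every $i$. -/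

import Mathlib

open MeasureTheory ProbabilityTheory Filter Topology
open scoped NNReal ENNReal

noncomputable section

namespace CrowdedGame

/-! ## Processes on a finite horizon

A process on `[0, T]` is represented by a function `ℝ≥0 → Ω → ℝ` of which only the values at times
`t ≤ T` are ever used.  Path properties on `[0, T]` are expressed through `stopAt T X`. -/

section Processes

variable {Ω : Type*} {E : Type*}

/-- The process `X` frozen at time `T`. -/
def stopAt (T : ℝ≥0) (X : ℝ≥0 → Ω → E) : ℝ≥0 → Ω → E := fun t ω => X (min t T) ω

/-- Right-continuous paths with left limits. -/
def IsCadlag (f : ℝ≥0 → ℝ) : Prop :=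
  ∀ t, ContinuousWithinAt f (Set.Ici t) t ∧ ∃ l, Tendsto f (𝓝[<] t) (𝓝 l)

variable [mΩ : MeasurableSpace Ω]

/-- Almost every path is càdlàg on `[0, T]`. -/
def AeCadlag (μ : Measure Ω) (T : ℝ≥0) (X : ℝ≥0 → Ω → ℝ) : Prop :=
  ∀ᵐ ω ∂μ, IsCadlag fun t => stopAt T X t ω

/-- Indistinguishability on `[0, T]`. -/
def Indist (μ : Measure Ω) (T : ℝ≥0) (X Y : ℝ≥0 → Ω → ℝ) : Prop :=
  ∀ᵐ ω ∂μ, ∀ t ≤ T, X t ω = Y t ω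

/-- The usual conditions: the filtration is right-continuous, and every `μ`-null set (measurable or
not: `μ` is an outer measure) belongs to `𝓕 0`; in particular `μ` is complete. -/
structure UsualConditions (𝓕 : Filtration ℝ≥0 mΩ) (μ : Measure Ω) : Prop where
  right_continuous : 𝓕.IsRightContinuous
  complete : ∀ s : Set Ω, μ s = 0 → MeasurableSet[𝓕 0] s

/-- A square integrable (càdlàg) martingale on `[0, T]`. -/
structure IsSqIntMartingale (μ : Measure Ω) (𝓕 : Filtration ℝ≥0 mΩ) (T : ℝ≥0)
    (M : ℝ≥0 → Ω → ℝ) : Prop where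
  martingale : Martingale (stopAt T M) 𝓕 μ
  memLp : MemLp (M T) 2 μ
  cadlag : AeCadlag μ T M

/-- `B` is the predictable quadratic variation `⟨L⟩` on `[0, T]`: it is predictable,
nondecreasing, càdlàg, starts at `0`, and there is a localizing sequence along which the stopped
versions of `L - L₀` and of `(L - L₀)² - B` are martingales. -/
structure IsAngleBracket (μ : Measure Ω) (𝓕 : Filtration ℝ≥0 mΩ) (T : ℝ≥0)
    (L B : ℝ≥0 → Ω → ℝ) : Prop where
  predictable : IsStronglyPredictable 𝓕 (stopAt T B)
  zero : ∀ᵐ ω ∂μ, B 0 ω = 0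
  mono : ∀ᵐ ω ∂μ, MonotoneOn (fun t => B t ω) (Set.Iic T)
  cadlag : AeCadlag μ T B
  bracket : Locally
    (fun X : ℝ≥0 → Ω → ℝ × ℝ =>
      Martingale (fun t ω => (X t ω).1) 𝓕 μ ∧
      Martingale (fun t ω => (X t ω).1 ^ 2 - (X t ω).2) 𝓕 μ)
    𝓕 (stopAt T fun t ω => (L t ω - L 0 ω, B t ω)) μ

/-- `P` is a special semimartingale of class `ℋ²` on `[0, T]` with canonical decomposition
`P = L + A`: `L` is a local martingale, `A` is a predictable process of finite variation started
at `0`, and `E[⟨L⟩_T] + E[(∫₀ᵀ |dA|)²] < ∞`.  The starting value `P₀` is integrable. -/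
structure IsH2Semimartingale (μ : Measure Ω) (𝓕 : Filtration ℝ≥0 mΩ) (T : ℝ≥0)
    (P L A : ℝ≥0 → Ω → ℝ) : Prop where
  decomposition : ∀ᵐ ω ∂μ, ∀ t ≤ T, P t ω = L t ω + A t ω
  integrable_zero : Integrable (P 0) μ
  local_martingale : Locally (fun X : ℝ≥0 → Ω → ℝ => Martingale X 𝓕 μ) 𝓕 (stopAt T L) μ
  cadlag_L : AeCadlag μ T L
  predictable : IsStronglyPredictable 𝓕 (stopAt T A)
  zero_A : ∀ᵐ ω ∂μ, A 0 ω = 0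
  cadlag_A : AeCadlag μ T A
  bracket : ∃ B : ℝ≥0 → Ω → ℝ, IsAngleBracket μ 𝓕 T L B ∧
    ∫⁻ ω, ENNReal.ofReal (B T ω) ∂μ < ∞
  variation : ∫⁻ ω, (eVariationOn (fun t => A t ω) (Set.Iic T)) ^ 2 ∂μ < ∞

/-- Admissible strategies: progressively measurable on `[0, T]` with `E[∫₀ᵀ v_s² ds] < ∞`. -/
def Admissible (μ : Measure Ω) (𝓕 : Filtration ℝ≥0 mΩ) (T : ℝ≥0) (v : ℝ≥0 → Ω → ℝ) : Prop :=
  IsStronglyProgressive 𝓕 (stopAt T v) ∧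
    ∫⁻ ω, (∫⁻ s in Set.Icc (0 : ℝ) T, ENNReal.ofReal (v s.toNNReal ω ^ 2)) ∂μ < ∞

end Processes

open Classical in
/-- The Lebesgue–Stieltjes integral `∫_(t,T] g(s) df(s)` against a right-continuous function `f` of
bounded variation on `[0, T]` (junk value `0` if `f` is not of bounded variation there). -/
def stieltjesIntegral (g f : ℝ≥0 → ℝ) (t T : ℝ≥0) : ℝ :=
  if h : BoundedVariationOn (fun s => f (min s T)) Set.univ then
    ∫ᵛ s in Set.Ioc t T, g s ∂•h.vectorMeasure
  else 0

/-! ## The model -/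

/-- The parameters of the game: the slippage cost `lam`, the impact parameters `gamma` and `kappa`,
the resilience rate `rho`, the terminal penalty `varrho`, the running inventory penalty `phi` and
the time horizon `T`, all positive. -/
structure Params where
  lam : ℝ
  gamma : ℝ
  kappa : ℝ
  rho : ℝ
  varrho : ℝ
  phi : ℝ
  T : ℝ≥0
  lam_pos : 0 < lam
  gamma_pos : 0 < gamma
  kappa_pos : 0 < kappa
  rho_pos : 0 < rho
  varrho_pos : 0 < varrho
  phi_pos : 0 < phi
  T_pos : 0 < T

section Game

variable {Ω : Type*} (p : Params) {N : ℕ}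

/-- The inventory `X_t = x - ∫₀ᵗ u_s ds`. -/
def inventory (x : ℝ) (u : ℝ≥0 → Ω → ℝ) (t : ℝ≥0) (ω : Ω) : ℝ :=
  x - ∫ s in (0 : ℝ)..t, u s.toNNReal ω

/-- The aggregated transient price impact
`Y_t = e^{-ρ t} y + γ ∫₀ᵗ e^{-ρ (t - s)} (1/N) ∑ⱼ uʲ_s ds`. -/
def impact (y : ℝ) (u : Fin N → ℝ≥0 → Ω → ℝ) (t : ℝ≥0) (ω : Ω) : ℝ :=
  Real.exp (-p.rho * t) * y +
    p.gamma * ∫ s in (0 : ℝ)..t,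
      Real.exp (-p.rho * ((t : ℝ) - s)) * ((1 / (N : ℝ)) * ∑ j, u j s.toNNReal ω)

/-- The execution price `S = P - κ Y`. -/
def execPrice (y : ℝ) (P : ℝ≥0 → Ω → ℝ) (u : Fin N → ℝ≥0 → Ω → ℝ) (t : ℝ≥0) (ω : Ω) : ℝ :=
  P t ω - p.kappa * impact p y u t ω

variable [mΩ : MeasurableSpace Ω]

/-- The performance functional of player `i` when the strategy profile `u` is played. -/
def objective (μ : Measure Ω) (x : Fin N → ℝ) (y : ℝ) (P : ℝ≥0 → Ω → ℝ)
    (u : Fin N → ℝ≥0 → Ω → ℝ) (i : Fin N) : ℝ :=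
  ∫ ω, ((∫ t in (0 : ℝ)..p.T, execPrice p y P u t.toNNReal ω * u i t.toNNReal ω)
      - p.lam * (∫ t in (0 : ℝ)..p.T, (u i t.toNNReal ω) ^ 2)
      - p.phi * (∫ t in (0 : ℝ)..p.T, (inventory (x i) (u i) t.toNNReal ω) ^ 2)
      + inventory (x i) (u i) p.T ω
          * (P p.T ω - p.varrho * inventory (x i) (u i) p.T ω)) ∂μ

/-- Open-loop Nash equilibrium. -/
def IsNash (μ : Measure Ω) (𝓕 : Filtration ℝ≥0 mΩ) (x : Fin N → ℝ) (y : ℝ)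
    (P : ℝ≥0 → Ω → ℝ) (u : Fin N → ℝ≥0 → Ω → ℝ) : Prop :=
  (∀ i, Admissible μ 𝓕 p.T (u i)) ∧
    ∀ i, ∀ v : ℝ≥0 → Ω → ℝ, Admissible μ 𝓕 p.T v →
      objective p μ x y P (Function.update u i v) i ≤ objective p μ x y P u i

/-- `(X, Y, u, Z)` solves on `[0, T]` the aggregated linear FBSDE
`dX = -u dt`, `X₀ = xbar`,
`dY = -ρ Y dt + γ u dt`, `Y₀ = y`,
`du = dP/(2λ) + κρY/(2λ) dt - γκ(N-1)u/(2λN) dt - φX/λ dt + ρZ/(2λ) dt + dM`,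
`u_T = ϱ/λ X_T - κ/(2λ) Y_T`,
`dZ = ρ Z dt + γκ/N u dt + dK`, `Z_T = 0`,
with `u` admissible, `Z` adapted, and square integrable martingales `M`, `K`. -/
structure SolvesMeanFBSDE (μ : Measure Ω) (𝓕 : Filtration ℝ≥0 mΩ) (N : ℕ) (xbar y : ℝ)
    (P X Y u Z : ℝ≥0 → Ω → ℝ) : Prop where
  admissible : Admissible μ 𝓕 p.T u
  adapted_Z : StronglyAdapted 𝓕 (stopAt p.T Z)
  cadlag_X : AeCadlag μ p.T X
  cadlag_Y : AeCadlag μ p.T Y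
  cadlag_u : AeCadlag μ p.T u
  cadlag_Z : AeCadlag μ p.T Z
  eq_X : ∀ᵐ ω ∂μ, ∀ t ≤ p.T, X t ω = xbar - ∫ s in (0 : ℝ)..t, u s.toNNReal ω
  eq_Y : ∀ᵐ ω ∂μ, ∀ t ≤ p.T,
    Y t ω = y + ∫ s in (0 : ℝ)..t, (-p.rho * Y s.toNNReal ω + p.gamma * u s.toNNReal ω)
  eq_u_Z : ∃ M K : ℝ≥0 → Ω → ℝ, IsSqIntMartingale μ 𝓕 p.T M ∧ IsSqIntMartingale μ 𝓕 p.T K ∧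
    (∀ᵐ ω ∂μ, ∀ t ≤ p.T,
      u t ω = u 0 ω + (P t ω - P 0 ω) / (2 * p.lam)
        + (∫ s in (0 : ℝ)..t,
            (p.kappa * p.rho * Y s.toNNReal ω / (2 * p.lam)
              - p.gamma * p.kappa * ((N : ℝ) - 1) * u s.toNNReal ω / (2 * p.lam * N)
              - p.phi * X s.toNNReal ω / p.lam
              + p.rho * Z s.toNNReal ω / (2 * p.lam)))
        + (M t ω - M 0 ω)) ∧
    (∀ᵐ ω ∂μ, ∀ t ≤ p.T,
      Z t ω = Z 0 ω
        + (∫ s in (0 : ℝ)..t, (p.rho * Z s.toNNReal ω + p.gamma * p.kappa / N * u s.toNNReal ω))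
        + (K t ω - K 0 ω))
  terminal_u : ∀ᵐ ω ∂μ,
    u p.T ω = p.varrho / p.lam * X p.T ω - p.kappa / (2 * p.lam) * Y p.T ω
  terminal_Z : ∀ᵐ ω ∂μ, Z p.T ω = 0

/-- `(X, u, Z)` solves on `[0, T]` the linear FBSDE of an individual player with initial inventory
`x`, in which the aggregated impact `Ybar` is a given input:
`dX = -u dt`, `X₀ = x`,
`du = (dP - κ dYbar)/(2λ) + γκ u/(2λN) dt - φX/λ dt + ρZ/(2λ) dt + dM`,
`u_T = ϱ/λ X_T - κ/(2λ) Ybar_T`,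
`dZ = ρ Z dt + γκ/N u dt + dK`, `Z_T = 0`,
with `u` admissible, `Z` adapted, and square integrable martingales `M`, `K`. -/
structure SolvesPlayerFBSDE (μ : Measure Ω) (𝓕 : Filtration ℝ≥0 mΩ) (N : ℕ) (x : ℝ)
    (P Ybar X u Z : ℝ≥0 → Ω → ℝ) : Prop where
  admissible : Admissible μ 𝓕 p.T u
  adapted_Z : StronglyAdapted 𝓕 (stopAt p.T Z)
  cadlag_X : AeCadlag μ p.T X
  cadlag_u : AeCadlag μ p.T u
  cadlag_Z : AeCadlag μ p.T Z
  eq_X : ∀ᵐ ω ∂μ, ∀ t ≤ p.T, X t ω = x - ∫ s in (0 : ℝ)..t, u s.toNNReal ω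
  eq_u_Z : ∃ M K : ℝ≥0 → Ω → ℝ, IsSqIntMartingale μ 𝓕 p.T M ∧ IsSqIntMartingale μ 𝓕 p.T K ∧
    (∀ᵐ ω ∂μ, ∀ t ≤ p.T,
      u t ω = u 0 ω
        + 1 / (2 * p.lam) * ((P t ω - P 0 ω) - p.kappa * (Ybar t ω - Ybar 0 ω))
        + (∫ s in (0 : ℝ)..t,
            (p.gamma * p.kappa / (2 * p.lam * N) * u s.toNNReal ω
              - p.phi * X s.toNNReal ω / p.lam
              + p.rho * Z s.toNNReal ω / (2 * p.lam)))
        + (M t ω - M 0 ω)) ∧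
    (∀ᵐ ω ∂μ, ∀ t ≤ p.T,
      Z t ω = Z 0 ω
        + (∫ s in (0 : ℝ)..t, (p.rho * Z s.toNNReal ω + p.gamma * p.kappa / N * u s.toNNReal ω))
        + (K t ω - K 0 ω))
  terminal_u : ∀ᵐ ω ∂μ,
    u p.T ω = p.varrho / p.lam * X p.T ω - p.kappa / (2 * p.lam) * Ybar p.T ω
  terminal_Z : ∀ᵐ ω ∂μ, Z p.T ω = 0

end Game

/-! ## The matrix exponentials

Indices start at `0` here: the mathematical `G_k`, `H_k` are `G p N t (k-1)`, `H p N t (k-1)`. -/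

section Matrices

variable (p : Params) (N : ℕ)

def Fbar : Matrix (Fin 4) (Fin 4) ℝ :=
  !![0, 0, -1, 0;
     0, -p.rho, p.gamma, 0;
     -(p.phi / p.lam), p.kappa * p.rho / (2 * p.lam),
       -(p.kappa * p.gamma * ((N : ℝ) - 1) / (2 * p.lam * N)), p.rho / (2 * p.lam);
     0, 0, p.kappa * p.gamma / N, p.rho]

def Qbar (t : ℝ) : Matrix (Fin 4) (Fin 4) ℝ := NormedSpace.exp (t • Fbar p N)

def Gbar (t : ℝ) : Fin 4 → ℝ :=
  Matrix.vecMul ![p.varrho / p.lam, -(p.kappa / (2 * p.lam)), -1, 0] (Qbar p N t)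

def Hbar (t : ℝ) : Fin 4 → ℝ := Matrix.vecMul ![0, 0, 0, 1] (Qbar p N t)

def F : Matrix (Fin 3) (Fin 3) ℝ :=
  !![0, -1, 0;
     -(p.phi / p.lam), p.kappa * p.gamma / (2 * p.lam * N), p.rho / (2 * p.lam);
     0, p.kappa * p.gamma / N, p.rho]

def Q (t : ℝ) : Matrix (Fin 3) (Fin 3) ℝ := NormedSpace.exp (t • F p N)

def G (t : ℝ) : Fin 3 → ℝ := Matrix.vecMul ![p.varrho / p.lam, -1, 0] (Q p N t)

def H (t : ℝ) : Fin 3 → ℝ := Matrix.vecMul ![0, 0, 1] (Q p N t)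

def v0 (t : ℝ) : ℝ := (1 - G p N t 2 / G p N t 1 * (H p N t 1 / H p N t 2))⁻¹

def v1 (t : ℝ) : ℝ :=
  G p N t 2 / G p N t 1 * (H p N t 0 / H p N t 2) - G p N t 0 / G p N t 1

def v2 (t : ℝ) : ℝ := G p N t 2 / G p N t 1

/-- Nondegeneracy of the four-dimensional (aggregated) system; the last field says that all
eigenvalues of `Fbar` are real and distinct. -/
structure MeanNondegenerate : Prop where
  det : 0 < sInf ((fun t : ℝ => |Gbar p N t 2 * Hbar p N t 3 - Gbar p N t 3 * Hbar p N t 2|) ''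
    Set.Icc 0 (p.T : ℝ))
  G3 : 0 < sInf ((fun t : ℝ => |Gbar p N t 2|) '' Set.Icc 0 (p.T : ℝ))
  H4 : 0 < sInf ((fun t : ℝ => |Hbar p N t 3|) '' Set.Icc 0 (p.T : ℝ))
  eigenvalues : ∃ ν : Fin 4 → ℝ, Function.Injective ν ∧
    ∀ k, Module.End.HasEigenvalue (Matrix.toLin' (Fbar p N)) (ν k)

/-- Nondegeneracy of the three-dimensional (individual) system. -/
structure PlayerNondegenerate : Prop where
  det : 0 < sInf ((fun t : ℝ => |G p N t 1 * H p N t 2 - G p N t 2 * H p N t 1|) ''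
    Set.Icc 0 (p.T : ℝ))
  G2 : 0 < sInf ((fun t : ℝ => |G p N t 1|) '' Set.Icc 0 (p.T : ℝ))
  H3 : 0 < sInf ((fun t : ℝ => |H p N t 2|) '' Set.Icc 0 (p.T : ℝ))

end Matrices

/-! ## The feedback form -/

section Feedback

variable {Ω : Type*} [mΩ : MeasurableSpace Ω] (p : Params) (N : ℕ)

/-- `∫_t^T H₂(T-s)/H₃(T-t) (dA_s - κ dYbar_s)`. -/
def futureH (A Ybar : ℝ≥0 → Ω → ℝ) (t : ℝ≥0) (ω : Ω) : ℝ :=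
  stieltjesIntegral (fun s => H p N ((p.T : ℝ) - s) 1 / H p N ((p.T : ℝ) - t) 2)
    (fun s => A s ω - p.kappa * Ybar s ω) t p.T

/-- `∫_t^T G₂(T-s)/G₂(T-t) (dA_s - κ dYbar_s) - κ/G₂(T-t) Ybar_T`. -/
def futureG (A Ybar : ℝ≥0 → Ω → ℝ) (t : ℝ≥0) (ω : Ω) : ℝ :=
  stieltjesIntegral (fun s => G p N ((p.T : ℝ) - s) 1 / G p N ((p.T : ℝ) - t) 1)
    (fun s => A s ω - p.kappa * Ybar s ω) t p.T
  - p.kappa / G p N ((p.T : ℝ) - t) 1 * Ybar p.T ω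

/-- The linear feedback form of the strategy `u` of a player with initial inventory `x`. The random
variables whose conditional expectations occur are integrable, and are built from Stieltjes
integrals against paths that are almost surely of bounded variation on `[0, T]`. -/
def HasFeedbackForm (μ : Measure Ω) (𝓕 : Filtration ℝ≥0 mΩ) (x : ℝ)
    (A Ybar u : ℝ≥0 → Ω → ℝ) : Prop :=
  (∀ᵐ ω ∂μ, BoundedVariationOn (fun s => A s ω - p.kappa * Ybar s ω) (Set.Iic p.T)) ∧
  ∀ t : ℝ≥0, 0 < t → t < p.T →
    Integrable (futureH p N A Ybar t) μ ∧ Integrable (futureG p N A Ybar t) μ ∧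
    ∀ᵐ ω ∂μ, u t ω =
      v0 p N ((p.T : ℝ) - t) *
        (v1 p N ((p.T : ℝ) - t) * inventory x u t ω
          + v2 p N ((p.T : ℝ) - t) / (2 * p.lam) * (μ[futureH p N A Ybar t | 𝓕 t]) ω
          - 1 / (2 * p.lam) * (μ[futureG p N A Ybar t | 𝓕 t]) ω)

end Feedback

end CrowdedGame

end

/-!
# The open-loop Nash equilibrium of the price impact game

**The game is a concave quadratic problem.** With the strategies of the other players frozen, a
deviation `δ` of a player changes the reward along a path by `∫ δ · (marginal) - cost(δ)`
(`pathReward_add`), where the cost is a quadratic form, nonnegative because the kernel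
`e^{-ρ|t-s|}` is positive definite (`expConv_energy_nonneg`, `integral_exp_kernel_nonneg`) and
coercive because of the slippage cost.  Hence a profile is an equilibrium if and only if each
strategy is *stationary*: the marginal reward integrates to zero against every admissible direction
(`isNash_of_isStationary`, `IsNash.isStationary`).  Stationarity of two profiles forces them to
agree `ℙ ⊗ dt`-almost everywhere, by the same positivity applied to their difference and summed over
the players (`ae_eq_of_isStationary`, `ae_eq_of_isStationary_impact`).

**The linear systems are the stationarity conditions.** If `(X, u, Z)` solves a player's system, its
adjoint component `Z` is the conditional expectation of the discounted future impact of `u`, and the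
marginal reward is the increment `M_T - M_t` of a martingale up to terms whose optional projection
vanishes; such increments are orthogonal to every admissible direction
(`integral_mul_martingale_increment`, `integral_mul_martingale_tail`,
`SolvesPlayerFBSDE.isStationary`).  The aggregated system is the player's system for the average
inventory with its own impact as input (`SolvesMeanFBSDE.solvesPlayer`), so uniqueness for both
systems is uniqueness of stationary strategies, improved from almost every time to all times by
right-continuity.  Averaging the players' stationarity conditions shows in the same way that the
input `Ybar` is the impact generated by the players' solutions (`indist_impact`).

**Existence.** The local martingale part `L` has bracket of finite expectation, so `L - L₀` is a
square integrable martingale (`exists_martingale_version`) and can be absorbed in the unknown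
martingales; only the finite variation part remains as a forcing term.  The remaining linear
forward-backward system is solved by taking conditional expectations of the solution of the
deterministic two-point boundary value problem, whose solvability at every time is the
nondegeneracy of the determinants built from `G` and `H` (`boundaryMatrix`,
`exists_linear_forward_backward`).  The càdlàg versions of the conditional expectations come from
the upcrossing inequality along the dyadic times (`exists_cadlag_condExp`).

**Feedback form.** Propagating the two terminal conditions backwards along the flow gives two linear
relations between `X_t`, `u_t`, `Z_t` and conditional expectations of integrals of the forcing; an
integration by parts for Stieltjes integrals (`stieltjesIntegral_eq`) rewrites the latter as
integrals against `A - κ Ybar`, and eliminating `Z_t` yields the formula.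
-/


noncomputable section

namespace CrowdedGame

section

/-! ### Càdlàg paths -/

lemma IsCadlag.add {f g : ℝ≥0 → ℝ} (hf : IsCadlag f) (hg : IsCadlag g) :
    IsCadlag fun t => f t + g t := fun t => by
  obtain ⟨hf1, l, hl⟩ := hf t
  obtain ⟨hg1, m, hm⟩ := hg t
  exact ⟨hf1.add hg1, l + m, hl.add hm⟩

lemma IsCadlag.mul {f g : ℝ≥0 → ℝ} (hf : IsCadlag f) (hg : IsCadlag g) :
    IsCadlag fun t => f t * g t := fun t => by
  obtain ⟨hf1, l, hl⟩ := hf t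
  obtain ⟨hg1, m, hm⟩ := hg t
  exact ⟨hf1.mul hg1, l * m, hl.mul hm⟩

lemma isCadlag_of_continuous {f : ℝ≥0 → ℝ} (hf : Continuous f) : IsCadlag f := fun t =>
  ⟨hf.continuousWithinAt, f t, (hf.tendsto t).mono_left nhdsWithin_le_nhds⟩

lemma isCadlag_const (c : ℝ) : IsCadlag fun _ => c := isCadlag_of_continuous continuous_const

lemma IsCadlag.neg {f : ℝ≥0 → ℝ} (hf : IsCadlag f) : IsCadlag fun t => - f t := by
  simpa using (isCadlag_const (-1)).mul hf

lemma IsCadlag.sub {f g : ℝ≥0 → ℝ} (hf : IsCadlag f) (hg : IsCadlag g) :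
    IsCadlag fun t => f t - g t := by
  simpa [sub_eq_add_neg] using hf.add hg.neg

/-- A càdlàg path is bounded near every point, hence on compact intervals. -/
lemma IsCadlag.exists_bound {f : ℝ≥0 → ℝ} (hf : IsCadlag f) (K : ℝ≥0) :
    ∃ C, ∀ t ≤ K, |f t| ≤ C := by
  have hloc : ∀ t : ℝ≥0, ∃ U ∈ 𝓝 t, ∃ C, ∀ s ∈ U, |f s| ≤ C := by
    intro t
    obtain ⟨h1, l, hl⟩ := hf t
    have e1 : ∀ᶠ s in 𝓝[≥] t, |f s| < |f t| + 1 :=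
      (h1.tendsto.abs).eventually (gt_mem_nhds (by linarith))
    have e2 : ∀ᶠ s in 𝓝[<] t, |f s| < |l| + 1 :=
      hl.abs.eventually (gt_mem_nhds (by linarith))
    have e3 : ∀ᶠ s in 𝓝 t, |f s| ≤ max (|f t| + 1) (|l| + 1) := by
      rw [← nhdsLT_sup_nhdsGE t, eventually_sup]
      exact ⟨e2.mono fun s hs => hs.le.trans (le_max_right _ _),
        e1.mono fun s hs => hs.le.trans (le_max_left _ _)⟩
    exact ⟨_, e3, _, fun s hs => hs⟩
  have hc : IsCompact (Set.Icc 0 K) := isCompact_Icc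
  obtain ⟨C, hC⟩ : ∃ C, ∀ t ∈ Set.Icc 0 K, |f t| ≤ C := by
    refine hc.induction_on (p := fun s => ∃ C, ∀ t ∈ s, |f t| ≤ C) ⟨0, by simp⟩ ?_ ?_ ?_
    · rintro s t hst ⟨C, hC⟩
      exact ⟨C, fun u hu => hC u (hst hu)⟩
    · rintro s t ⟨C, hC⟩ ⟨D, hD⟩
      refine ⟨max C D, fun u hu => ?_⟩
      rcases hu with hu | hu
      · exact (hC u hu).trans (le_max_left _ _)
      · exact (hD u hu).trans (le_max_right _ _)
    · intro t _
      obtain ⟨U, hU, C, hC⟩ := hloc t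
      exact ⟨U, mem_nhdsWithin_of_mem_nhds hU, C, hC⟩
  exact ⟨C, fun t ht => hC t ⟨zero_le, ht⟩⟩

/-! ### Measurability of right-continuous processes -/

/-- The right-hand grid point of mesh `1 / (n + 1)` following `t`. -/
def gridAfter (n : ℕ) (t : ℝ≥0) : ℝ≥0 := (⌊((n : ℝ≥0) + 1) * t⌋₊ + 1) / ((n : ℝ≥0) + 1)

lemma lt_gridAfter (n : ℕ) (t : ℝ≥0) : t < gridAfter n t := by
  unfold gridAfter
  rw [lt_div_iff₀ (by positivity), mul_comm]
  exact Nat.lt_floor_add_one _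

lemma gridAfter_le (n : ℕ) (t : ℝ≥0) : gridAfter n t ≤ t + 1 / ((n : ℝ≥0) + 1) := by
  unfold gridAfter
  rw [add_div]
  gcongr
  rw [div_le_iff₀ (by positivity), mul_comm]
  exact Nat.floor_le (zero_le)

lemma tendsto_gridAfter (t : ℝ≥0) : Tendsto (fun n => gridAfter n t) atTop (𝓝 t) := by
  refine tendsto_of_tendsto_of_tendsto_of_le_of_le (g := fun _ => t)
    (h := fun n : ℕ => t + 1 / ((n : ℝ≥0) + 1)) tendsto_const_nhds ?_
    (fun n => (lt_gridAfter n t).le) (fun n => gridAfter_le n t)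
  have : Tendsto (fun n : ℕ => 1 / ((n : ℝ≥0) + 1)) atTop (𝓝 0) := by
    have h := tendsto_one_div_add_atTop_nhds_zero_nat (𝕜 := ℝ)
    rw [← NNReal.tendsto_coe]
    simpa using h
  simpa using tendsto_const_nhds.add this

lemma measurable_comp_gridAfter {Ω : Type*} [MeasurableSpace Ω] {X : ℝ≥0 → Ω → ℝ} {i : ℝ≥0}
    (hX : ∀ s ≤ i, Measurable (X s)) (n : ℕ) :
    Measurable fun q : Set.Iic i × Ω => X (min (gridAfter n q.1) i) q.2 := by
  let V : ℕ × Ω → ℝ := fun q => X (min (((q.1 : ℝ≥0) + 1) / ((n : ℝ≥0) + 1)) i) q.2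
  have hV : Measurable V := measurable_from_prod_countable_right fun k =>
    hX (min (((k : ℝ≥0) + 1) / ((n : ℝ≥0) + 1)) i) (min_le_right _ _)
  have e : (fun q : Set.Iic i × Ω => X (min (gridAfter n q.1) i) q.2) =
      V ∘ fun q : Set.Iic i × Ω => (⌊((n : ℝ≥0) + 1) * (q.1 : ℝ≥0)⌋₊, q.2) := by
    funext q
    simp only [V, gridAfter, Function.comp_apply]
  have hφ : Measurable
      (fun q : Set.Iic i × Ω => (⌊((n : ℝ≥0) + 1) * (q.1 : ℝ≥0)⌋₊, q.2)) := by fun_prop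
  rw [e]
  exact hV.comp hφ

/-- An adapted process with right-continuous paths is progressively measurable. -/
lemma isStronglyProgressive_of_rightContinuous {Ω : Type*} {mΩ : MeasurableSpace Ω}
    {𝓕 : Filtration ℝ≥0 mΩ} {X : ℝ≥0 → Ω → ℝ} (hX : StronglyAdapted 𝓕 X)
    (hc : ∀ ω t, ContinuousWithinAt (fun s => X s ω) (Set.Ici t) t) :
    IsStronglyProgressive 𝓕 X := by
  intro i
  refine stronglyMeasurable_of_tendsto (f := fun (n : ℕ) (q : Set.Iic i × Ω) =>
    X (min (gridAfter n q.1) i) q.2) atTop (fun n => Measurable.stronglyMeasurable ?_) ?_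
  · exact @measurable_comp_gridAfter Ω (𝓕 i) X i
      (fun s hs => ((hX s).mono (𝓕.mono hs)).measurable) n
  · rw [tendsto_pi_nhds]
    rintro ⟨⟨t, ht⟩, ω⟩
    have h1 : Tendsto (fun n => min (gridAfter n t) i) atTop (𝓝[Set.Ici t] t) := by
      refine tendsto_nhdsWithin_iff.2 ⟨?_, Eventually.of_forall fun n =>
        le_min (lt_gridAfter n t).le ht⟩
      have := (tendsto_gridAfter t).min (tendsto_const_nhds (x := i))
      rwa [min_eq_left (show t ≤ i from ht)] at this
    exact (hc ω t).tendsto.comp h1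

lemma measurable_comp_min {Ω : Type*} [MeasurableSpace Ω] {t : ℝ≥0} {f : Set.Iic t × Ω → ℝ}
    (hf : Measurable f) :
    Measurable fun q : ℝ × Ω => f (⟨min q.1.toNNReal t, Set.mem_Iic.2 (min_le_right _ _)⟩, q.2) :=
  hf.comp (by fun_prop)

/-- A progressively measurable process frozen at time `t` is jointly measurable with respect to
`Borel ⊗ 𝓕 t`. -/
lemma measurable_stopAt_of_isStronglyProgressive {Ω : Type*} {mΩ : MeasurableSpace Ω}
    {𝓕 : Filtration ℝ≥0 mΩ} {X : ℝ≥0 → Ω → ℝ} (hX : IsStronglyProgressive 𝓕 X) (t : ℝ≥0) :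
    Measurable[Prod.instMeasurableSpace (m₂ := 𝓕 t)]
      (fun q : ℝ × Ω => X (min q.1.toNNReal t) q.2) :=
  @measurable_comp_min Ω (𝓕 t) t _ (hX t).measurable

lemma measurable_of_rightContinuous {f : ℝ≥0 → ℝ}
    (hc : ∀ t, ContinuousWithinAt f (Set.Ici t) t) : Measurable f := by
  refine measurable_of_tendsto_metrizable (f := fun n t => f (gridAfter n t)) (fun n => ?_) ?_
  · have : (fun t => f (gridAfter n t)) = (fun k : ℕ => f ((k + 1) / ((n : ℝ≥0) + 1))) ∘
        (fun t : ℝ≥0 => ⌊((n : ℝ≥0) + 1) * t⌋₊) := rfl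
    rw [this]
    exact (measurable_of_countable _).comp (Nat.measurable_floor.comp (measurable_id.const_mul _))
  · rw [tendsto_pi_nhds]
    intro t
    refine (hc t).tendsto.comp (tendsto_nhdsWithin_iff.2 ⟨tendsto_gridAfter t,
      Eventually.of_forall fun n => (lt_gridAfter n t).le⟩)

lemma IsCadlag.measurable {f : ℝ≥0 → ℝ} (hf : IsCadlag f) : Measurable f :=
  measurable_of_rightContinuous fun t => (hf t).1

lemma IsCadlag.memLp {f : ℝ≥0 → ℝ} (hf : IsCadlag f) (a b : ℝ) (q : ℝ≥0∞) :
    MemLp (fun s : ℝ => f s.toNNReal) q (volume.restrict (Set.uIoc a b)) := by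
  obtain ⟨C, hC⟩ := hf.exists_bound (max a b).toNNReal
  have : IsFiniteMeasure (volume.restrict (Set.uIoc a b)) := ⟨by simp [Set.uIoc]⟩
  refine MemLp.of_bound (hf.measurable.comp measurable_real_toNNReal).aestronglyMeasurable C ?_
  filter_upwards [ae_restrict_mem measurableSet_uIoc] with s hs
  exact hC _ (Real.toNNReal_le_toNNReal hs.2)

lemma IsCadlag.intervalIntegrable {f : ℝ≥0 → ℝ} (hf : IsCadlag f) (a b : ℝ) :
    IntervalIntegrable (fun s : ℝ => f s.toNNReal) volume a b := by
  rw [intervalIntegrable_iff]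
  have : IsFiniteMeasure (volume.restrict (Set.uIoc a b)) := ⟨by simp [Set.uIoc]⟩
  exact memLp_one_iff_integrable.1 (hf.memLp a b 1)

/-- Two càdlàg paths on `[0, T]` that agree for almost every time agree everywhere before `T`. -/
lemma eq_of_ae_eq_of_rightContinuous {f g : ℝ≥0 → ℝ} {T : ℝ≥0}
    (hf : ∀ t, ContinuousWithinAt f (Set.Ici t) t) (hg : ∀ t, ContinuousWithinAt g (Set.Ici t) t)
    (h : ∀ᵐ s : ℝ, s ∈ Set.Icc (0 : ℝ) T → f s.toNNReal = g s.toNNReal) {t : ℝ≥0} (ht : t < T) :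
    f t = g t := by
  have hd : Dense {s : ℝ | s ∈ Set.Icc (0 : ℝ) T → f s.toNNReal = g s.toNNReal} :=
    Measure.dense_of_ae h
  have hq : ∀ n : ℕ, ∃ s : ℝ, s ∈ {s : ℝ | s ∈ Set.Icc (0 : ℝ) T → f s.toNNReal = g s.toNNReal} ∧
      s ∈ Set.Ioo (t : ℝ) (min T (t + 1 / ((n : ℝ) + 1))) := fun n =>
    hd.exists_mem_open isOpen_Ioo (Set.nonempty_Ioo.2 (lt_min (by exact_mod_cast ht)
      (by have : (0 : ℝ) < 1 / ((n : ℝ) + 1) := by positivity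
          linarith)))
  choose s hs1 hs2 using hq
  have hs0 : ∀ n, (0 : ℝ) ≤ s n := fun n => t.2.trans (hs2 n).1.le
  have hlim : Tendsto (fun n => (s n).toNNReal) atTop (𝓝[Set.Ici t] t) := by
    refine tendsto_nhdsWithin_iff.2 ⟨?_, Eventually.of_forall fun n => ?_⟩
    · rw [← NNReal.tendsto_coe]
      simp only [Real.coe_toNNReal _ (hs0 _)]
      refine tendsto_of_tendsto_of_tendsto_of_le_of_le (g := fun _ => (t : ℝ))
        (h := fun n : ℕ => (t : ℝ) + 1 / ((n : ℝ) + 1)) tendsto_const_nhds ?_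
        (fun n => (hs2 n).1.le) (fun n => ((hs2 n).2.trans_le (min_le_right _ _)).le)
      simpa using tendsto_const_nhds.add (tendsto_one_div_add_atTop_nhds_zero_nat (𝕜 := ℝ))
    · exact NNReal.coe_le_coe.1 (by rw [Real.coe_toNNReal _ (hs0 _)]; exact (hs2 n).1.le)
  refine tendsto_nhds_unique ((hf t).tendsto.comp hlim) (((hg t).tendsto.comp hlim).congr
    fun n => ?_)
  exact (hs1 n ⟨hs0 n, ((hs2 n).2.trans_le (min_le_left _ _)).le⟩).symm

/-! ### Calculus of primitives of integrable functions -/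

/-- The product rule for primitives of integrable functions. -/
lemma integral_primitive_mul {f g : ℝ → ℝ} {a b : ℝ} (hf : IntervalIntegrable f volume a b)
    (hg : IntervalIntegrable g volume a b) {Φ Γ : ℝ → ℝ} (c d : ℝ)
    (hΦ : ∀ x ∈ Set.uIcc a b, Φ x = c + ∫ s in a..x, f s)
    (hΓ : ∀ x ∈ Set.uIcc a b, Γ x = d + ∫ s in a..x, g s) :
    ∫ x in a..b, (f x * Γ x + Φ x * g x) = Φ b * Γ b - Φ a * Γ a := by
  have hac (h : ℝ → ℝ) (hh : IntervalIntegrable h volume a b) (e : ℝ) :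
      AbsolutelyContinuousOnInterval (fun x => e + ∫ s in a..x, h s) a b := by
    refine AbsolutelyContinuousOnInterval.add ?_
      (hh.absolutelyContinuousOnInterval_intervalIntegral Set.left_mem_uIcc)
    exact ((LipschitzWith.const e).lipschitzOnWith).absolutelyContinuousOnInterval
  have key := (hac f hf c).integral_deriv_mul_eq_sub (hac g hg d)
  have haa : a ∈ Set.uIcc a b := Set.left_mem_uIcc
  have hbb : b ∈ Set.uIcc a b := Set.right_mem_uIcc
  rw [hΦ a haa, hΓ a haa, hΦ b hbb, hΓ b hbb, ← key]
  refine intervalIntegral.integral_congr_ae ?_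
  filter_upwards [hf.ae_hasDerivAt_integral, hg.ae_hasDerivAt_integral] with x h1 h2 hx
  have hx' := Set.uIoc_subset_uIcc hx
  have d1 := ((h1 hx' a haa).const_add c).deriv
  have d2 := ((h2 hx' a haa).const_add d).deriv
  rw [hΦ x hx', hΓ x hx', d1, d2]

lemma hasDerivAt_eq_add_integral {g g' : ℝ → ℝ} {a b : ℝ}
    (hg : ∀ x ∈ Set.uIcc a b, HasDerivAt g (g' x) x) (hc : ContinuousOn g' (Set.uIcc a b)) :
    ∀ x ∈ Set.uIcc a b, g x = g a + ∫ s in a..x, g' s := by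
  intro x hx
  have hsub : Set.uIcc a x ⊆ Set.uIcc a b := Set.uIcc_subset_uIcc_left hx
  rw [intervalIntegral.integral_eq_sub_of_hasDerivAt (fun y hy => hg y (hsub hy))
    (hc.mono hsub).intervalIntegrable]
  ring

/-- The product rule for a `C¹` function and a primitive. -/
lemma integral_C1_mul_primitive {g g' f : ℝ → ℝ} {a b : ℝ}
    (hg : ∀ x ∈ Set.uIcc a b, HasDerivAt g (g' x) x) (hc : ContinuousOn g' (Set.uIcc a b))
    (hf : IntervalIntegrable f volume a b) {Φ : ℝ → ℝ} (c : ℝ)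
    (hΦ : ∀ x ∈ Set.uIcc a b, Φ x = c + ∫ s in a..x, f s) :
    ∫ x in a..b, (g' x * Φ x + g x * f x) = g b * Φ b - g a * Φ a :=
  integral_primitive_mul hc.intervalIntegrable hf (g a) c (hasDerivAt_eq_add_integral hg hc) hΦ

/-- Fubini on the triangle `t ≤ s`, for interval integrals. -/
lemma integral_primitive_swap {v k : ℝ → ℝ} {T : ℝ}
    (hv : IntervalIntegrable v volume 0 T) (hk : IntervalIntegrable k volume 0 T) :
    ∫ t in (0 : ℝ)..T, v t * (∫ s in t..T, k s) =
      ∫ s in (0 : ℝ)..T, (∫ t in (0 : ℝ)..s, v t) * k s := by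
  have hsplit : ∀ x ∈ Set.uIcc 0 T, (∫ s in x..T, k s) =
      (∫ s in (0 : ℝ)..T, k s) + ∫ s in (0 : ℝ)..x, - k s := by
    intro x hx
    rw [intervalIntegral.integral_neg, ← sub_eq_add_neg, intervalIntegral.integral_interval_sub_left
      hk (hk.mono_set (Set.uIcc_subset_uIcc_left hx))]
  have key := integral_primitive_mul hv hk.neg (Φ := fun x => ∫ t in (0 : ℝ)..x, v t)
    (Γ := fun x => ∫ s in x..T, k s) 0 (∫ s in (0 : ℝ)..T, k s) (fun x _ => by simp)
    (fun x hx => hsplit x hx)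
  have c1 : ContinuousOn (fun x => ∫ t in (0 : ℝ)..x, v t) (Set.uIcc 0 T) :=
    intervalIntegral.continuousOn_primitive_interval'
      (hv) Set.left_mem_uIcc
  have c2 : ContinuousOn (fun x => ∫ s in x..T, k s) (Set.uIcc 0 T) := by
    refine ContinuousOn.congr (continuousOn_const.add
      (intervalIntegral.continuousOn_primitive_interval' hk.neg Set.left_mem_uIcc)) hsplit
  have i1 := hv.mul_continuousOn c2
  have i2 := hk.continuousOn_mul c1
  have : ∫ x in (0 : ℝ)..T, (v x * (∫ s in x..T, k s) + (∫ t in (0 : ℝ)..x, v t) * -k x) =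
      (∫ x in (0 : ℝ)..T, v x * (∫ s in x..T, k s)) -
        ∫ x in (0 : ℝ)..T, (∫ t in (0 : ℝ)..x, v t) * k x := by
    rw [← intervalIntegral.integral_sub i1 i2]
    simp [sub_eq_add_neg]
  simp only [Pi.neg_apply] at key
  rw [this] at key
  simp at key
  linarith

/-- Variation of constants for the scalar equation `a' = r a + k`. -/
lemma exp_mul_eq_of_linear_integral_eq {a k : ℝ → ℝ} {r c T : ℝ}
    (hk : IntervalIntegrable k volume 0 T) (ha : IntervalIntegrable a volume 0 T)
    (h : ∀ t ∈ Set.uIcc 0 T, a t = c + ∫ s in (0 : ℝ)..t, (r * a s + k s)) :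
    ∀ t ∈ Set.uIcc 0 T, Real.exp (-r * t) * a t = c + ∫ s in (0 : ℝ)..t, Real.exp (-r * s) * k s := by
  intro t ht
  have hsub : Set.uIcc 0 t ⊆ Set.uIcc 0 T := Set.uIcc_subset_uIcc_left ht
  have hd : ∀ x ∈ Set.uIcc 0 t, HasDerivAt (fun x : ℝ => Real.exp (-r * x))
      (Real.exp (-r * x) * -r) x := fun x _ => by
    simpa using (((hasDerivAt_id x).const_mul (-r)).exp)
  have key := integral_C1_mul_primitive hd (by fun_prop)
    (((ha.const_mul r).add hk).mono_set hsub) (Φ := a) c (fun x hx => h x (hsub hx))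
  have h0 : a 0 = c := by simpa using h 0 Set.left_mem_uIcc
  simp only [h0, mul_zero, Real.exp_zero, one_mul] at key
  rw [sub_eq_iff_eq_add'.1 key.symm, add_right_inj]
  refine intervalIntegral.integral_congr fun x _ => ?_
  ring

/-- The exponential kernel is positive definite. -/
lemma integral_exp_kernel_nonneg {v : ℝ → ℝ} {r T : ℝ} (hr : 0 ≤ r) (hT : 0 ≤ T)
    (hv : IntervalIntegrable v volume 0 T) :
    0 ≤ ∫ t in (0 : ℝ)..T, (Real.exp (-r * t) * ∫ s in (0 : ℝ)..t, Real.exp (r * s) * v s) * v t := by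
  set f : ℝ → ℝ := fun s => Real.exp (r * s) * v s with hf
  have hfi : IntervalIntegrable f volume 0 T :=
    hv.continuousOn_mul (by fun_prop)
  set Φ : ℝ → ℝ := fun t => ∫ s in (0 : ℝ)..t, f s with hΦ
  have cΦ : ContinuousOn Φ (Set.uIcc 0 T) :=
    intervalIntegral.continuousOn_primitive_interval' hfi Set.left_mem_uIcc
  have i1 : IntervalIntegrable (fun x => f x * Φ x + Φ x * f x) volume 0 T :=
    (hfi.mul_continuousOn cΦ).add (hfi.continuousOn_mul cΦ)
  have sq : ∀ x ∈ Set.uIcc 0 T, Φ x ^ 2 = 0 + ∫ s in (0 : ℝ)..x, (f s * Φ s + Φ s * f s) := by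
    intro x hx
    have := integral_primitive_mul (hfi.mono_set (Set.uIcc_subset_uIcc_left hx))
      (hfi.mono_set (Set.uIcc_subset_uIcc_left hx)) (Φ := Φ) (Γ := Φ) 0 0 (by simp [hΦ])
      (by simp [hΦ])
    rw [this]
    simp [hΦ, sq]
  have hd : ∀ x ∈ Set.uIcc 0 T, HasDerivAt (fun x : ℝ => Real.exp (-(2 * r) * x))
      (Real.exp (-(2 * r) * x) * -(2 * r)) x := fun x _ => by
    simpa using (((hasDerivAt_id x).const_mul (-(2 * r))).exp)
  have key := integral_C1_mul_primitive hd (by fun_prop) i1 0 sq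
  have ci : IntervalIntegrable (fun x => Real.exp (-(2 * r) * x) * -(2 * r) * Φ x ^ 2) volume 0 T :=
    ContinuousOn.intervalIntegrable (by fun_prop)
  have ci2 : IntervalIntegrable (fun x => Real.exp (-(2 * r) * x) * (f x * Φ x + Φ x * f x))
      volume 0 T := i1.continuousOn_mul (by fun_prop)
  rw [intervalIntegral.integral_add ci ci2] at key
  have e2 : ∫ x in (0 : ℝ)..T, Real.exp (-(2 * r) * x) * (f x * Φ x + Φ x * f x) =
      2 * ∫ t in (0 : ℝ)..T, (Real.exp (-r * t) * Φ t) * v t := by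
    rw [← intervalIntegral.integral_const_mul]
    refine intervalIntegral.integral_congr fun x _ => ?_
    have : Real.exp (-(2 * r) * x) * Real.exp (r * x) = Real.exp (-r * x) := by
      rw [← Real.exp_add]; congr 1; ring
    simp only [hf]
    rw [← this]; ring
  have n1 : ∫ x in (0 : ℝ)..T, Real.exp (-(2 * r) * x) * -(2 * r) * Φ x ^ 2 ≤ 0 := by
    have : 0 ≤ ∫ x in (0 : ℝ)..T, -(Real.exp (-(2 * r) * x) * -(2 * r) * Φ x ^ 2) :=
      intervalIntegral.integral_nonneg hT fun x _ => by
        have : 0 ≤ Real.exp (-(2 * r) * x) * (2 * r) * Φ x ^ 2 := by positivity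
        linarith
    rw [intervalIntegral.integral_neg] at this
    linarith
  have n2 : 0 ≤ Real.exp (-(2 * r) * T) * Φ T ^ 2 := by positivity
  have z : Φ 0 = 0 := by simp [hΦ]
  rw [z] at key
  change 0 ≤ ∫ t in (0 : ℝ)..T, (Real.exp (-r * t) * Φ t) * v t
  rw [e2] at key
  nlinarith

end

section

/-! ### Regularisation of paths along the dyadic numbers -/

/-- The dyadic grid point `k / 2 ^ n`. -/
def dyadic (n k : ℕ) : ℝ≥0 := k / 2 ^ n

/-- The nonnegative dyadic numbers. -/
def dyadics : Set ℝ≥0 := {q | ∃ n k, q = dyadic n k}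

lemma dyadic_mul_pow (n k : ℕ) : dyadic n (k * 2 ^ n) = k := by
  simp [dyadic]

lemma dyadic_add (n m k : ℕ) : dyadic (n + m) (k * 2 ^ m) = dyadic n k := by
  simp only [dyadic, Nat.cast_mul, Nat.cast_pow, Nat.cast_ofNat, pow_add]
  rw [mul_div_mul_right _ _ (by positivity)]

lemma dyadic_le_dyadic_iff {n k l : ℕ} : dyadic n k ≤ dyadic n l ↔ k ≤ l := by
  unfold dyadic
  rw [div_le_div_iff_of_pos_right (by positivity)]
  exact Nat.cast_le

lemma dyadic_lt_dyadic_iff {n k l : ℕ} : dyadic n k < dyadic n l ↔ k < l := by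
  simpa using dyadic_le_dyadic_iff (n := n) (k := l) (l := k).not

lemma eventually_eq_dyadic {q : ℝ≥0} (hq : q ∈ dyadics) :
    ∀ᶠ n in atTop, ∃ k, q = dyadic n k := by
  obtain ⟨n, k, rfl⟩ := hq
  filter_upwards [eventually_ge_atTop n] with m hm
  obtain ⟨d, rfl⟩ := Nat.exists_eq_add_of_le hm
  exact ⟨k * 2 ^ d, (dyadic_add n d k).symm⟩

lemma exists_dyadic_between {s t : ℝ≥0} (h : s < t) : ∃ q ∈ dyadics, s < q ∧ q < t := by
  obtain ⟨n, hn⟩ : ∃ n : ℕ, 1 / (t - s) < 2 ^ n := pow_unbounded_of_one_lt _ one_lt_two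
  have hts : 0 < t - s := tsub_pos_of_lt h
  have hn' : 1 < (t - s) * 2 ^ n := by
    rw [div_lt_iff₀ hts] at hn
    rwa [mul_comm]
  refine ⟨dyadic n (⌊s * 2 ^ n⌋₊ + 1), ⟨n, _, rfl⟩, ?_, ?_⟩
  · rw [dyadic, lt_div_iff₀ (by positivity)]
    exact_mod_cast Nat.lt_floor_add_one _
  · rw [dyadic, div_lt_iff₀ (by positivity)]
    have h1 : ((⌊s * 2 ^ n⌋₊ + 1 : ℕ) : ℝ≥0) ≤ s * 2 ^ n + 1 := by
      push_cast
      gcongr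
      exact Nat.floor_le zero_le
    refine h1.trans_lt ?_
    calc s * 2 ^ n + 1 < s * 2 ^ n + (t - s) * 2 ^ n := by gcongr
      _ = t * 2 ^ n := by rw [← add_mul, add_tsub_cancel_of_le h.le]

/-- `UpcrossingChain f a b k e` says that `f` goes from below `a` to above `b` at least `k` times
along dyadic times before `e`. -/
def UpcrossingChain (f : ℝ≥0 → ℝ) (a b : ℝ) : ℕ → ℝ≥0 → Prop
  | 0, _ => True
  | k + 1, e => ∃ q ∈ dyadics, ∃ r ∈ dyadics,
      UpcrossingChain f a b k q ∧ q < r ∧ r < e ∧ f q < a ∧ b < f r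

lemma UpcrossingChain.mono {f : ℝ≥0 → ℝ} {a b : ℝ} {k : ℕ} {e e' : ℝ≥0}
    (h : UpcrossingChain f a b k e) (he : e ≤ e') : UpcrossingChain f a b k e' := by
  cases k with
  | zero => trivial
  | succ k =>
    obtain ⟨q, hq, r, hr, h1, h2, h3, h4⟩ := h
    exact ⟨q, hq, r, hr, h1, h2, h3.trans_le he, h4⟩

lemma UpcrossingChain.le_upcrossingsBefore {Ω : Type*} {f : ℝ≥0 → Ω → ℝ} {a b : ℝ} (hab : a < b)
    {ω : Ω} {k : ℕ} : ∀ {e : ℝ≥0}, UpcrossingChain (fun t => f t ω) a b k e →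
    ∀ᶠ n in atTop, ∀ N, e ≤ dyadic n N →
      k ≤ upcrossingsBefore a b (fun j => f (dyadic n j)) N ω := by
  induction k with
  | zero => intro e _; simp
  | succ k ih =>
    rintro e ⟨q, hq, r, hr, h1, h2, h3, h4, h5⟩
    filter_upwards [ih h1, eventually_eq_dyadic hq, eventually_eq_dyadic hr] with n hn hqn hrn N hN
    obtain ⟨i, rfl⟩ := hqn
    obtain ⟨j, rfl⟩ := hrn
    have hij : i ≤ j := (dyadic_lt_dyadic_iff.1 h2).le
    have hjN : j + 1 ≤ N := dyadic_lt_dyadic_iff.1 (h3.trans_le hN)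
    have a1 := hn i le_rfl
    have a2 := upcrossingsBefore_lt_of_exists_upcrossing (f := fun j => f (dyadic n j)) (ω := ω)
      (N := i) hab le_rfl h4 hij h5
    have a3 := upcrossingsBefore_mono (f := fun j => f (dyadic n j)) hab hjN ω
    simp only at a3
    omega

/-- A path has one-sided limits along the dyadic numbers when it is bounded and has finitely many
upcrossings of every interval. -/
def IsRegularisable (f : ℝ≥0 → ℝ) : Prop :=
  ∀ K : ℕ, (∃ C, ∀ q ∈ dyadics, q ≤ K → |f q| ≤ C) ∧
    ∀ a b : ℚ, a < b → ∃ m, ¬ UpcrossingChain f a b m K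

lemma IsRegularisable.tendsto_aux {f : ℝ≥0 → ℝ} (hf : IsRegularisable f) {l : Filter ℝ≥0}
    {K : ℕ} (hK : ∀ᶠ q in l, q ∈ dyadics ∧ q ≤ K)
    (h : ∀ a b : ℝ, (∃ᶠ q in l, f q < a) → (∃ᶠ q in l, b < f q) →
      ∀ k, UpcrossingChain f a b k K) : ∃ c, Tendsto f l (𝓝 c) := by
  obtain ⟨⟨C, hC⟩, hchain⟩ := hf K
  refine tendsto_of_no_upcrossings (s := Set.range ((↑) : ℚ → ℝ)) Rat.denseRange_cast ?_ ?_ ?_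
  · rintro _ ⟨a, rfl⟩ _ ⟨b, rfl⟩ hab ⟨h1, h2⟩
    obtain ⟨m, hm⟩ := hchain a b (by exact_mod_cast hab)
    exact hm (h _ _ h1 h2 m)
  · exact ⟨C, eventually_map.2 (hK.mono fun q hq => (abs_le.1 (hC q hq.1 hq.2)).2)⟩
  · exact ⟨-C, eventually_map.2 (hK.mono fun q hq => (abs_le.1 (hC q hq.1 hq.2)).1)⟩

lemma IsRegularisable.tendsto_right {f : ℝ≥0 → ℝ} (hf : IsRegularisable f) (t : ℝ≥0) :
    ∃ c, Tendsto f (𝓝[>] t ⊓ 𝓟 dyadics) (𝓝 c) := by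
  obtain ⟨K, hK⟩ := exists_nat_gt t
  have hIoo : ∀ u, t < u → ∀ᶠ q in 𝓝[>] t ⊓ 𝓟 dyadics, q ∈ dyadics ∧ t < q ∧ q < u := by
    intro u hu
    have : ∀ᶠ q in 𝓝[>] t, q ∈ Set.Ioo t u := Ioo_mem_nhdsGT hu
    filter_upwards [this.filter_mono inf_le_left, mem_inf_of_right (mem_principal_self dyadics)]
      with q h1 h2 using ⟨h2, h1.1, h1.2⟩
  refine hf.tendsto_aux (K := K) ((hIoo K hK).mono fun q hq => ⟨hq.1, hq.2.2.le⟩) ?_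
  intro a b ha hb k
  have : ∀ k, ∀ u, t < u → UpcrossingChain f a b k u := by
    intro k
    induction k with
    | zero => intro u _; trivial
    | succ k ih =>
      intro u hu
      obtain ⟨r, h1, hr, htr, hru⟩ := (hb.and_eventually (hIoo u hu)).exists
      obtain ⟨q, h2, hq, htq, hqr⟩ := (ha.and_eventually (hIoo r htr)).exists
      exact ⟨q, hq, r, hr, ih q htq, hqr, hru, h2, h1⟩
  exact this k K hK

lemma IsRegularisable.tendsto_left {f : ℝ≥0 → ℝ} (hf : IsRegularisable f) (t : ℝ≥0) :
    ∃ c, Tendsto f (𝓝[<] t ⊓ 𝓟 dyadics) (𝓝 c) := by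
  rcases eq_or_ne t 0 with rfl | ht0
  · exact ⟨0, by simp⟩
  have ht : 0 < t := pos_iff_ne_zero.2 ht0
  obtain ⟨K, hK⟩ := exists_nat_gt t
  have hIoo : ∀ u, u < t → ∀ᶠ q in 𝓝[<] t ⊓ 𝓟 dyadics, q ∈ dyadics ∧ u < q ∧ q < t := by
    intro u hu
    have : ∀ᶠ q in 𝓝[<] t, q ∈ Set.Ioo u t := Ioo_mem_nhdsLT hu
    filter_upwards [this.filter_mono inf_le_left, mem_inf_of_right (mem_principal_self dyadics)]
      with q h1 h2 using ⟨h2, h1.1, h1.2⟩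
  refine hf.tendsto_aux (K := K) ((hIoo 0 ht).mono fun q hq => ⟨hq.1, (hq.2.2.trans hK).le⟩) ?_
  intro a b ha hb k
  have : ∀ k, ∃ u, u < t ∧ UpcrossingChain f a b k u := by
    intro k
    induction k with
    | zero => exact ⟨0, ht, trivial⟩
    | succ k ih =>
      obtain ⟨u, hu, hc⟩ := ih
      obtain ⟨q, h2, hq, huq, hqt⟩ := (ha.and_eventually (hIoo u hu)).exists
      obtain ⟨r, h1, hr, hqr, hrt⟩ := (hb.and_eventually (hIoo q hqt)).exists
      obtain ⟨e, hre, het⟩ := exists_between hrt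
      exact ⟨e, het, q, hq, r, hr, hc.mono huq.le, hqr, hre, h2, h1⟩
  obtain ⟨u, hu, hc⟩ := this k
  exact hc.mono (hu.trans hK).le

lemma neBot_nhdsGT_inf_dyadics (t : ℝ≥0) : (𝓝[>] t ⊓ 𝓟 dyadics).NeBot := by
  rw [inf_principal_neBot_iff]
  intro U hU
  obtain ⟨u, hu, hsub⟩ := mem_nhdsGT_iff_exists_Ioo_subset.1 hU
  obtain ⟨q, hq, h1, h2⟩ := exists_dyadic_between hu
  exact ⟨q, hsub ⟨h1, h2⟩, hq⟩

/-- The right limits along the dyadic numbers form a càdlàg path. -/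
lemma isCadlag_of_tendsto_dyadics {f g : ℝ≥0 → ℝ}
    (hr : ∀ t, Tendsto f (𝓝[>] t ⊓ 𝓟 dyadics) (𝓝 (g t)))
    (hl : ∀ t, ∃ c, Tendsto f (𝓝[<] t ⊓ 𝓟 dyadics) (𝓝 c)) : IsCadlag g := by
  -- a closed set containing `f` on the dyadics of `(s, u)` contains `g` on `[s, u)` as well
  have key : ∀ {V : Set ℝ} {s u : ℝ≥0}, IsClosed V → s < u →
      (∀ q ∈ dyadics, s < q → q < u → f q ∈ V) → g s ∈ V := by
    intro V s u hV hsu h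
    have := neBot_nhdsGT_inf_dyadics s
    refine hV.mem_of_tendsto (hr s) ?_
    have h1 : ∀ᶠ q in 𝓝[>] s, q ∈ Set.Ioo s u := Ioo_mem_nhdsGT hsu
    filter_upwards [h1.filter_mono inf_le_left, mem_inf_of_right (mem_principal_self dyadics)]
      with q h1 h2 using h q h2 h1.1 h1.2
  intro t
  constructor
  · rw [ContinuousWithinAt, (closed_nhds_basis (g t)).tendsto_right_iff]
    rintro V ⟨hV, hVc⟩
    have h1 : ∀ᶠ q in 𝓝[>] t ⊓ 𝓟 dyadics, f q ∈ V := (hr t).eventually hV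
    rw [eventually_inf_principal] at h1
    obtain ⟨u, hu, hsub⟩ := mem_nhdsGT_iff_exists_Ioo_subset.1 h1
    have h2 : ∀ᶠ s in 𝓝[≥] t, s ∈ Set.Ico t u := Ico_mem_nhdsGE hu
    filter_upwards [h2] with s hs
    exact key hVc hs.2 fun q hq h3 h4 => hsub ⟨hs.1.trans_lt h3, h4⟩ hq
  · rcases eq_or_ne t 0 with rfl | ht0
    · exact ⟨0, by simp⟩
    obtain ⟨c, hc⟩ := hl t
    refine ⟨c, ?_⟩
    rw [(closed_nhds_basis c).tendsto_right_iff]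
    rintro V ⟨hV, hVc⟩
    have h1 : ∀ᶠ q in 𝓝[<] t ⊓ 𝓟 dyadics, f q ∈ V := hc.eventually hV
    rw [eventually_inf_principal] at h1
    obtain ⟨u, hu, hsub⟩ := (mem_nhdsLT_iff_exists_Ioo_subset' (pos_iff_ne_zero.2 ht0)).1 h1
    have h2 : ∀ᶠ s in 𝓝[<] t, s ∈ Set.Ioo u t := Ioo_mem_nhdsLT hu
    filter_upwards [h2] with s hs
    exact key hVc hs.2 fun q hq h3 h4 => hsub ⟨hs.1.trans h3, h4⟩ hq

/-! ### Càdlàg versions of closed martingales -/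

variable {Ω : Type*} {mΩ : MeasurableSpace Ω} {μ : Measure Ω}

lemma UsualConditions.stronglyMeasurable_congr {𝓕 : Filtration ℝ≥0 mΩ}
    (h : UsualConditions 𝓕 μ) {t : ℝ≥0} {f g : Ω → ℝ} (hf : StronglyMeasurable[𝓕 t] f)
    (hfg : f =ᵐ[μ] g) : StronglyMeasurable[𝓕 t] g := by
  refine Measurable.stronglyMeasurable fun s hs => ?_
  have hnull : ∀ u : Set Ω, u ⊆ {ω | f ω ≠ g ω} → MeasurableSet[𝓕 t] u := fun u hu =>
    𝓕.mono zero_le _ (h.complete u (measure_mono_null hu hfg))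
  have e : g ⁻¹' s = (f ⁻¹' s \ {ω | ω ∈ f ⁻¹' s ∧ ω ∉ g ⁻¹' s}) ∪
      {ω | ω ∉ f ⁻¹' s ∧ ω ∈ g ⁻¹' s} := by
    ext ω; simp only [Set.mem_union, Set.mem_sdiff, Set.mem_ofPred_eq]; tauto
  rw [e]
  refine MeasurableSet.union (MeasurableSet.diff (hf.measurable hs) (hnull _ ?_)) (hnull _ ?_)
  · rintro ω ⟨h1, h2⟩ h3
    exact h2 (by rw [Set.mem_preimage, ← h3]; exact h1)
  · rintro ω ⟨h1, h2⟩ h3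
    exact h1 (by rw [Set.mem_preimage, h3]; exact h2)

lemma UsualConditions.measurableSet_of_ae {𝓕 : Filtration ℝ≥0 mΩ}
    (h : UsualConditions 𝓕 μ) {q : Ω → Prop} (hq : ∀ᵐ ω ∂μ, q ω) (t : ℝ≥0) :
    MeasurableSet[𝓕 t] {ω | q ω} := by
  have := MeasurableSet.compl (𝓕.mono zero_le _ (h.complete {ω | ¬ q ω} hq) :
    MeasurableSet[𝓕 t] {ω | ¬ q ω})
  simpa [Set.compl_ofPred] using this

/-- The filtration `𝓕` sampled on the dyadic grid of level `n`. -/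
def gridFiltration (𝓕 : Filtration ℝ≥0 mΩ) (n : ℕ) : Filtration ℕ mΩ where
  seq k := 𝓕 (dyadic n k)
  mono' _ _ h := 𝓕.mono (dyadic_le_dyadic_iff.2 h)
  le' _ := 𝓕.le _

lemma martingale_grid [IsFiniteMeasure μ] (𝓕 : Filtration ℝ≥0 mΩ) (ξ : Ω → ℝ) (n : ℕ) :
    Martingale (fun k => μ[ξ | 𝓕 (dyadic n k)]) (gridFiltration 𝓕 n) μ :=
  martingale_condExp ξ (gridFiltration 𝓕 n) μ

/-- Doob's upcrossing inequality on the dyadic grids bounds the expected number of upcrossings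
uniformly in the mesh, so almost surely the number of upcrossings along the dyadics is finite. -/
lemma ae_exists_not_upcrossingChain [IsFiniteMeasure μ] (𝓕 : Filtration ℝ≥0 mΩ) (ξ : Ω → ℝ)
    {a b : ℝ} (hab : a < b) (K : ℕ) :
    ∀ᵐ ω ∂μ, ∃ m, ¬ UpcrossingChain (fun t => (μ[ξ | 𝓕 t]) ω) a b m K := by
  set X : ℝ≥0 → Ω → ℝ := fun t => μ[ξ | 𝓕 t] with hX
  set U : ℕ → Ω → ℕ := fun n => upcrossingsBefore a b (fun j => X (dyadic n j)) (K * 2 ^ n) with hU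
  have hmart := fun n => martingale_grid (μ := μ) 𝓕 ξ n
  have hmeas : ∀ n, Measurable (U n) := fun n =>
    (hmart n).stronglyAdapted.measurable_upcrossingsBefore hab
  set c : ℝ := (∫ ω, (X K ω - a)⁺ ∂μ) / (b - a) with hc
  have hbound : ∀ n, ∫⁻ ω, (U n ω : ℝ≥0∞) ∂μ ≤ ENNReal.ofReal c := by
    intro n
    have h1 := (hmart n).submartingale.mul_integral_upcrossingsBefore_le_integral_pos_part a b
      (K * 2 ^ n)
    rw [dyadic_mul_pow] at h1
    have h2 : ∫ ω, (U n ω : ℝ) ∂μ ≤ c := by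
      rw [hc, le_div_iff₀ (sub_pos.2 hab), mul_comm]
      exact h1
    have h3 : Integrable (fun ω => (U n ω : ℝ)) μ :=
      (hmart n).stronglyAdapted.integrable_upcrossingsBefore hab
    calc ∫⁻ ω, (U n ω : ℝ≥0∞) ∂μ = ∫⁻ ω, ENNReal.ofReal (U n ω : ℝ) ∂μ := by simp
      _ = ENNReal.ofReal (∫ ω, (U n ω : ℝ) ∂μ) :=
        (ofReal_integral_eq_lintegral_ofReal h3 (ae_of_all _ fun ω => by positivity)).symm
      _ ≤ ENNReal.ofReal c := ENNReal.ofReal_le_ofReal h2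
  have hfatou : ∫⁻ ω, liminf (fun n => (U n ω : ℝ≥0∞)) atTop ∂μ ≤ ENNReal.ofReal c := by
    refine (lintegral_liminf_le fun n => (measurable_from_top.comp (hmeas n))).trans ?_
    refine (liminf_le_liminf (Eventually.of_forall hbound)).trans ?_
    simp
  have hlt : ∀ᵐ ω ∂μ, liminf (fun n => (U n ω : ℝ≥0∞)) atTop < ∞ :=
    ae_lt_top (Measurable.liminf fun n => measurable_from_top.comp (hmeas n))
      (hfatou.trans_lt ENNReal.ofReal_lt_top).ne
  filter_upwards [hlt] with ω hω
  obtain ⟨m, hm⟩ := ENNReal.exists_nat_gt hω.ne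
  refine ⟨m, fun hchain => ?_⟩
  have h1 := frequently_lt_of_liminf_lt (by isBoundedDefault) hm
  have h2 := UpcrossingChain.le_upcrossingsBefore (f := X) hab hchain
  obtain ⟨n, hn1, hn2⟩ := (h1.and_eventually h2).exists
  have h3 : m ≤ U n ω := hn2 (K * 2 ^ n) (by rw [dyadic_mul_pow])
  have h4 : U n ω < m := by exact_mod_cast hn1
  omega

/-- Doob's maximal inequality on the dyadic grids, uniform in the mesh. -/
lemma ae_bounded_dyadics [IsFiniteMeasure μ] (𝓕 : Filtration ℝ≥0 mΩ) (ξ : Ω → ℝ) (K : ℕ) :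
    ∀ᵐ ω ∂μ, ∃ C, ∀ q ∈ dyadics, q ≤ K → |(μ[ξ | 𝓕 q]) ω| ≤ C := by
  set X : ℝ≥0 → Ω → ℝ := fun t => μ[ξ | 𝓕 t] with hX
  set Y : ℕ → Ω → ℝ := fun n ω =>
    (Finset.range (K * 2 ^ n + 1)).sup' Finset.nonempty_range_add_one
      fun k => |X (dyadic n k) ω| with hY
  set c : ℝ≥0∞ := ENNReal.ofReal (∫ ω, |X K ω| ∂μ) with hc
  have hmax : ∀ (n : ℕ) (m : ℕ), (m : ℝ≥0∞) * μ {ω | (m : ℝ) ≤ Y n ω} ≤ c := by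
    intro n m
    have hm := martingale_grid (μ := μ) 𝓕 ξ n
    have hsub : Submartingale (fun k ω => |X (dyadic n k) ω|) (gridFiltration 𝓕 n) μ :=
      hm.submartingale.sup hm.neg.submartingale
    have h1 := maximal_ineq hsub (fun k ω => abs_nonneg _) (ε := (m : ℝ≥0)) (K * 2 ^ n)
    refine le_trans (le_of_eq ?_) (h1.trans (ENNReal.ofReal_le_ofReal ?_))
    · simp [hY]
    · rw [dyadic_mul_pow]
      exact setIntegral_le_integral integrable_condExp.abs (ae_of_all _ fun ω => abs_nonneg _)
  have hnull : μ {ω | ∀ m : ℕ, ∃ q ∈ dyadics, q ≤ K ∧ (m : ℝ) ≤ |X q ω|} = 0 := by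
    set S := {ω | ∀ m : ℕ, ∃ q ∈ dyadics, q ≤ K ∧ (m : ℝ) ≤ |X q ω|} with hS
    have hle : ∀ m : ℕ, (m : ℝ≥0∞) * μ S ≤ c := by
      intro m
      set A : ℕ → Set Ω := fun n => {ω | ∀ n' ≥ n, (m : ℝ) ≤ Y n' ω} with hA
      have hmono : Monotone A := fun i j hij ω hω n' hn' => hω n' (hij.trans hn')
      have hSA : S ⊆ ⋃ n, A n := by
        intro ω hω
        obtain ⟨q, hq, hqK, hmq⟩ := hω m
        obtain ⟨n, hn⟩ := eventually_atTop.1 (eventually_eq_dyadic hq)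
        refine Set.mem_iUnion.2 ⟨n, fun n' hn' => ?_⟩
        obtain ⟨k, rfl⟩ := hn n' hn'
        refine hmq.trans (Finset.le_sup' (f := fun k => |X (dyadic n' k) ω|) ?_)
        rw [Finset.mem_range, Nat.lt_add_one_iff, ← dyadic_le_dyadic_iff (n := n'), dyadic_mul_pow]
        exact hqK
      calc (m : ℝ≥0∞) * μ S ≤ m * μ (⋃ n, A n) := by gcongr
        _ = m * ⨆ n, μ (A n) := by rw [hmono.measure_iUnion]
        _ = ⨆ n, m * μ (A n) := ENNReal.mul_iSup ..
        _ ≤ c := iSup_le fun n => le_trans (by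
            gcongr
            exact fun ω hω => hω n le_rfl) (hmax n m)
    by_contra hne
    obtain ⟨m, hm⟩ := ENNReal.exists_nat_mul_gt hne (ENNReal.ofReal_ne_top (r := ∫ ω, |X K ω| ∂μ))
    exact absurd (hle m) (not_le.2 hm)
  have : ∀ᵐ ω ∂μ, ¬ ∀ m : ℕ, ∃ q ∈ dyadics, q ≤ K ∧ (m : ℝ) ≤ |X q ω| := by
    rw [ae_iff]; simpa using hnull
  filter_upwards [this] with ω hω
  push Not at hω
  obtain ⟨m, hm⟩ := hω
  exact ⟨m, fun q hq hqK => (hm q hq hqK).le⟩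

/-- Almost every path of a closed martingale is bounded along the dyadics and crosses every rational
band finitely often there, hence has one-sided limits along the dyadics. -/
lemma ae_isRegularisable_condExp [IsFiniteMeasure μ] (𝓕 : Filtration ℝ≥0 mΩ) (ξ : Ω → ℝ) :
    ∀ᵐ ω ∂μ, IsRegularisable fun t => (μ[ξ | 𝓕 t]) ω := by
  have h1 := ae_all_iff.2 fun K : ℕ => ae_bounded_dyadics (μ := μ) 𝓕 ξ K
  have h2 : ∀ᵐ ω ∂μ, ∀ (K : ℕ) (a b : ℚ), a < b →
      ∃ m, ¬ UpcrossingChain (fun t => (μ[ξ | 𝓕 t]) ω) a b m K := by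
    refine ae_all_iff.2 fun K => ae_all_iff.2 fun a => ae_all_iff.2 fun b => ?_
    by_cases hab : a < b
    · filter_upwards [ae_exists_not_upcrossingChain (μ := μ) 𝓕 ξ (a := a) (b := b)
        (by exact_mod_cast hab) K] with ω hω _ using hω
    · exact ae_of_all _ fun ω h => absurd h hab
  filter_upwards [h1, h2] with ω h1 h2 K using ⟨h1 K, h2 K⟩

/-- Under the usual conditions the martingale `E[ξ | 𝓕 t]` has a càdlàg version. -/
theorem exists_cadlag_condExp [IsFiniteMeasure μ] {𝓕 : Filtration ℝ≥0 mΩ}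
    (h𝓕 : UsualConditions 𝓕 μ) {ξ : Ω → ℝ} (hξ : Integrable ξ μ) :
    ∃ N : ℝ≥0 → Ω → ℝ, (∀ ω, IsCadlag fun t => N t ω) ∧ StronglyAdapted 𝓕 N ∧
      ∀ t, N t =ᵐ[μ] μ[ξ | 𝓕 t] := by
  classical
  set X : ℝ≥0 → Ω → ℝ := fun t => μ[ξ | 𝓕 t] with hX
  set good : Set Ω := {ω | IsRegularisable fun t => X t ω} with hgood
  have hae : ∀ᵐ ω ∂μ, ω ∈ good := ae_isRegularisable_condExp 𝓕 ξ
  have hgm : ∀ t, MeasurableSet[𝓕 t] good := fun t => h𝓕.measurableSet_of_ae hae t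
  let X' : ℝ≥0 → Ω → ℝ := fun t => good.indicator (X t)
  have hreg : ∀ ω, IsRegularisable fun t => X' t ω := by
    intro ω
    by_cases hω : ω ∈ good
    · have : (fun t => X' t ω) = fun t => X t ω := by funext t; simp [X', hω]
      rw [this]; exact hω
    · have : (fun t => X' t ω) = fun _ => 0 := by funext t; simp [X', hω]
      rw [this]
      intro K
      refine ⟨⟨0, by simp⟩, fun a b hab => ⟨1, ?_⟩⟩
      rintro ⟨q, -, r, -, -, -, -, h1, h2⟩
      have : (a : ℝ) < b := by exact_mod_cast hab
      linarith
  choose N hN using fun t ω => (hreg ω).tendsto_right t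
  have hcad : ∀ ω, IsCadlag fun t => N t ω := fun ω =>
    isCadlag_of_tendsto_dyadics (fun t => hN t ω) fun t => (hreg ω).tendsto_left t
  -- a sequence of dyadic times decreasing to a given time
  have hseq : ∀ t u : ℝ≥0, t < u → ∃ q : ℕ → ℝ≥0, (∀ n, t < q n ∧ q n < u) ∧
      Tendsto q atTop (𝓝[>] t ⊓ 𝓟 dyadics) := by
    intro t u htu
    obtain ⟨v, hv1, hv2, hv3⟩ := exists_seq_strictAnti_tendsto' htu
    choose q hq1 hq2 hq3 using fun n => exists_dyadic_between (hv2 n).1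
    refine ⟨q, fun n => ⟨hq2 n, (hq3 n).trans (hv2 n).2⟩, tendsto_inf.2 ⟨?_, ?_⟩⟩
    · refine tendsto_nhdsWithin_iff.2 ⟨?_, Eventually.of_forall hq2⟩
      exact tendsto_of_tendsto_of_tendsto_of_le_of_le tendsto_const_nhds hv3
        (fun n => (hq2 n).le) fun n => (hq3 n).le
    · exact tendsto_principal.2 (Eventually.of_forall hq1)
  have hXm : ∀ t u : ℝ≥0, t ≤ u → StronglyMeasurable[𝓕 u] (X' t) := fun t u h =>
    (stronglyMeasurable_condExp.mono (𝓕.mono h)).indicator (hgm u)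
  have hNm' : ∀ t u : ℝ≥0, t < u → StronglyMeasurable[𝓕 u] (N t) := by
    intro t u htu
    obtain ⟨q, hq1, hq2⟩ := hseq t u htu
    exact stronglyMeasurable_of_tendsto atTop (fun n => hXm (q n) u (hq1 n).2.le)
      (tendsto_pi_nhds.2 fun ω => (hN t ω).comp hq2)
  have := h𝓕.right_continuous
  have hNm : StronglyAdapted 𝓕 N := by
    intro t
    refine Measurable.stronglyMeasurable fun s hs => ?_
    refine Filtration.IsRightContinuous.measurableSet ?_
    rw [Filtration.rightCont_eq]
    simp only [MeasurableSpace.measurableSet_iInf]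
    exact fun u hu => (hNm' t u hu).measurable hs
  refine ⟨N, hcad, hNm, fun t => ?_⟩
  obtain ⟨q, hq1, hq2⟩ := hseq t (t + 1) (by simp)
  have hui := hξ.uniformIntegrable_condExp (fun n => 𝓕.le (q n))
  have hlim : ∀ᵐ ω ∂μ, Tendsto (fun n => X (q n) ω) atTop (𝓝 (N t ω)) := by
    filter_upwards [hae] with ω hω
    have := (hN t ω).comp hq2
    refine this.congr fun n => ?_
    simp [X', hω]
  have hNaesm : AEStronglyMeasurable (N t) μ := ((hNm t).mono (𝓕.le t)).aestronglyMeasurable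
  have hNint : MemLp (N t) 1 μ := hui.memLp_of_ae_tendsto hlim
  have hL1 := tendsto_Lp_finite_of_tendsto_ae le_rfl (by simp)
    (fun n => (stronglyMeasurable_condExp.mono (𝓕.le (q n))).aestronglyMeasurable) hNint hui.2.1 hlim
  refine ae_eq_condExp_of_forall_setIntegral_eq (𝓕.le t) hξ
    (fun s _ _ => (memLp_one_iff_integrable.1 hNint).integrableOn) (fun s hs _ => ?_)
    (hNm t).aestronglyMeasurable
  have h1 : Tendsto (fun n => ∫ ω in s, X (q n) ω ∂μ) atTop (𝓝 (∫ ω in s, N t ω ∂μ)) :=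
    tendsto_setIntegral_of_L1' _ hNaesm
      (Eventually.of_forall fun n => integrable_condExp) hL1 s
  refine tendsto_nhds_unique h1 (tendsto_const_nhds.congr fun n => ?_)
  exact (setIntegral_condExp (𝓕.le _) hξ (𝓕.mono (hq1 n).1.le _ hs)).symm

end

section

variable {Ω : Type*} {mΩ : MeasurableSpace Ω} {μ : Measure Ω} {𝓕 : Filtration ℝ≥0 mΩ} {T : ℝ≥0}

/-! ### Square integrability over the product of the horizon and the sample space -/

/-- The measure `ℙ ⊗ dt` on `Ω × [0, T]`. -/
abbrev horizonMeasure (μ : Measure Ω) (T : ℝ≥0) : Measure (Ω × ℝ) :=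
  μ.prod (volume.restrict (Set.Icc (0 : ℝ) T))

/-- A process as a function on `Ω × ℝ`. -/
def lift (X : ℝ≥0 → Ω → ℝ) : Ω × ℝ → ℝ := fun z => X z.2.toNNReal z.1

lemma eLpNorm_two_sq {α : Type*} {m : MeasurableSpace α} (f : α → ℝ) (ν : Measure α) :
    eLpNorm f 2 ν ^ 2 = ∫⁻ x, ‖f x‖ₑ ^ 2 ∂ν := by
  have := eLpNorm_nnreal_pow_eq_lintegral (μ := ν) (f := f) (p := 2) (by norm_num)
  simpa using this

lemma eLpNorm_two_le_of_sq_le {α : Type*} {m : MeasurableSpace α} {f : α → ℝ} {ν : Measure α}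
    {C : ℝ≥0∞} (h : ∫⁻ x, ‖f x‖ₑ ^ 2 ∂ν ≤ C ^ 2) : eLpNorm f 2 ν ≤ C := by
  rw [← eLpNorm_two_sq] at h
  exact (ENNReal.pow_le_pow_left_iff two_ne_zero).1 h

lemma exists_sq_eq {C : ℝ≥0∞} (hC : C ≠ ∞) : ∃ D : ℝ≥0∞, D ≠ ∞ ∧ D ^ 2 = C :=
  ⟨C ^ (1 / 2 : ℝ), by finiteness, by
    rw [← ENNReal.rpow_natCast, ← ENNReal.rpow_mul]; norm_num⟩

lemma ae_horizon_mem [SFinite μ] : ∀ᵐ z ∂(horizonMeasure μ T), z.2 ∈ Set.Icc (0 : ℝ) T :=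
  Measure.quasiMeasurePreserving_snd.ae (ae_restrict_mem measurableSet_Icc)

/-- Cauchy–Schwarz for the time integral. -/
lemma enorm_integral_sq_le {f : ℝ → ℝ} {s t : ℝ}
    (hf : AEStronglyMeasurable f (volume.restrict (Set.Icc (0 : ℝ) T))) (hs : 0 ≤ s) (hst : s ≤ t)
    (ht : t ≤ T) :
    ‖∫ r in s..t, f r‖ₑ ^ 2 ≤ T * ∫⁻ r in Set.Icc (0 : ℝ) T, ‖f r‖ₑ ^ 2 := by
  set ν := volume.restrict (Set.Icc (0 : ℝ) T)
  have h1 : ‖∫ r in s..t, f r‖ₑ ≤ eLpNorm f 1 ν := by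
    rw [intervalIntegral.integral_of_le hst, eLpNorm_one_eq_lintegral_enorm]
    refine (enorm_integral_le_lintegral_enorm _).trans (lintegral_mono_set fun r hr => ?_)
    exact ⟨hs.trans hr.1.le, hr.2.trans ht⟩
  have h2 := eLpNorm_le_eLpNorm_mul_rpow_measure_univ (p := 1) (q := 2) (by norm_num) hf
  have h3 : (ν Set.univ) = T := by simp [ν]
  rw [h3] at h2
  calc ‖∫ r in s..t, f r‖ₑ ^ 2 ≤ (eLpNorm f 2 ν * (T : ℝ≥0∞) ^ (1 / 2 : ℝ)) ^ 2 := by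
        gcongr
        refine h1.trans (h2.trans (le_of_eq ?_))
        norm_num
    _ = T * ∫⁻ r in Set.Icc (0 : ℝ) T, ‖f r‖ₑ ^ 2 := by
        rw [mul_pow, eLpNorm_two_sq, ← ENNReal.rpow_natCast, ← ENNReal.rpow_mul, mul_comm]
        norm_num [ν]

/-- The running time integral of a square integrable process is square integrable. -/
lemma exists_bound_eLpNorm_primitive [SFinite μ] {f : Ω × ℝ → ℝ}
    (hf : MemLp f 2 (horizonMeasure μ T)) :
    ∃ C : ℝ≥0∞, C ≠ ∞ ∧ ∀ s t : ℝ, 0 ≤ s → s ≤ t → t ≤ T →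
      eLpNorm (fun ω => ∫ r in s..t, f (ω, r)) 2 μ ≤ C := by
  have hfin : (T : ℝ≥0∞) * ∫⁻ z, ‖f z‖ₑ ^ 2 ∂(horizonMeasure μ T) ≠ ∞ := by
    rw [← eLpNorm_two_sq]
    have := hf.2
    finiteness
  obtain ⟨D, hD, hD2⟩ := exists_sq_eq hfin
  refine ⟨D, hD, fun s t hs hst ht => eLpNorm_two_le_of_sq_le ?_⟩
  rw [hD2, lintegral_prod _ (hf.1.enorm.pow_const 2), ← lintegral_const_mul' _ _ (by simp)]
  refine lintegral_mono_ae ?_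
  filter_upwards [hf.1.prodMk_left] with ω hω
  exact enorm_integral_sq_le hω hs hst ht

lemma ae_memLp_path [SFinite μ] {f : Ω × ℝ → ℝ} (hf : MemLp f 2 (horizonMeasure μ T)) :
    ∀ᵐ ω ∂μ, MemLp (fun r => f (ω, r)) 2 (volume.restrict (Set.Icc (0 : ℝ) T)) := by
  have hfin : ∫⁻ z, ‖f z‖ₑ ^ 2 ∂(horizonMeasure μ T) ≠ ∞ := by
    rw [← eLpNorm_two_sq]
    have := hf.2
    finiteness
  rw [lintegral_prod _ (hf.1.enorm.pow_const 2)] at hfin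
  have hm : AEMeasurable (fun ω => ∫⁻ r in Set.Icc (0 : ℝ) T, ‖f (ω, r)‖ₑ ^ 2) μ :=
    (hf.1.enorm.pow_const 2).lintegral_prod_right'
  filter_upwards [hf.1.prodMk_left, ae_lt_top' hm hfin] with ω h1 h2
  refine ⟨h1, ?_⟩
  rw [← eLpNorm_two_sq] at h2
  by_contra hcon
  rw [not_lt, top_le_iff] at hcon
  rw [hcon] at h2
  simp at h2

lemma memLp_intervalIntegrable {f : ℝ → ℝ}
    (hf : MemLp f 2 (volume.restrict (Set.Icc (0 : ℝ) T))) : IntervalIntegrable f volume 0 T := by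
  rw [intervalIntegrable_iff_integrableOn_Icc_of_le T.coe_nonneg]
  exact hf.integrable (by norm_num)

lemma memLp_mul_intervalIntegrable {f g : ℝ → ℝ}
    (hf : MemLp f 2 (volume.restrict (Set.Icc (0 : ℝ) T)))
    (hg : MemLp g 2 (volume.restrict (Set.Icc (0 : ℝ) T))) :
    IntervalIntegrable (fun s => f s * g s) volume 0 T := by
  rw [intervalIntegrable_iff_integrableOn_Icc_of_le T.coe_nonneg]
  exact hf.integrable_mul hg

/-! ### Admissible processes -/

lemma aestronglyMeasurable_lift_of_progressive [SFinite μ] {v : ℝ≥0 → Ω → ℝ}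
    (hv : IsStronglyProgressive 𝓕 (stopAt T v)) :
    AEStronglyMeasurable (lift v) (horizonMeasure μ T) := by
  have h1 := (measurable_stopAt_of_isStronglyProgressive hv T).mono
    (sup_le_sup le_rfl (MeasurableSpace.comap_mono (𝓕.le T))) le_rfl
  have h2 : Measurable fun z : Ω × ℝ => stopAt T v (min z.2.toNNReal T) z.1 :=
    h1.comp measurable_swap
  refine ⟨_, h2.stronglyMeasurable, ?_⟩
  filter_upwards [ae_horizon_mem (μ := μ) (T := T)] with z hz
  have : z.2.toNNReal ≤ T := Real.toNNReal_le_iff_le_coe.2 hz.2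
  simp [lift, stopAt, min_eq_left this]

lemma Admissible.memLp [SFinite μ] {v : ℝ≥0 → Ω → ℝ} (hv : Admissible μ 𝓕 T v) :
    MemLp (lift v) 2 (horizonMeasure μ T) := by
  have hm := aestronglyMeasurable_lift_of_progressive (μ := μ) hv.1
  refine ⟨hm, ?_⟩
  have h1 : ∫⁻ z, ‖lift v z‖ₑ ^ 2 ∂(horizonMeasure μ T) < ∞ := by
    rw [lintegral_prod _ (hm.enorm.pow_const 2)]
    refine lt_of_le_of_lt (le_of_eq ?_) hv.2
    refine lintegral_congr fun ω => lintegral_congr fun s => ?_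
    rw [lift, ← Real.enorm_of_nonneg (sq_nonneg _), enorm_pow]
  rw [← eLpNorm_two_sq] at h1
  by_contra hcon
  rw [not_lt, top_le_iff] at hcon
  rw [hcon] at h1
  simp at h1

lemma admissible_of_memLp [SFinite μ] {v : ℝ≥0 → Ω → ℝ}
    (hp : IsStronglyProgressive 𝓕 (stopAt T v)) (hv : MemLp (lift v) 2 (horizonMeasure μ T)) :
    Admissible μ 𝓕 T v := by
  refine ⟨hp, ?_⟩
  have h1 : ∫⁻ z, ‖lift v z‖ₑ ^ 2 ∂(horizonMeasure μ T) < ∞ := by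
    rw [← eLpNorm_two_sq]
    have := hv.2
    finiteness
  rw [lintegral_prod _ (hv.1.enorm.pow_const 2)] at h1
  refine lt_of_le_of_lt (le_of_eq ?_) h1
  refine lintegral_congr fun ω => lintegral_congr fun s => ?_
  rw [lift, ← Real.enorm_of_nonneg (sq_nonneg _), enorm_pow]

lemma stronglyMeasurable_primitive {v : ℝ≥0 → Ω → ℝ} (hv : IsStronglyProgressive 𝓕 (stopAt T v))
    {t : ℝ≥0} (ht : t ≤ T) :
    StronglyMeasurable[𝓕 t] fun ω => ∫ s in (0 : ℝ)..t, v s.toNNReal ω := by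
  have h1 := (measurable_stopAt_of_isStronglyProgressive hv t).stronglyMeasurable
  have h2 : (fun ω => ∫ s in (0 : ℝ)..t, v s.toNNReal ω) =
      fun ω => ∫ s in Set.Ioc (0 : ℝ) t, stopAt T v (min s.toNNReal t) ω := by
    funext ω
    rw [intervalIntegral.integral_of_le t.coe_nonneg]
    refine setIntegral_congr_fun measurableSet_Ioc fun s hs => ?_
    have : s.toNNReal ≤ t := Real.toNNReal_le_iff_le_coe.2 hs.2
    simp [stopAt, min_eq_left this, min_eq_left (this.trans ht)]
  rw [h2]
  exact @StronglyMeasurable.integral_prod_left ℝ Ω ℝ _ (𝓕 t) _ _ _ _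
    (fun s ω => stopAt T v (min s.toNNReal t) ω) h1

/-! ### Càdlàg adapted processes bounded in mean square -/

/-- Adapted processes with càdlàg paths, frozen at time `T` and bounded in `L²`. -/
structure CadlagL2 (μ : Measure Ω) (𝓕 : Filtration ℝ≥0 mΩ) (T : ℝ≥0) (X : ℝ≥0 → Ω → ℝ) :
    Prop where
  cadlag : ∀ ω, IsCadlag fun t => X t ω
  adapted : StronglyAdapted 𝓕 X
  stopped : ∀ t ω, X (min t T) ω = X t ω
  bounded : ∃ C : ℝ≥0∞, C ≠ ∞ ∧ ∀ t, eLpNorm (X t) 2 μ ≤ C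

namespace CadlagL2

variable {X Y : ℝ≥0 → Ω → ℝ}

lemma stopAt_eq (hX : CadlagL2 μ 𝓕 T X) : stopAt T X = X := by
  funext t ω; exact hX.stopped t ω

lemma aestronglyMeasurable (hX : CadlagL2 μ 𝓕 T X) (t : ℝ≥0) : AEStronglyMeasurable (X t) μ :=
  ((hX.adapted t).mono (𝓕.le t)).aestronglyMeasurable

lemma memLp (hX : CadlagL2 μ 𝓕 T X) (t : ℝ≥0) : MemLp (X t) 2 μ := by
  obtain ⟨C, hC, h⟩ := hX.bounded
  exact ⟨hX.aestronglyMeasurable t, (h t).trans_lt (lt_top_iff_ne_top.2 hC)⟩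

lemma integrable [IsFiniteMeasure μ] (hX : CadlagL2 μ 𝓕 T X) (t : ℝ≥0) : Integrable (X t) μ :=
  (hX.memLp t).integrable (by norm_num)

lemma progressive (hX : CadlagL2 μ 𝓕 T X) : IsStronglyProgressive 𝓕 (stopAt T X) := by
  rw [hX.stopAt_eq]
  exact isStronglyProgressive_of_rightContinuous hX.adapted fun ω t => (hX.cadlag ω t).1

lemma aeCadlag (hX : CadlagL2 μ 𝓕 T X) : AeCadlag μ T X := by
  rw [AeCadlag, hX.stopAt_eq]
  exact ae_of_all _ hX.cadlag

lemma memLp_lift [SFinite μ] (hX : CadlagL2 μ 𝓕 T X) : MemLp (lift X) 2 (horizonMeasure μ T) := by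
  obtain ⟨C, hC, h⟩ := hX.bounded
  have hm := aestronglyMeasurable_lift_of_progressive (μ := μ) hX.progressive
  refine ⟨hm, ?_⟩
  have hfin : (T : ℝ≥0∞) * C ^ 2 ≠ ∞ := by finiteness
  obtain ⟨D, hD, hD2⟩ := exists_sq_eq hfin
  refine lt_of_le_of_lt (eLpNorm_two_le_of_sq_le ?_) (lt_top_iff_ne_top.2 hD)
  rw [hD2, lintegral_prod_symm _ (hm.enorm.pow_const 2)]
  calc ∫⁻ s in Set.Icc (0 : ℝ) T, ∫⁻ ω, ‖lift X (ω, s)‖ₑ ^ 2 ∂μ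
      ≤ ∫⁻ s in Set.Icc (0 : ℝ) T, C ^ 2 := by
        refine lintegral_mono fun s => ?_
        change ∫⁻ ω, ‖X s.toNNReal ω‖ₑ ^ 2 ∂μ ≤ _
        rw [← eLpNorm_two_sq]
        gcongr
        exact h _
    _ = T * C ^ 2 := by simp [mul_comm]

lemma admissible [SFinite μ] (hX : CadlagL2 μ 𝓕 T X) : Admissible μ 𝓕 T X :=
  admissible_of_memLp hX.progressive hX.memLp_lift

lemma add (hX : CadlagL2 μ 𝓕 T X) (hY : CadlagL2 μ 𝓕 T Y) :
    CadlagL2 μ 𝓕 T fun t ω => X t ω + Y t ω where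
  cadlag ω := (hX.cadlag ω).add (hY.cadlag ω)
  adapted t := (hX.adapted t).add (hY.adapted t)
  stopped t ω := by rw [hX.stopped, hY.stopped]
  bounded := by
    obtain ⟨C, hC, h⟩ := hX.bounded
    obtain ⟨D, hD, h'⟩ := hY.bounded
    exact ⟨C + D, by finiteness, fun t => (eLpNorm_add_le (hX.aestronglyMeasurable t)
      (hY.aestronglyMeasurable t) (by norm_num)).trans (add_le_add (h t) (h' t))⟩

/-- Multiplication by a deterministic continuous function of time. -/
lemma mul_deterministic (hX : CadlagL2 μ 𝓕 T X) {c : ℝ → ℝ}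
    (hc : ContinuousOn c (Set.Icc 0 (T : ℝ))) :
    CadlagL2 μ 𝓕 T fun t ω => c (min t T : ℝ≥0) * X t ω where
  cadlag ω := by
    refine (isCadlag_of_continuous ?_).mul (hX.cadlag ω)
    exact hc.comp_continuous (by fun_prop) fun t => ⟨NNReal.coe_nonneg _,
      NNReal.coe_le_coe.2 (min_le_right _ _)⟩
  adapted t := (hX.adapted t).const_mul _
  stopped t ω := by rw [hX.stopped, min_assoc, min_self]
  bounded := by
    obtain ⟨C, hC, h⟩ := hX.bounded
    obtain ⟨B, hB⟩ := isCompact_Icc.exists_bound_of_continuousOn hc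
    refine ⟨ENNReal.ofReal B * C, by finiteness, fun t => ?_⟩
    have hb : ‖c (min t T : ℝ≥0)‖ₑ ≤ ENNReal.ofReal B := by
      rw [← ofReal_norm]
      exact ENNReal.ofReal_le_ofReal (hB _ ⟨NNReal.coe_nonneg _,
        NNReal.coe_le_coe.2 (min_le_right _ _)⟩)
    refine le_trans ?_ (mul_le_mul' hb (h t))
    exact (eLpNorm_const_smul_le (c := c (min t T : ℝ≥0)) (f := X t) (p := 2) (μ := μ))

lemma const_mul (hX : CadlagL2 μ 𝓕 T X) (c : ℝ) : CadlagL2 μ 𝓕 T fun t ω => c * X t ω :=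
  hX.mul_deterministic (c := fun _ => c) continuousOn_const

lemma sub (hX : CadlagL2 μ 𝓕 T X) (hY : CadlagL2 μ 𝓕 T Y) :
    CadlagL2 μ 𝓕 T fun t ω => X t ω - Y t ω := by
  simpa [sub_eq_add_neg] using hX.add (hY.const_mul (-1))

lemma const [IsFiniteMeasure μ] (c : ℝ) : CadlagL2 μ 𝓕 T fun _ _ => c where
  cadlag _ := isCadlag_const c
  adapted _ := stronglyMeasurable_const
  stopped _ _ := rfl
  bounded := ⟨_, (memLp_const c : MemLp (fun _ : Ω => c) 2 μ).2.ne, fun _ => le_rfl⟩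

lemma sum [IsFiniteMeasure μ] {κ : Type*} (s : Finset κ) {Z : κ → ℝ≥0 → Ω → ℝ}
    (hZ : ∀ k ∈ s, CadlagL2 μ 𝓕 T (Z k)) : CadlagL2 μ 𝓕 T fun t ω => ∑ k ∈ s, Z k t ω := by
  classical
  induction s using Finset.induction_on with
  | empty => simpa using const 0
  | insert a s ha ih =>
    simp only [Finset.sum_insert ha]
    exact (hZ a (by simp)).add (ih fun k hk => hZ k (by simp [hk]))

/-- Value at time `0`, as a constant process. -/
lemma initial (hX : CadlagL2 μ 𝓕 T X) : CadlagL2 μ 𝓕 T fun _ ω => X 0 ω where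
  cadlag _ := isCadlag_const _
  adapted _ := (hX.adapted 0).mono (𝓕.mono zero_le)
  stopped _ _ := rfl
  bounded := ⟨_, (hX.memLp 0).2.ne, fun _ => le_rfl⟩

lemma primitive [SFinite μ] (hX : CadlagL2 μ 𝓕 T X) :
    CadlagL2 μ 𝓕 T fun t ω => ∫ s in (0 : ℝ)..(min t T : ℝ≥0), X s.toNNReal ω where
  cadlag ω := isCadlag_of_continuous ((intervalIntegral.continuous_primitive
    (fun a b => (hX.cadlag ω).intervalIntegrable a b) 0).comp (by fun_prop))
  adapted t := (stronglyMeasurable_primitive hX.progressive (min_le_right t T)).mono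
    (𝓕.mono (min_le_left _ _))
  stopped t ω := by rw [min_assoc, min_self]
  bounded := by
    obtain ⟨C, hC, h⟩ := exists_bound_eLpNorm_primitive hX.memLp_lift
    exact ⟨C, hC, fun t => h 0 _ le_rfl (NNReal.coe_nonneg _)
      (NNReal.coe_le_coe.2 (min_le_right _ _))⟩

lemma setIntegral_primitive [IsFiniteMeasure μ] (hX : CadlagL2 μ 𝓕 T X) {B : Set Ω}
    {s t : ℝ≥0} (hst : s ≤ t) (ht : t ≤ T) :
    ∫ ω in B, (∫ r in (s : ℝ)..t, X r.toNNReal ω) ∂μ =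
      ∫ r in (s : ℝ)..t, (∫ ω in B, X r.toNNReal ω ∂μ) := by
  simp only [intervalIntegral.integral_of_le (NNReal.coe_le_coe.2 hst)]
  refine integral_integral_swap ?_
  have h := (hX.memLp_lift.integrable (by norm_num : (1 : ℝ≥0∞) ≤ 2))
  refine h.mono_measure ?_
  refine Measure.prod_mono Measure.restrict_le_self (Measure.restrict_mono (fun r hr => ?_) le_rfl)
  exact ⟨s.2.trans hr.1.le, hr.2.trans (NNReal.coe_le_coe.2 ht)⟩

lemma intervalIntegrable_setIntegral [IsFiniteMeasure μ] (hX : CadlagL2 μ 𝓕 T X) (B : Set Ω)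
    {s t : ℝ≥0} (hst : s ≤ t) (ht : t ≤ T) :
    IntervalIntegrable (fun r : ℝ => ∫ ω in B, X r.toNNReal ω ∂μ) volume s t := by
  rw [intervalIntegrable_iff_integrableOn_Ioc_of_le (NNReal.coe_le_coe.2 hst)]
  have h := (hX.memLp_lift.integrable (by norm_num : (1 : ℝ≥0∞) ≤ 2))
  have h' : Integrable (lift X) ((μ.restrict B).prod (volume.restrict (Set.Ioc (s : ℝ) t))) := by
    refine h.mono_measure (Measure.prod_mono Measure.restrict_le_self
      (Measure.restrict_mono (fun r hr => ?_) le_rfl))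
    exact ⟨s.2.trans hr.1.le, hr.2.trans (NNReal.coe_le_coe.2 ht)⟩
  exact h'.integral_prod_right

lemma congr_eq (hX : CadlagL2 μ 𝓕 T X) (h : ∀ t ω, Y t ω = X t ω) : CadlagL2 μ 𝓕 T Y := by
  have : Y = X := by funext t ω; exact h t ω
  rwa [this]

end CadlagL2

/-- Under the usual conditions, an adapted process with almost surely càdlàg paths on `[0, T]` has
an indistinguishable version all of whose paths are càdlàg. -/
lemma UsualConditions.exists_cadlag_version (h𝓕 : UsualConditions 𝓕 μ) {X : ℝ≥0 → Ω → ℝ}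
    (ha : StronglyAdapted 𝓕 (stopAt T X)) (hc : AeCadlag μ T X) :
    ∃ X' : ℝ≥0 → Ω → ℝ, (∀ ω, IsCadlag fun t => X' t ω) ∧ StronglyAdapted 𝓕 X' ∧
      (∀ t ω, X' (min t T) ω = X' t ω) ∧ ∀ᵐ ω ∂μ, ∀ t ≤ T, X t ω = X' t ω := by
  classical
  set good : Set Ω := {ω | IsCadlag fun t => stopAt T X t ω} with hgood
  refine ⟨fun t => good.indicator (stopAt T X t), fun ω => ?_, fun t =>
    (ha t).indicator (h𝓕.measurableSet_of_ae hc t), fun t ω => ?_, ?_⟩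
  · by_cases hω : ω ∈ good
    · simp only [Set.indicator_of_mem hω]; exact hω
    · simp only [Set.indicator_of_notMem hω]; exact isCadlag_const 0
  · simp [Set.indicator, stopAt]
  · filter_upwards [hc] with ω hω t ht
    have hω' : ω ∈ good := hω
    simp [Set.indicator_of_mem hω', stopAt, min_eq_left ht]

/-! ### The driving semimartingale -/

/-- A sequence bounded in `L²` that converges almost surely converges in `L¹`. -/
lemma tendsto_setIntegral_of_bounded_L2 [IsFiniteMeasure μ] {f : ℕ → Ω → ℝ} {g : Ω → ℝ} {C : ℝ≥0∞}
    (hC : C ≠ ∞) (hf : ∀ n, AEStronglyMeasurable (f n) μ) (hb : ∀ n, eLpNorm (f n) 2 μ ≤ C)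
    (hlim : ∀ᵐ ω ∂μ, Tendsto (fun n => f n ω) atTop (𝓝 (g ω))) :
    eLpNorm g 2 μ ≤ C ∧ ∀ s, Tendsto (fun n => ∫ ω in s, f n ω ∂μ) atTop (𝓝 (∫ ω in s, g ω ∂μ)) := by
  have hg : AEStronglyMeasurable g μ := aestronglyMeasurable_of_tendsto_ae atTop hf hlim
  have hgC : eLpNorm g 2 μ ≤ C := Lp.eLpNorm_le_of_ae_tendsto (Eventually.of_forall hb) hf hlim
  have hgL : MemLp g 2 μ := ⟨hg, hgC.trans_lt (lt_top_iff_ne_top.2 hC)⟩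
  have hfL : ∀ n, MemLp (f n) 2 μ := fun n => ⟨hf n, (hb n).trans_lt (lt_top_iff_ne_top.2 hC)⟩
  refine ⟨hgC, fun s => ?_⟩
  have hui : UnifIntegrable f 1 μ := by
    intro ε hε
    have hC0 : 0 < C.toReal + 1 := by positivity
    refine ⟨(ε / (C.toReal + 1)) ^ 2, by positivity, fun n s hs hμs => ?_⟩
    rw [eLpNorm_indicator_eq_eLpNorm_restrict hs]
    have h2 := eLpNorm_le_eLpNorm_mul_rpow_measure_univ (p := 1) (q := 2) (μ := μ.restrict s)
      (by norm_num) (hf n).restrict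
    refine h2.trans ?_
    have h3 : eLpNorm (f n) 2 (μ.restrict s) ≤ ENNReal.ofReal (C.toReal + 1) := by
      refine (eLpNorm_mono_measure _ Measure.restrict_le_self).trans ((hb n).trans ?_)
      rw [← ENNReal.ofReal_toReal hC]
      exact ENNReal.ofReal_le_ofReal (by rw [ENNReal.toReal_ofReal ENNReal.toReal_nonneg]; linarith)
    have h4 : (μ.restrict s Set.univ) ^ (1 / (1 : ℝ≥0∞).toReal - 1 / (2 : ℝ≥0∞).toReal) ≤
        ENNReal.ofReal (ε / (C.toReal + 1)) := by
      rw [Measure.restrict_apply_univ]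
      calc μ s ^ (1 / (1 : ℝ≥0∞).toReal - 1 / (2 : ℝ≥0∞).toReal)
          ≤ ENNReal.ofReal ((ε / (C.toReal + 1)) ^ 2) ^
            (1 / (1 : ℝ≥0∞).toReal - 1 / (2 : ℝ≥0∞).toReal) := by
              gcongr
              norm_num
        _ = ENNReal.ofReal (ε / (C.toReal + 1)) := by
              rw [ENNReal.ofReal_pow (by positivity), ← ENNReal.rpow_natCast, ← ENNReal.rpow_mul]
              norm_num
    refine (mul_le_mul' h3 h4).trans (le_of_eq ?_)
    rw [← ENNReal.ofReal_mul hC0.le, mul_div_cancel₀ _ hC0.ne']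
  have hL1 := tendsto_Lp_finite_of_tendsto_ae le_rfl (by simp) hf
    (hgL.mono_exponent (by norm_num : (1 : ℝ≥0∞) ≤ 2)) hui hlim
  exact tendsto_setIntegral_of_L1' _ hg (Eventually.of_forall fun n =>
    (hfL n).integrable (by norm_num)) hL1 s

lemma martingale_of_setIntegral_eq [IsFiniteMeasure μ] {M : ℝ≥0 → Ω → ℝ} (ha : StronglyAdapted 𝓕 M)
    (hi : ∀ t, Integrable (M t) μ)
    (h : ∀ s t, s ≤ t → ∀ B, MeasurableSet[𝓕 s] B → ∫ ω in B, M s ω ∂μ = ∫ ω in B, M t ω ∂μ) :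
    Martingale M 𝓕 μ := by
  refine ⟨ha, fun s t hst => ?_⟩
  refine (ae_eq_condExp_of_forall_setIntegral_eq (𝓕.le s) (hi t)
    (fun B _ _ => (hi s).integrableOn) (fun B hB _ => h s t hst B hB)
    (ha s).aestronglyMeasurable).symm

/-- Along the localizing sequence the second moments of `L - L₀` are at most `E⟨L⟩_T`, so `L - L₀`
is a true martingale, bounded in `L²`. -/
lemma exists_martingale_version [IsFiniteMeasure μ] (h𝓕 : UsualConditions 𝓕 μ)
    {L B : ℝ≥0 → Ω → ℝ} (hcL : AeCadlag μ T L) (hB : IsAngleBracket μ 𝓕 T L B)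
    (hBT : ∫⁻ ω, ENNReal.ofReal (B T ω) ∂μ < ∞) :
    ∃ W : ℝ≥0 → Ω → ℝ, CadlagL2 μ 𝓕 T W ∧ Martingale W 𝓕 μ ∧
      ∀ᵐ ω ∂μ, ∀ t ≤ T, L t ω - L 0 ω = W t ω := by
  set D : ℝ≥0 → Ω → ℝ := stopAt T fun t ω => L t ω - L 0 ω with hD
  obtain ⟨τ, hτ, hmart⟩ := hB.bracket
  set Z : ℕ → ℝ≥0 → Ω → ℝ × ℝ := fun n => stoppedProcess (fun i ↦ {ω | ⊥ < τ n ω}.indicator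
    (stopAt T (fun t ω => (L t ω - L 0 ω, B t ω)) i)) (τ n) with hZ
  have hBTm : AEStronglyMeasurable (B T) μ := by
    have := (hB.predictable.stronglyAdapted T).mono (𝓕.le T)
    have e : stopAt T B T = B T := by funext ω; simp [stopAt]
    exact e ▸ this.aestronglyMeasurable
  have hB0 : 0 ≤ᵐ[μ] B T := by
    filter_upwards [hB.zero, hB.mono] with ω h0 hm
    have := hm (zero_le : (0 : ℝ≥0) ≤ T) (le_refl T) zero_le
    simp only [h0] at this
    exact this
  have hBint : Integrable (B T) μ := by
    refine ⟨hBTm, ?_⟩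
    rw [hasFiniteIntegral_iff_ofReal hB0]
    exact hBT
  obtain ⟨C, hC, hC2⟩ := exists_sq_eq (C := ENNReal.ofReal (∫ ω, B T ω ∂μ)) (by finiteness)
  have hbound : ∀ n t, eLpNorm (fun ω => (Z n t ω).1) 2 μ ≤ C := by
    intro n t
    refine eLpNorm_two_le_of_sq_le ?_
    rw [hC2]
    obtain ⟨-, h2⟩ := hmart n
    have hle : ∀ᵐ ω ∂μ, (Z n t ω).1 ^ 2 ≤ ((Z n t ω).1 ^ 2 - (Z n t ω).2) + B T ω := by
      filter_upwards [hB.mono, hB0] with ω hm h0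
      have : (Z n t ω).2 ≤ B T ω := by
        simp only [hZ, stoppedProcess, Set.indicator, stopAt]
        split_ifs
        · exact hm (min_le_right _ T) (le_refl T) (min_le_right _ _)
        · exact h0
      linarith
    have hint : Integrable (fun ω => ((Z n t ω).1 ^ 2 - (Z n t ω).2) + B T ω) μ :=
      (h2.integrable t).add hBint
    calc ∫⁻ ω, ‖(Z n t ω).1‖ₑ ^ 2 ∂μ
        ≤ ∫⁻ ω, ENNReal.ofReal (((Z n t ω).1 ^ 2 - (Z n t ω).2) + B T ω) ∂μ := by
          refine lintegral_mono_ae ?_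
          filter_upwards [hle] with ω hω
          rw [← enorm_pow, Real.enorm_of_nonneg (sq_nonneg _)]
          exact ENNReal.ofReal_le_ofReal hω
      _ = ENNReal.ofReal (∫ ω, (((Z n t ω).1 ^ 2 - (Z n t ω).2) + B T ω) ∂μ) := by
          refine (ofReal_integral_eq_lintegral_ofReal hint ?_).symm
          filter_upwards [hle] with ω hω
          exact (sq_nonneg _).trans hω
      _ = ENNReal.ofReal (∫ ω, B T ω ∂μ) := by
          rw [integral_add (h2.integrable t) hBint]
          have e1 := h2.setIntegral_eq (zero_le : 0 ≤ t) MeasurableSet.univ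
          simp only [Measure.restrict_univ] at e1
          have e0 : ∫ ω, ((Z n 0 ω).1 ^ 2 - (Z n 0 ω).2) ∂μ = 0 := by
            refine integral_eq_zero_of_ae ?_
            filter_upwards [hB.zero] with ω h0
            have hb : (↑(0 : ℝ≥0) : WithTop ℝ≥0) ≤ τ n ω := bot_le
            simp only [hZ]
            rw [stoppedProcess_eq_of_le hb]
            simp only [Set.indicator, stopAt]
            split_ifs <;> simp [h0]
          rw [← e1, e0, zero_add]
  have hlim : ∀ t, ∀ᵐ ω ∂μ, Tendsto (fun n => (Z n t ω).1) atTop (𝓝 (D t ω)) := by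
    intro t
    filter_upwards [hτ.tendsto_top] with ω hω
    have := (WithTop.tendsto_nhds_top_iff _).1 hω t
    refine tendsto_const_nhds.congr' ?_
    filter_upwards [this] with n hn
    simp only [hZ]
    rw [stoppedProcess_eq_of_le hn.le, Set.indicator_of_mem]
    · rfl
    · exact lt_of_le_of_lt bot_le hn
  have hZm : ∀ n t, StronglyMeasurable[𝓕 t] (fun ω => (Z n t ω).1) := fun n t =>
    (hmart n).1.stronglyAdapted t
  have hDlim := fun t => tendsto_setIntegral_of_bounded_L2 hC
    (fun n => ((hZm n t).mono (𝓕.le t)).aestronglyMeasurable) (fun n => hbound n t) (hlim t)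
  have hDa : StronglyAdapted 𝓕 D := by
    intro t
    -- the almost sure limit is measurable because the filtration is complete
    have h1 : StronglyMeasurable[𝓕 t] (fun ω => limsup (fun n => (Z n t ω).1) atTop) :=
      (Measurable.limsup fun n => (hZm n t).measurable).stronglyMeasurable
    refine h𝓕.stronglyMeasurable_congr h1 ?_
    filter_upwards [hlim t] with ω hω using hω.limsup_eq
  have hDc : AeCadlag μ T fun t ω => L t ω - L 0 ω := by
    filter_upwards [hcL] with ω hω
    exact hω.sub (isCadlag_const (L 0 ω))
  obtain ⟨W, hW1, hW2, hW3, hW4⟩ := h𝓕.exists_cadlag_version (T := T)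
    (X := fun t ω => L t ω - L 0 ω) hDa hDc
  have hWD : ∀ t, W t =ᵐ[μ] D t := by
    intro t
    filter_upwards [hW4] with ω hω
    rw [← hW3, ← hω _ (min_le_right _ _)]
    rfl
  have hWL : CadlagL2 μ 𝓕 T W := ⟨hW1, hW2, hW3, C, hC, fun t => by
    rw [eLpNorm_congr_ae (hWD t)]; exact (hDlim t).1⟩
  refine ⟨W, hWL, martingale_of_setIntegral_eq hW2 hWL.integrable fun s t hst S hS => ?_, hW4⟩
  rw [setIntegral_congr_ae (g := D s) (𝓕.le s _ hS) ((hWD s).mono fun ω h _ => h),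
    setIntegral_congr_ae (g := D t) (𝓕.le s _ hS) ((hWD t).mono fun ω h _ => h)]
  refine tendsto_nhds_unique ((hDlim s).2 S) (((hDlim t).2 S).congr fun n => ?_)
  exact ((hmart n).1.setIntegral_eq hst hS).symm

/-- Since `A 0 = 0`, the total variation of `A` dominates its paths, so `A` agrees on `[0, T]` with a
càdlàg process dominated by a square integrable variable. -/
lemma exists_finiteVariation_version (h𝓕 : UsualConditions 𝓕 μ)
    {P L A : ℝ≥0 → Ω → ℝ} (hP : IsH2Semimartingale μ 𝓕 T P L A) :
    ∃ A' : ℝ≥0 → Ω → ℝ, CadlagL2 μ 𝓕 T A' ∧ ∀ᵐ ω ∂μ, ∀ t ≤ T, A t ω = A' t ω := by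
  obtain ⟨A', h1, h2, h3, h4⟩ := h𝓕.exists_cadlag_version hP.predictable.stronglyAdapted hP.cadlag_A
  obtain ⟨C, hC, hC2⟩ := exists_sq_eq hP.variation.ne
  refine ⟨A', ⟨h1, h2, h3, C, hC, fun t => eLpNorm_two_le_of_sq_le ?_⟩, h4⟩
  rw [hC2]
  refine lintegral_mono_ae ?_
  filter_upwards [h4, hP.zero_A] with ω hω h0
  gcongr
  rw [← h3, ← hω _ (min_le_right _ _)]
  have := eVariationOn.edist_le (fun t => A t ω) (s := Set.Iic T) (x := min t T) (y := 0)
    (Set.mem_Iic.2 (min_le_right _ _)) (zero_le : (0 : ℝ≥0) ≤ T)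
  simpa [h0, edist_eq_enorm_sub] using this

end

section

/-! ### Linear boundary value problems -/

section Deterministic

open Matrix

variable {ι : Type*} [Fintype ι] [DecidableEq ι]

omit [DecidableEq ι] in
/-- The product rule for a `C¹` matrix function and a vector of primitives. -/
lemma integral_mulVec_primitive {A A' : ℝ → Matrix ι ι ℝ} {φ f : ℝ → ι → ℝ} {s t : ℝ}
    (hA : ∀ r ∈ Set.uIcc s t, ∀ i j, HasDerivAt (fun r => A r i j) (A' r i j) r)
    (hA' : ∀ i j, ContinuousOn (fun r => A' r i j) (Set.uIcc s t))
    (hf : ∀ j, IntervalIntegrable (fun r => f r j) volume s t)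
    (hφ : ∀ j, ∀ r ∈ Set.uIcc s t, φ r j = φ s j + ∫ u in s..r, f u j) (i : ι) :
    IntervalIntegrable (fun r => (A' r *ᵥ φ r) i + (A r *ᵥ f r) i) volume s t ∧
      ∫ r in s..t, ((A' r *ᵥ φ r) i + (A r *ᵥ f r) i) = (A t *ᵥ φ t) i - (A s *ᵥ φ s) i := by
  have hcφ : ∀ j, ContinuousOn (fun r => φ r j) (Set.uIcc s t) := fun j =>
    ((continuousOn_const (c := φ s j)).add (intervalIntegral.continuousOn_primitive_interval' (hf j)
      Set.left_mem_uIcc)).congr (hφ j)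
  have hint : ∀ j, IntervalIntegrable (fun r => A' r i j * φ r j + A r i j * f r j) volume s t :=
    fun j => (((hA' i j).mul (hcφ j)).intervalIntegrable).add ((hf j).continuousOn_mul
      fun r hr => (hA r hr i j).continuousAt.continuousWithinAt)
  have e : (fun r => (A' r *ᵥ φ r) i + (A r *ᵥ f r) i) =
      fun r => ∑ j, (A' r i j * φ r j + A r i j * f r j) := by
    funext r
    simp only [mulVec, dotProduct, Finset.sum_add_distrib]
  rw [e]
  constructor
  · have := IntervalIntegrable.sum Finset.univ (fun j _ => hint j)
    exact this.congr (fun r _ => by simp)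
  · rw [intervalIntegral.integral_finsetSum fun j _ => hint j]
    simp only [mulVec, dotProduct, ← Finset.sum_sub_distrib]
    refine Finset.sum_congr rfl fun j _ => ?_
    exact integral_C1_mul_primitive (fun r hr => hA r hr i j) (hA' i j) (hf j) _ (hφ j)

/-- The flow `e^{tF}` of a linear system. -/
def flow (F : Matrix ι ι ℝ) (t : ℝ) : Matrix ι ι ℝ := NormedSpace.exp (t • F)

section Norm

attribute [local instance] Matrix.linftyOpNormedRing Matrix.linftyOpNormedAlgebra

lemma flow_zero (F : Matrix ι ι ℝ) : flow F 0 = 1 := by simp [flow]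

lemma flow_add (F : Matrix ι ι ℝ) (s t : ℝ) : flow F (s + t) = flow F s * flow F t := by
  unfold flow
  rw [add_smul]
  exact NormedSpace.exp_add_of_commute (((Commute.refl F).smul_left s).smul_right t)

lemma isUnit_flow (F : Matrix ι ι ℝ) (t : ℝ) : IsUnit (flow F t) :=
  NormedSpace.isUnit_exp _

/-- Matrix entries as a continuous linear functional. -/
def entryCLM (i j : ι) : Matrix ι ι ℝ →L[ℝ] ℝ :=
  LinearMap.toContinuousLinearMap (Matrix.entryLinearMap ℝ ℝ i j)

lemma hasDerivAt_entry {A : ℝ → Matrix ι ι ℝ} {A' : Matrix ι ι ℝ} {t : ℝ} (h : HasDerivAt A A' t)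
    (i j : ι) : HasDerivAt (fun r => A r i j) (A' i j) t :=
  (entryCLM i j).hasFDerivAt.comp_hasDerivAt t h

lemma hasDerivAt_flow (F : Matrix ι ι ℝ) (t : ℝ) : HasDerivAt (flow F) (F * flow F t) t :=
  hasDerivAt_exp_smul_const' F t

lemma hasDerivAt_flow_entry (F : Matrix ι ι ℝ) (t : ℝ) (i j : ι) :
    HasDerivAt (fun r => flow F r i j) ((F * flow F t) i j) t :=
  hasDerivAt_entry (hasDerivAt_flow F t) i j

/-- The same derivative with the generator on the right. -/
lemma hasDerivAt_flow_entry' (F : Matrix ι ι ℝ) (t : ℝ) (i j : ι) :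
    HasDerivAt (fun r => flow F r i j) ((flow F t * F) i j) t :=
  hasDerivAt_entry (hasDerivAt_exp_smul_const F t) i j

lemma hasDerivAt_const_mul_flow (C F : Matrix ι ι ℝ) (t : ℝ) :
    HasDerivAt (fun r => C * flow F r) (C * (F * flow F t)) t :=
  (hasDerivAt_flow F t).const_mul C

lemma hasDerivAt_inv {A : ℝ → Matrix ι ι ℝ} {A' : Matrix ι ι ℝ} {t : ℝ} (h : HasDerivAt A A' t)
    (hu : IsUnit (A t)) : HasDerivAt (fun r => (A r)⁻¹) (-((A t)⁻¹ * A' * (A t)⁻¹)) t := by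
  obtain ⟨u, hu⟩ := hu
  have h1 := hasFDerivAt_ringInverse (𝕜 := ℝ) u
  rw [hu] at h1
  have h2 := h1.comp_hasDerivAt t h
  simp only [nonsing_inv_eq_ringInverse]
  refine h2.congr_deriv ?_
  have : ((u⁻¹ : (Matrix ι ι ℝ)ˣ) : Matrix ι ι ℝ) = Ring.inverse (A t) := by
    rw [← hu, Ring.inverse_unit]
  simp [this, ContinuousLinearMap.mulLeftRight_apply]

lemma hasDerivAt_flow_mul {A : ℝ → Matrix ι ι ℝ} {A' : Matrix ι ι ℝ} {t : ℝ} (F : Matrix ι ι ℝ)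
    (h : HasDerivAt A A' t) :
    HasDerivAt (fun r => flow F r * A r) (F * flow F t * A t + flow F t * A') t :=
  (hasDerivAt_flow F t).mul h

lemma continuousAt_of_hasDerivAt_matrix {A : ℝ → Matrix ι ι ℝ} {A' : Matrix ι ι ℝ} {t : ℝ}
    (h : HasDerivAt A A' t) : ContinuousAt A t := h.continuousAt

lemma hasDerivAt_add_const_matrix {A : ℝ → Matrix ι ι ℝ} {A' : Matrix ι ι ℝ} {t : ℝ}
    (h : HasDerivAt A A' t) (C : Matrix ι ι ℝ) : HasDerivAt (fun r => A r + C) A' t :=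
  h.add_const C

variable (F C : Matrix ι ι ℝ) (fwd : ι → Prop) [DecidablePred fwd] (T : ℝ)

/-- The projection onto the forward coordinates. -/
def fwdProj : Matrix ι ι ℝ := Matrix.diagonal fun i => if fwd i then 1 else 0

/-- The matrix whose forward rows are those of the identity and whose backward rows are those of
`C e^{(T - t) F}`: it expresses the state through the forward coordinates and the propagated
terminal conditions. -/
def boundaryMatrix (t : ℝ) : Matrix ι ι ℝ :=
  fwdProj fwd + (1 - fwdProj fwd) * (C * flow F (T - t))

/-- `boundaryMatrix` transported by the flow. -/
def transportMatrix (t : ℝ) : Matrix ι ι ℝ :=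
  fwdProj fwd * flow F t + (1 - fwdProj fwd) * (C * flow F T)

lemma fwdProj_mul_self : fwdProj fwd * fwdProj fwd = fwdProj fwd := by
  unfold fwdProj
  rw [diagonal_mul_diagonal]
  congr 1; funext i; split_ifs <;> simp

lemma boundaryMatrix_mul_flow (t : ℝ) :
    boundaryMatrix F C fwd T t * flow F t = transportMatrix F C fwd T t := by
  unfold boundaryMatrix transportMatrix
  rw [add_mul, mul_assoc, mul_assoc, ← flow_add, sub_add_cancel]

lemma isUnit_transportMatrix {t : ℝ} (h : (boundaryMatrix F C fwd T t).det ≠ 0) :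
    IsUnit (transportMatrix F C fwd T t) := by
  rw [← boundaryMatrix_mul_flow]
  exact ((Matrix.isUnit_iff_isUnit_det _).2 (isUnit_iff_ne_zero.2 h)).mul (isUnit_flow F t)

lemma hasDerivAt_transportMatrix (t : ℝ) :
    HasDerivAt (transportMatrix F C fwd T) (fwdProj fwd * (F * flow F t)) t :=
  hasDerivAt_add_const_matrix (hasDerivAt_const_mul_flow _ _ _) _

/-- The inverse of `transportMatrix`. -/
def transportInv (t : ℝ) : Matrix ι ι ℝ := (transportMatrix F C fwd T t)⁻¹

variable {F C fwd T}

lemma transport_mul_inv {t : ℝ} (h : (boundaryMatrix F C fwd T t).det ≠ 0) :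
    transportMatrix F C fwd T t * transportInv F C fwd T t = 1 :=
  mul_nonsing_inv _ ((Matrix.isUnit_iff_isUnit_det _).1 (isUnit_transportMatrix F C fwd T h))

lemma flow_mul_inv_mul_boundary {t : ℝ} (h : (boundaryMatrix F C fwd T t).det ≠ 0) :
    flow F t * transportInv F C fwd T t * boundaryMatrix F C fwd T t = 1 := by
  have := transport_mul_inv h
  rw [← boundaryMatrix_mul_flow, mul_assoc] at this
  exact mul_eq_one_comm.1 this

lemma fwdProj_mul_flow_mul_inv {t : ℝ} (h : (boundaryMatrix F C fwd T t).det ≠ 0) :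
    fwdProj fwd * (flow F t * transportInv F C fwd T t) = fwdProj fwd := by
  have h1 : fwdProj fwd * transportMatrix F C fwd T t = fwdProj fwd * flow F t := by
    unfold transportMatrix
    rw [mul_add, ← mul_assoc, fwdProj_mul_self, ← mul_assoc (fwdProj fwd), mul_sub,
      fwdProj_mul_self, mul_one, sub_self, zero_mul, add_zero]
  rw [← mul_assoc, ← h1, mul_assoc, transport_mul_inv h, mul_one]

lemma hasDerivAt_transportInv {t : ℝ} (h : (boundaryMatrix F C fwd T t).det ≠ 0) :
    HasDerivAt (transportInv F C fwd T) (-(transportInv F C fwd T t *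
      (fwdProj fwd * (F * flow F t)) * transportInv F C fwd T t)) t :=
  hasDerivAt_inv (hasDerivAt_transportMatrix F C fwd T t) (isUnit_transportMatrix F C fwd T h)

lemma continuousAt_transportInv {t : ℝ} (h : (boundaryMatrix F C fwd T t).det ≠ 0) :
    ContinuousAt (transportInv F C fwd T) t :=
  continuousAt_of_hasDerivAt_matrix (hasDerivAt_transportInv h)

end Norm

lemma continuous_flow (F : Matrix ι ι ℝ) : Continuous (flow F) :=
  continuous_iff_continuousAt.2 fun t => continuousAt_of_hasDerivAt_matrix (hasDerivAt_flow F t)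

variable {F C : Matrix ι ι ℝ} {fwd : ι → Prop} [DecidablePred fwd] {T : ℝ}

/-- If `α' = R (π k + π F e^{rF} R l)`, the forward coordinates of `m = e^{rF} (R l + α)` solve
`m' = F m + k`. -/
lemma forward_coordinates_eq (hdet : ∀ t ∈ Set.Icc 0 T, (boundaryMatrix F C fwd T t).det ≠ 0)
    {l α k : ℝ → ι → ℝ} {s t : ℝ} (hs : 0 ≤ s) (hst : s ≤ t) (htT : t ≤ T)
    (hα' : ∀ j, IntervalIntegrable (fun r => ((transportInv F C fwd T r * fwdProj fwd) *ᵥ k r +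
      (transportInv F C fwd T r * (fwdProj fwd * (F * (flow F r * transportInv F C fwd T r)))) *ᵥ
        l r) j) volume s t)
    (hα : ∀ j, ∀ r ∈ Set.uIcc s t, α r j = α s j + ∫ u in s..r,
      ((transportInv F C fwd T u * fwdProj fwd) *ᵥ k u +
      (transportInv F C fwd T u * (fwdProj fwd * (F * (flow F u * transportInv F C fwd T u)))) *ᵥ
        l u) j) {i : ι} (hi : fwd i) :
    (flow F t *ᵥ α t) i - (flow F s *ᵥ α s) i =
      ∫ r in s..t, ((F *ᵥ ((flow F r * transportInv F C fwd T r) *ᵥ l r + flow F r *ᵥ α r)) i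
        + k r i) := by
  have hmem : ∀ r ∈ Set.uIcc s t, r ∈ Set.Icc 0 T := fun r hr => by
    rw [Set.uIcc_of_le hst] at hr
    exact ⟨hs.trans hr.1, hr.2.trans htT⟩
  obtain ⟨-, h⟩ := integral_mulVec_primitive (A := flow F) (A' := fun r => F * flow F r)
    (fun r _ i j => hasDerivAt_flow_entry F r i j)
    (fun i j => ((continuous_const.matrix_mul (continuous_flow F)).matrix_elem i j).continuousOn)
    hα' hα i
  rw [← h]
  refine intervalIntegral.integral_congr fun r hr => ?_
  have hproj : ∀ v : ι → ℝ, (fwdProj fwd *ᵥ v) i = v i := fun v => by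
    simp [fwdProj, mulVec_diagonal, hi]
  have hP := fwdProj_mul_flow_mul_inv (hdet r (hmem r hr))
  rw [← hproj (flow F r *ᵥ _)]
  simp only [mulVec_add, mulVec_mulVec, ← mul_assoc] at hP ⊢
  simp only [hP, fwdProj_mul_self]
  have h1 := hproj (k r)
  have h2 := hproj ((F * flow F r * transportInv F C fwd T r) *ᵥ l r)
  simp only [mulVec_mulVec, ← mul_assoc] at h1 h2
  simp only [Pi.add_apply, h1, h2]
  ring

/-- If moreover `l' = (1 - π) C e^{(T-r)F} k`, all coordinates of `m = e^{rF} (R l + α)` solve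
`m' = F m + k`. -/
lemma all_coordinates_eq (hdet : ∀ t ∈ Set.Icc 0 T, (boundaryMatrix F C fwd T t).det ≠ 0)
    {l α k : ℝ → ι → ℝ} {s t : ℝ} (hs : 0 ≤ s) (hst : s ≤ t) (htT : t ≤ T)
    (hα' : ∀ j, IntervalIntegrable (fun r => ((transportInv F C fwd T r * fwdProj fwd) *ᵥ k r +
      (transportInv F C fwd T r * (fwdProj fwd * (F * (flow F r * transportInv F C fwd T r)))) *ᵥ
        l r) j) volume s t)
    (hα : ∀ j, ∀ r ∈ Set.uIcc s t, α r j = α s j + ∫ u in s..r,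
      ((transportInv F C fwd T u * fwdProj fwd) *ᵥ k u +
      (transportInv F C fwd T u * (fwdProj fwd * (F * (flow F u * transportInv F C fwd T u)))) *ᵥ
        l u) j)
    (hl' : ∀ j, IntervalIntegrable (fun r => (((1 - fwdProj fwd) * (C * flow F (T - r))) *ᵥ k r) j)
      volume s t)
    (hl : ∀ j, ∀ r ∈ Set.uIcc s t, l r j = l s j + ∫ u in s..r,
      (((1 - fwdProj fwd) * (C * flow F (T - u))) *ᵥ k u) j) (i : ι) :
    ((flow F t * transportInv F C fwd T t) *ᵥ l t + flow F t *ᵥ α t) i -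
      ((flow F s * transportInv F C fwd T s) *ᵥ l s + flow F s *ᵥ α s) i =
      ∫ r in s..t, ((F *ᵥ ((flow F r * transportInv F C fwd T r) *ᵥ l r + flow F r *ᵥ α r)) i
        + k r i) := by
  have hmem : ∀ r ∈ Set.uIcc s t, r ∈ Set.Icc 0 T := fun r hr => by
    rw [Set.uIcc_of_le hst] at hr
    exact ⟨hs.trans hr.1, hr.2.trans htT⟩
  obtain ⟨i1, h1⟩ := integral_mulVec_primitive (A := flow F) (A' := fun r => F * flow F r)
    (fun r _ i j => hasDerivAt_flow_entry F r i j)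
    (fun i j => ((continuous_const.matrix_mul (continuous_flow F)).matrix_elem i j).continuousOn)
    hα' hα i
  have hcR : ContinuousOn (transportInv F C fwd T) (Set.uIcc s t) := fun r hr =>
    (continuousAt_transportInv (hdet r (hmem r hr))).continuousWithinAt
  have hcE : ContinuousOn (flow F) (Set.uIcc s t) := (continuous_flow F).continuousOn
  have hcA : ContinuousOn (fun r => F * flow F r * transportInv F C fwd T r + flow F r *
      -(transportInv F C fwd T r * (fwdProj fwd * (F * flow F r)) * transportInv F C fwd T r))
      (Set.uIcc s t) := ((continuousOn_const.mul hcE).mul hcR).add (hcE.mul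
        ((hcR.mul (continuousOn_const.mul (continuousOn_const.mul hcE))).mul hcR).neg)
  obtain ⟨i2, h2⟩ := integral_mulVec_primitive (A := fun r => flow F r * transportInv F C fwd T r)
    (A' := fun r => F * flow F r * transportInv F C fwd T r + flow F r *
      -(transportInv F C fwd T r * (fwdProj fwd * (F * flow F r)) * transportInv F C fwd T r))
    (fun r hr i j => hasDerivAt_entry
      (hasDerivAt_flow_mul F (hasDerivAt_transportInv (hdet r (hmem r hr)))) i j)
    (fun i j => (entryCLM i j).continuous.comp_continuousOn hcA)
    hl' hl i
  have hsplit : ((flow F t * transportInv F C fwd T t) *ᵥ l t + flow F t *ᵥ α t) i -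
      ((flow F s * transportInv F C fwd T s) *ᵥ l s + flow F s *ᵥ α s) i =
      (((flow F t * transportInv F C fwd T t) *ᵥ l t) i -
        ((flow F s * transportInv F C fwd T s) *ᵥ l s) i) +
      ((flow F t *ᵥ α t) i - (flow F s *ᵥ α s) i) := by
    simp only [Pi.add_apply]; ring
  rw [hsplit, ← h1, ← h2, ← intervalIntegral.integral_add i2 i1]
  refine intervalIntegral.integral_congr fun r hr => ?_
  have hS := flow_mul_inv_mul_boundary (hdet r (hmem r hr))
  unfold boundaryMatrix at hS
  have hk : k r = (flow F r * transportInv F C fwd T r *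
      (fwdProj fwd + (1 - fwdProj fwd) * (C * flow F (T - r)))) *ᵥ k r := by
    rw [hS, one_mulVec]
  have hk' := congrFun hk i
  rw [hk']
  simp only [mulVec_add, mulVec_mulVec, add_mulVec, mul_add, Pi.add_apply, ← mul_assoc,
    mul_neg, neg_mulVec, Pi.neg_apply]
  ring

end Deterministic

end

section

/-! ### Linear forward-backward systems -/

lemma IsCadlag.stopped {f : ℝ≥0 → ℝ} (hf : IsCadlag f) (T : ℝ≥0) :
    IsCadlag fun t => f (min t T) := by
  intro t
  rcases lt_trichotomy t T with h | h | h
  · have e : (fun s => f (min s T)) =ᶠ[𝓝 t] f := by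
      filter_upwards [Iio_mem_nhds h] with s hs
      rw [min_eq_left (le_of_lt hs)]
    obtain ⟨h1, l, hl⟩ := hf t
    exact ⟨(h1.congr_of_eventuallyEq (e.filter_mono nhdsWithin_le_nhds) e.self_of_nhds),
      l, hl.congr' (e.filter_mono nhdsWithin_le_nhds).symm⟩
  · obtain ⟨-, l, hl⟩ := hf t
    refine ⟨?_, l, hl.congr' ?_⟩
    · refine (continuousWithinAt_const (b := f T)).congr (fun s hs => ?_) ?_
      · rw [min_eq_right (h ▸ hs)]
      · rw [min_eq_right h.ge]
    · filter_upwards [self_mem_nhdsWithin] with s hs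
      rw [min_eq_left (h ▸ le_of_lt hs)]
  · have e : (fun s => f (min s T)) =ᶠ[𝓝 t] fun _ => f T := by
      filter_upwards [Ioi_mem_nhds h] with s hs
      rw [min_eq_right (le_of_lt hs)]
    exact ⟨(continuousAt_const.congr e.symm).continuousWithinAt, f T,
      tendsto_const_nhds.congr' (e.filter_mono nhdsWithin_le_nhds).symm⟩

section LinearFBSDE

open Matrix

variable {Ω : Type*} {mΩ : MeasurableSpace Ω} {μ : Measure Ω} {𝓕 : Filtration ℝ≥0 mΩ} {T : ℝ≥0}
variable {ι : Type*} [Fintype ι] [DecidableEq ι]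

omit [DecidableEq ι] in
lemma CadlagL2.mulVec [IsFiniteMeasure μ] {A : ℝ → Matrix ι ι ℝ}
    (hA : ContinuousOn A (Set.Icc 0 (T : ℝ))) {h : ι → ℝ≥0 → Ω → ℝ}
    (hh : ∀ k, CadlagL2 μ 𝓕 T (h k)) (i : ι) :
    CadlagL2 μ 𝓕 T fun t ω => (A (min t T : ℝ≥0) *ᵥ fun k => h k t ω) i := by
  refine (CadlagL2.sum Finset.univ (Z := fun k t ω => A (min t T : ℝ≥0) i k * h k t ω)
    fun k _ => (hh k).mul_deterministic (c := fun r => A r i k) ?_)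
  exact (entryCLM i k).continuous.comp_continuousOn hA

omit [DecidableEq ι] in
lemma setIntegral_mulVec (A : Matrix ι ι ℝ) {f : ι → Ω → ℝ} (hf : ∀ k, Integrable (f k) μ)
    (B : Set Ω) (i : ι) :
    ∫ ω in B, (A *ᵥ fun k => f k ω) i ∂μ = (A *ᵥ fun k => ∫ ω in B, f k ω ∂μ) i := by
  simp only [Matrix.mulVec, dotProduct]
  rw [integral_finsetSum _ fun k _ => ((hf k).const_mul _).integrableOn]
  simp only [integral_const_mul]

lemma CadlagL2.primitive_increment {X : ℝ≥0 → Ω → ℝ} (hX : CadlagL2 μ 𝓕 T X) (ω : Ω) {s r : ℝ≥0}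
    (hsr : s ≤ r) (hr : r ≤ T) :
    ∫ u in (0 : ℝ)..(min r T : ℝ≥0), X u.toNNReal ω =
      (∫ u in (0 : ℝ)..(min s T : ℝ≥0), X u.toNNReal ω) + ∫ u in (s : ℝ)..r, X u.toNNReal ω := by
  rw [min_eq_left hr, min_eq_left (hsr.trans hr)]
  exact (intervalIntegral.integral_add_adjacent_intervals ((hX.cadlag ω).intervalIntegrable _ _)
    ((hX.cadlag ω).intervalIntegrable _ _)).symm

/-- The càdlàg version of the martingale closed by a square integrable random variable. -/
lemma UsualConditions.exists_cadlagL2_martingale [IsFiniteMeasure μ] (h𝓕 : UsualConditions 𝓕 μ)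
    {ξ : Ω → ℝ} (hm : StronglyMeasurable[𝓕 T] ξ) (hξ : MemLp ξ 2 μ) :
    ∃ N, CadlagL2 μ 𝓕 T N ∧ Martingale N 𝓕 μ ∧ N T =ᵐ[μ] ξ ∧ ∀ t, N t =ᵐ[μ] μ[ξ|𝓕 t] := by
  have hi : Integrable ξ μ := hξ.integrable (by norm_num)
  obtain ⟨N, h1, h2, h3⟩ := exists_cadlag_condExp h𝓕 hi
  have key : ∀ t, N (min t T) =ᵐ[μ] μ[ξ|𝓕 t] := by
    intro t
    rcases le_total t T with h | h
    · rw [min_eq_left h]; exact h3 t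
    · rw [min_eq_right h]
      refine (h3 T).trans ?_
      rw [condExp_of_stronglyMeasurable (𝓕.le T) hm hi,
        condExp_of_stronglyMeasurable (𝓕.le t) (hm.mono (𝓕.mono h)) hi]
  have hcad : CadlagL2 μ 𝓕 T fun t ω => N (min t T) ω :=
    ⟨fun ω => (h1 ω).stopped T, fun t => (h2 _).mono (𝓕.mono (min_le_left _ _)),
      fun t ω => by rw [min_assoc, min_self], eLpNorm ξ 2 μ, hξ.2.ne, fun t => by
        rw [eLpNorm_congr_ae (key t)]; exact eLpNorm_condExp_le_eLpNorm _ (by norm_num)⟩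
  refine ⟨_, hcad, ⟨hcad.adapted, fun s t hst => ?_⟩, ?_, key⟩
  · refine (condExp_congr_ae (key t)).trans ((condExp_condExp_of_le (𝓕.mono hst) (𝓕.le t)).trans
      (key s).symm)
  · refine (key T).trans ?_
    rw [condExp_of_stronglyMeasurable (𝓕.le T) hm hi]

/-- A linear forward-backward system with square integrable càdlàg input `h` and terminal data `ζ`
has a solution as soon as `boundaryMatrix` is invertible along `[0, T]`. The backward coordinates
are driven by the martingales closed by the propagated terminal data. -/
theorem exists_linear_forward_backward [IsFiniteMeasure μ] (h𝓕 : UsualConditions 𝓕 μ)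
    (F C : Matrix ι ι ℝ) (fwd : ι → Prop) [DecidablePred fwd]
    (hdet : ∀ t ∈ Set.Icc 0 (T : ℝ), (boundaryMatrix F C fwd T t).det ≠ 0) (x0 : ι → ℝ)
    {h : ι → ℝ≥0 → Ω → ℝ} (hh : ∀ i, CadlagL2 μ 𝓕 T (h i)) {ζ : ι → Ω → ℝ}
    (hζm : ∀ i, StronglyMeasurable[𝓕 T] (ζ i)) (hζ : ∀ i, MemLp (ζ i) 2 μ) :
    ∃ X : ι → ℝ≥0 → Ω → ℝ, (∀ i, CadlagL2 μ 𝓕 T (X i)) ∧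
      (∀ i, fwd i → ∀ ω, ∀ t ≤ T, X i t ω = x0 i +
        ∫ r in (0 : ℝ)..t, ((F *ᵥ fun k => X k r.toNNReal ω) i + h i r.toNNReal ω)) ∧
      (∀ i, ∃ M, CadlagL2 μ 𝓕 T M ∧ Martingale M 𝓕 μ ∧ ∀ ω, ∀ t ≤ T, X i t ω = X i 0 ω +
        (∫ r in (0 : ℝ)..t, ((F *ᵥ fun k => X k r.toNNReal ω) i + h i r.toNNReal ω)) +
        (M t ω - M 0 ω)) ∧
      (∀ i, ¬ fwd i → ∀ᵐ ω ∂μ, (C *ᵥ fun k => X k T ω) i = ζ i ω) ∧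
      (∀ i, ¬ fwd i → ∀ t ≤ T, ∀ᵐ ω ∂μ, ((C * flow F (T - t)) *ᵥ fun k => X k t ω) i =
        (μ[fun ω => ζ i ω - ∫ r in (t : ℝ)..T,
          ((C * flow F (T - r)) *ᵥ fun k => h k r.toNNReal ω) i | 𝓕 t]) ω) := by
  have hR : ContinuousOn (transportInv F C fwd T) (Set.Icc 0 (T : ℝ)) := fun r hr =>
    (continuousAt_transportInv (hdet r hr)).continuousWithinAt
  have hE : ContinuousOn (flow F) (Set.Icc 0 (T : ℝ)) := (continuous_flow F).continuousOn
  have hE' : ContinuousOn (fun r => flow F ((T : ℝ) - r)) (Set.Icc 0 (T : ℝ)) :=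
    ((continuous_flow F).comp (continuous_const.sub continuous_id)).continuousOn
  -- the drift of the propagated backward data
  set Γ : ℝ → Matrix ι ι ℝ := fun r => (1 - fwdProj fwd) * (C * flow F (T - r)) with hΓ
  have hΓc : ContinuousOn Γ (Set.Icc 0 (T : ℝ)) := continuousOn_const.mul (continuousOn_const.mul hE')
  set g : ι → ℝ≥0 → Ω → ℝ := fun j t ω => (Γ (min t T : ℝ≥0) *ᵥ fun k => h k t ω) j with hg_def
  have hg : ∀ j, CadlagL2 μ 𝓕 T (g j) := fun j => CadlagL2.mulVec hΓc hh j
  have hgT : ∀ j, CadlagL2 μ 𝓕 T fun t ω => ∫ u in (0 : ℝ)..(min t T : ℝ≥0), g j u.toNNReal ω :=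
    fun j => (hg j).primitive
  set ξ : ι → Ω → ℝ := fun j ω => ζ j ω - ∫ u in (0 : ℝ)..(min T T : ℝ≥0), g j u.toNNReal ω with hξ
  choose N hN1 hN2 hN3 hN4 using fun j => h𝓕.exists_cadlagL2_martingale (T := T) (ξ := ξ j)
    ((hζm j).sub ((hgT j).adapted T)) ((hζ j).sub ((hgT j).memLp T))
  set l : ι → ℝ≥0 → Ω → ℝ := fun j t ω => if fwd j then 0 else
    N j t ω + ∫ u in (0 : ℝ)..(min t T : ℝ≥0), g j u.toNNReal ω with hl_def
  have hl : ∀ j, CadlagL2 μ 𝓕 T (l j) := by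
    intro j
    by_cases hj : fwd j
    · exact (CadlagL2.const 0).congr_eq fun t ω => by simp [l, hj]
    · exact ((hN1 j).add (hgT j)).congr_eq fun t ω => by simp [l, hj]
  set A1 : ℝ → Matrix ι ι ℝ := fun r => transportInv F C fwd T r * fwdProj fwd with hA1
  set A2 : ℝ → Matrix ι ι ℝ := fun r => transportInv F C fwd T r *
    (fwdProj fwd * (F * (flow F r * transportInv F C fwd T r))) with hA2
  have hA1c : ContinuousOn A1 (Set.Icc 0 (T : ℝ)) := hR.mul continuousOn_const
  have hA2c : ContinuousOn A2 (Set.Icc 0 (T : ℝ)) :=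
    hR.mul (continuousOn_const.mul (continuousOn_const.mul (hE.mul hR)))
  set q : ι → ℝ≥0 → Ω → ℝ := fun j t ω => (A1 (min t T : ℝ≥0) *ᵥ fun k => h k t ω) j +
    (A2 (min t T : ℝ≥0) *ᵥ fun k => l k t ω) j with hq_def
  have hq : ∀ j, CadlagL2 μ 𝓕 T (q j) := fun j =>
    (CadlagL2.mulVec hA1c hh j).add (CadlagL2.mulVec hA2c hl j)
  set c : ι → ℝ := transportInv F C fwd T 0 *ᵥ (fwdProj fwd *ᵥ x0) with hc
  set a : ι → ℝ≥0 → Ω → ℝ := fun j t ω =>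
    c j + ∫ u in (0 : ℝ)..(min t T : ℝ≥0), q j u.toNNReal ω with ha_def
  have ha : ∀ j, CadlagL2 μ 𝓕 T (a j) := fun j => (CadlagL2.const (c j)).add (hq j).primitive
  set X : ι → ℝ≥0 → Ω → ℝ := fun i t ω =>
    ((flow F (min t T : ℝ≥0) * transportInv F C fwd T (min t T : ℝ≥0)) *ᵥ fun k => l k t ω) i +
      (flow F (min t T : ℝ≥0) *ᵥ fun k => a k t ω) i with hX_def
  have hX : ∀ i, CadlagL2 μ 𝓕 T (X i) := fun i =>
    (CadlagL2.mulVec (A := fun r => flow F r * transportInv F C fwd T r) (hE.mul hR) hl i).add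
      (CadlagL2.mulVec hE ha i)
  -- values at real times in `[0, T]`
  have hmin : ∀ {u : ℝ}, u ∈ Set.Icc 0 (T : ℝ) → ((min u.toNNReal T : ℝ≥0) : ℝ) = u := by
    intro u hu
    rw [min_eq_left (Real.toNNReal_le_iff_le_coe.2 hu.2), Real.coe_toNNReal _ hu.1]
  have hq' : ∀ (j : ι) (ω : Ω) {u : ℝ}, u ∈ Set.Icc 0 (T : ℝ) → q j u.toNNReal ω =
      (A1 u *ᵥ (fun k => h k u.toNNReal ω) + A2 u *ᵥ fun k => l k u.toNNReal ω) j := by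
    intro j ω u hu
    simp only [hq_def, hmin hu, Pi.add_apply]
  have hX' : ∀ (i : ι) (ω : Ω) {u : ℝ}, u ∈ Set.Icc 0 (T : ℝ) → X i u.toNNReal ω =
      ((flow F u * transportInv F C fwd T u) *ᵥ (fun k => l k u.toNNReal ω) +
        flow F u *ᵥ fun k => a k u.toNNReal ω) i := by
    intro i ω u hu
    simp only [hX_def, hmin hu, Pi.add_apply]
  have hsub : ∀ {s t : ℝ≥0} {r : ℝ}, s ≤ t → t ≤ T → r ∈ Set.uIcc (s : ℝ) t →
      r ∈ Set.Icc 0 (T : ℝ) := fun {s t r} hst ht hr => by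
    rw [Set.uIcc_of_le (NNReal.coe_le_coe.2 hst)] at hr
    exact ⟨s.2.trans hr.1, hr.2.trans (NNReal.coe_le_coe.2 ht)⟩
  have hdr : ∀ {s t : ℝ≥0} {r : ℝ}, s ≤ t → t ≤ T → r ∈ Set.uIcc (s : ℝ) t →
      s ≤ r.toNNReal ∧ r.toNNReal ≤ T ∧ (r.toNNReal : ℝ) = r := fun {s t r} hst ht hr => by
    have h1 := hsub hst ht hr
    rw [Set.uIcc_of_le (NNReal.coe_le_coe.2 hst)] at hr
    exact ⟨NNReal.le_toNNReal_of_coe_le hr.1, Real.toNNReal_le_iff_le_coe.2 h1.2,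
      Real.coe_toNNReal _ h1.1⟩
  have hqi : ∀ (j : ι) (ω : Ω) {s t : ℝ≥0}, s ≤ t → t ≤ T → IntervalIntegrable (fun u : ℝ =>
      (A1 u *ᵥ (fun k => h k u.toNNReal ω) + A2 u *ᵥ fun k => l k u.toNNReal ω) j)
      volume s t := fun j ω s t hst ht => by
    refine (((hq j).cadlag ω).intervalIntegrable s t).congr fun u hu => ?_
    exact hq' j ω (hsub hst ht (Set.uIoc_subset_uIcc hu))
  have hai : ∀ (j : ι) (ω : Ω) {s t : ℝ≥0}, s ≤ t → t ≤ T → ∀ r ∈ Set.uIcc (s : ℝ) t,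
      a j r.toNNReal ω = a j s ω + ∫ u in (s : ℝ)..r,
      (A1 u *ᵥ (fun k => h k u.toNNReal ω) + A2 u *ᵥ fun k => l k u.toNNReal ω) j := by
    intro j ω s t hst ht r hr
    obtain ⟨e1, e2, e3⟩ := hdr hst ht hr
    simp only [ha_def]
    rw [(hq j).primitive_increment ω e1 e2, e3, ← add_assoc]
    congr 1
    refine intervalIntegral.integral_congr fun u hu => ?_
    refine hq' j ω (hsub e1 e2 ?_)
    rwa [e3]
  have hproj : ∀ (v : ι → ℝ) (i : ι), fwd i → (fwdProj fwd *ᵥ v) i = v i := fun v i hi => by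
    simp [fwdProj, mulVec_diagonal, hi]
  have hproj0 : ∀ (v : ι → ℝ) (i : ι), ¬ fwd i → (fwdProj fwd *ᵥ v) i = 0 := fun v i hi => by
    simp [fwdProj, mulVec_diagonal, hi]
  have hl0 : ∀ (ω : Ω) (t : ℝ≥0), fwdProj fwd *ᵥ (fun k => l k t ω) = 0 := by
    intro ω t
    funext i
    by_cases hi : fwd i
    · rw [hproj _ _ hi]; simp [l, hi]
    · rw [hproj0 _ _ hi]; rfl
  -- the drift
  set f : ι → ℝ≥0 → Ω → ℝ := fun i t ω => (F *ᵥ fun k => X k t ω) i + h i t ω with hf_def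
  have hf : ∀ i, CadlagL2 μ 𝓕 T (f i) := fun i =>
    (CadlagL2.mulVec (A := fun _ => F) continuousOn_const hX i).add (hh i)
  have hfwd : ∀ i, fwd i → ∀ ω, ∀ t ≤ T, X i t ω = x0 i +
      ∫ r in (0 : ℝ)..t, f i r.toNNReal ω := by
    intro i hi ω t ht
    have key := forward_coordinates_eq hdet (l := fun r k => l k r.toNNReal ω)
      (α := fun r k => a k r.toNNReal ω) (k := fun r k => h k r.toNNReal ω)
      (s := ((0 : ℝ≥0) : ℝ)) (t := t) le_rfl t.2 ht (fun j => hqi j ω zero_le ht)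
      (fun j r hr => by rw [Real.toNNReal_coe]; exact hai j ω zero_le ht r hr) hi
    have hXi : ∀ u ∈ Set.Icc 0 (T : ℝ), X i u.toNNReal ω =
        (flow F u *ᵥ fun k => a k u.toNNReal ω) i := by
      intro u hu
      rw [hX' i ω hu, Pi.add_apply,
        ← hproj ((flow F u * transportInv F C fwd T u) *ᵥ _) i hi, mulVec_mulVec,
        fwdProj_mul_flow_mul_inv (hdet u hu), hl0, Pi.zero_apply, zero_add]
    have h0 : (flow F ((0 : ℝ≥0) : ℝ) *ᵥ fun k => a k ((0 : ℝ≥0) : ℝ).toNNReal ω) i = x0 i := by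
      have h00 : (0 : ℝ) ∈ Set.Icc 0 (T : ℝ) := ⟨le_rfl, T.2⟩
      have e : (fun k => a k ((0 : ℝ≥0) : ℝ).toNNReal ω) = c := by
        funext k; simp [ha_def]
      have hP := fwdProj_mul_flow_mul_inv (hdet 0 h00)
      rw [flow_zero, one_mul] at hP
      rw [e, NNReal.coe_zero, flow_zero, one_mulVec, ← hproj c i hi, hc, mulVec_mulVec, hP,
        hproj _ _ hi, hproj _ _ hi]
    have ht' : (t : ℝ) ∈ Set.Icc 0 (T : ℝ) := ⟨t.2, NNReal.coe_le_coe.2 ht⟩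
    have hXt := hXi t ht'
    rw [Real.toNNReal_coe] at hXt
    rw [hXt, ← h0]
    rw [Real.toNNReal_coe] at key
    rw [eq_add_of_sub_eq' key]
    congr 1
    refine intervalIntegral.integral_congr fun r hr => ?_
    have hr' := hsub (s := 0) zero_le ht hr
    have e : (fun k => X k r.toNNReal ω) = (flow F r * transportInv F C fwd T r) *ᵥ
        (fun k => l k r.toNNReal ω) + flow F r *ᵥ fun k => a k r.toNNReal ω := by
      funext k; exact hX' k ω hr'
    simp only [hf_def]
    rw [e]
  have hmart : ∀ i, Martingale (fun t ω => X i t ω -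
      ∫ u in (0 : ℝ)..(min t T : ℝ≥0), f i u.toNNReal ω) 𝓕 μ := by
    intro i
    have hM := (hX i).sub (hf i).primitive
    refine martingale_of_setIntegral_eq hM.adapted hM.integrable fun s t hst B hB => ?_
    have hred : ∀ s t : ℝ≥0, s ≤ t → t ≤ T → ∀ B, MeasurableSet[𝓕 s] B →
        ∫ ω in B, (X i s ω - ∫ u in (0 : ℝ)..(min s T : ℝ≥0), f i u.toNNReal ω) ∂μ =
        ∫ ω in B, (X i t ω - ∫ u in (0 : ℝ)..(min t T : ℝ≥0), f i u.toNNReal ω) ∂μ := by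
      clear hst hB s t B
      intro s t hst ht B hB
      have hαi : ∀ j, IntervalIntegrable (fun u : ℝ =>
          (A1 u *ᵥ (fun k => ∫ ω in B, h k u.toNNReal ω ∂μ) +
            A2 u *ᵥ fun k => ∫ ω in B, l k u.toNNReal ω ∂μ) j) volume s t ∧
          ∀ r ∈ Set.uIcc (s : ℝ) t, (∫ ω in B, a j r.toNNReal ω ∂μ) = (∫ ω in B, a j s ω ∂μ) +
            ∫ u in (s : ℝ)..r, (A1 u *ᵥ (fun k => ∫ ω in B, h k u.toNNReal ω ∂μ) +
              A2 u *ᵥ fun k => ∫ ω in B, l k u.toNNReal ω ∂μ) j := by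
        intro j
        have e : ∀ u ∈ Set.Icc 0 (T : ℝ), ∫ ω in B, q j u.toNNReal ω ∂μ =
            (A1 u *ᵥ (fun k => ∫ ω in B, h k u.toNNReal ω ∂μ) +
            A2 u *ᵥ fun k => ∫ ω in B, l k u.toNNReal ω ∂μ) j := by
          intro u hu
          simp only [hq_def, hmin hu, Pi.add_apply]
          rw [integral_add, setIntegral_mulVec _ (fun k => (hh k).integrable _),
            setIntegral_mulVec _ (fun k => (hl k).integrable _)]
          · have := ((CadlagL2.mulVec hA1c hh j).integrable u.toNNReal).restrict (s := B)
            simpa only [hmin hu] using this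
          · have := ((CadlagL2.mulVec hA2c hl j).integrable u.toNNReal).restrict (s := B)
            simpa only [hmin hu] using this
        refine ⟨((hq j).intervalIntegrable_setIntegral B hst ht).congr fun u hu =>
          e u (hsub hst ht (Set.uIoc_subset_uIcc hu)), fun r hr => ?_⟩
        obtain ⟨e1, e2, e3⟩ := hdr hst ht hr
        have e4 : ∀ ω, a j r.toNNReal ω = a j s ω + ∫ u in (s : ℝ)..r.toNNReal,
            q j u.toNNReal ω := fun ω => by
          simp only [ha_def]
          rw [(hq j).primitive_increment ω e1 e2, ← add_assoc]
        have i4 : Integrable (fun ω => ∫ u in (s : ℝ)..r.toNNReal, q j u.toNNReal ω) μ := by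
          have := ((ha j).integrable r.toNNReal).sub ((ha j).integrable s)
          refine this.congr (Eventually.of_forall fun ω => ?_)
          simp only [Pi.sub_apply]
          rw [e4 ω]; ring
        simp only [e4]
        rw [integral_add ((ha j).integrable s).integrableOn i4.integrableOn,
          (hq j).setIntegral_primitive e1 e2, e3]
        congr 1
        refine intervalIntegral.integral_congr fun u hu => e u (hsub e1 e2 ?_)
        rwa [e3]
      have hli : ∀ j, IntervalIntegrable (fun u : ℝ =>
          (Γ u *ᵥ fun k => ∫ ω in B, h k u.toNNReal ω ∂μ) j) volume s t ∧
          ∀ r ∈ Set.uIcc (s : ℝ) t, (∫ ω in B, l j r.toNNReal ω ∂μ) = (∫ ω in B, l j s ω ∂μ) +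
            ∫ u in (s : ℝ)..r, (Γ u *ᵥ fun k => ∫ ω in B, h k u.toNNReal ω ∂μ) j := by
        intro j
        have e : ∀ u ∈ Set.Icc 0 (T : ℝ), ∫ ω in B, g j u.toNNReal ω ∂μ =
            (Γ u *ᵥ fun k => ∫ ω in B, h k u.toNNReal ω ∂μ) j := by
          intro u hu
          simp only [hg_def, hmin hu]
          rw [setIntegral_mulVec _ (fun k => (hh k).integrable _)]
        refine ⟨((hg j).intervalIntegrable_setIntegral B hst ht).congr fun u hu =>
          e u (hsub hst ht (Set.uIoc_subset_uIcc hu)), fun r hr => ?_⟩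
        by_cases hj : fwd j
        · have hz : ∀ v : ι → ℝ, ∀ u, (Γ u *ᵥ v) j = 0 := by
            intro v u
            simp only [hΓ]
            rw [← mulVec_mulVec, sub_mulVec, Pi.sub_apply, one_mulVec, hproj _ _ hj, sub_self]
          simp [hl_def, hj, hz]
        · obtain ⟨e1, e2, e3⟩ := hdr hst ht hr
          have e4 : ∀ ω, l j r.toNNReal ω = (N j r.toNNReal ω - N j s ω + l j s ω) +
              ∫ u in (s : ℝ)..r.toNNReal, g j u.toNNReal ω := fun ω => by
            simp only [hl_def, hj, if_false]
            rw [(hg j).primitive_increment ω e1 e2]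
            ring
          have i4 : Integrable (fun ω => ∫ u in (s : ℝ)..r.toNNReal, g j u.toNNReal ω) μ := by
            have := ((hl j).integrable r.toNNReal).sub ((((hN1 j).integrable r.toNNReal).sub
              ((hN1 j).integrable s)).add ((hl j).integrable s))
            refine this.congr (Eventually.of_forall fun ω => ?_)
            simp only [Pi.sub_apply, Pi.add_apply]
            rw [e4 ω]; ring
          have i5 : Integrable (fun ω => N j r.toNNReal ω - N j s ω) μ :=
            ((hN1 j).integrable r.toNNReal).sub ((hN1 j).integrable s)
          have i6 : Integrable (fun ω => N j r.toNNReal ω - N j s ω + l j s ω) μ :=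
            i5.add ((hl j).integrable s)
          simp only [e4]
          rw [integral_add i6.integrableOn i4.integrableOn,
            integral_add i5.integrableOn ((hl j).integrable s).integrableOn,
            integral_sub ((hN1 j).integrable r.toNNReal).integrableOn
              ((hN1 j).integrable s).integrableOn, (hN2 j).setIntegral_eq e1 hB, sub_self,
            zero_add, (hg j).setIntegral_primitive e1 e2, e3]
          congr 1
          refine intervalIntegral.integral_congr fun u hu => e u (hsub e1 e2 ?_)
          rwa [e3]
      have key := all_coordinates_eq hdet (l := fun r k => ∫ ω in B, l k r.toNNReal ω ∂μ)
        (α := fun r k => ∫ ω in B, a k r.toNNReal ω ∂μ)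
        (k := fun r k => ∫ ω in B, h k r.toNNReal ω ∂μ) (s := (s : ℝ)) (t := (t : ℝ)) s.2 hst ht (fun j => (hαi j).1)
        (fun j r hr => by rw [Real.toNNReal_coe]; exact (hαi j).2 r hr) (fun j => (hli j).1)
        (fun j r hr => by rw [Real.toNNReal_coe]; exact (hli j).2 r hr) i
      have hXB : ∀ (i : ι), ∀ u ∈ Set.Icc 0 (T : ℝ), ∫ ω in B, X i u.toNNReal ω ∂μ =
          ((flow F u * transportInv F C fwd T u) *ᵥ (fun k => ∫ ω in B, l k u.toNNReal ω ∂μ) +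
            flow F u *ᵥ fun k => ∫ ω in B, a k u.toNNReal ω ∂μ) i := by
        intro i u hu
        simp only [hX_def, hmin hu, Pi.add_apply]
        rw [integral_add, setIntegral_mulVec _ (fun k => (hl k).integrable _),
          setIntegral_mulVec _ (fun k => (ha k).integrable _)]
        · have := ((CadlagL2.mulVec (A := fun r => flow F r * transportInv F C fwd T r)
            (hE.mul hR) hl i).integrable u.toNNReal).restrict (s := B)
          simpa only [hmin hu] using this
        · have := ((CadlagL2.mulVec hE ha i).integrable u.toNNReal).restrict (s := B)
          simpa only [hmin hu] using this
      have hs' : (s : ℝ) ∈ Set.Icc 0 (T : ℝ) := ⟨s.2, NNReal.coe_le_coe.2 (hst.trans ht)⟩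
      have ht' : (t : ℝ) ∈ Set.Icc 0 (T : ℝ) := ⟨t.2, NNReal.coe_le_coe.2 ht⟩
      rw [← hXB i _ hs', ← hXB i _ ht', Real.toNNReal_coe, Real.toNNReal_coe] at key
      have hfB : ∫ r in (s : ℝ)..t, (∫ ω in B, f i r.toNNReal ω ∂μ) =
          (∫ ω in B, X i t ω ∂μ) - ∫ ω in B, X i s ω ∂μ := by
        rw [key]
        refine intervalIntegral.integral_congr fun r hr => ?_
        have hr' := hsub hst ht hr
        simp only [hf_def]
        rw [integral_add ((CadlagL2.mulVec (A := fun _ => F) continuousOn_const hX i).integrable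
          r.toNNReal).integrableOn ((hh i).integrable _).integrableOn,
          setIntegral_mulVec _ (fun k => (hX k).integrable _)]
        have e : (fun k => ∫ ω in B, X k r.toNNReal ω ∂μ) =
            (flow F r * transportInv F C fwd T r) *ᵥ (fun k => ∫ ω in B, l k r.toNNReal ω ∂μ) +
            flow F r *ᵥ fun k => ∫ ω in B, a k r.toNNReal ω ∂μ := by
          funext k; exact hXB k r hr'
        rw [e]
      have i4 : Integrable (fun ω => ∫ u in (s : ℝ)..t, f i u.toNNReal ω) μ := by
        have := ((hf i).primitive.integrable t).sub ((hf i).primitive.integrable s)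
        refine this.congr (Eventually.of_forall fun ω => ?_)
        simp only [Pi.sub_apply]
        rw [(hf i).primitive_increment ω hst ht]; ring
      have e5 : ∀ ω, X i t ω - ∫ u in (0 : ℝ)..(min t T : ℝ≥0), f i u.toNNReal ω =
          (X i t ω - X i s ω - ∫ u in (s : ℝ)..t, f i u.toNNReal ω) +
          (X i s ω - ∫ u in (0 : ℝ)..(min s T : ℝ≥0), f i u.toNNReal ω) := fun ω => by
        rw [(hf i).primitive_increment ω hst ht]; ring
      have i5 : Integrable (fun ω => X i t ω - X i s ω) μ :=
        ((hX i).integrable t).sub ((hX i).integrable s)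
      have i6 : Integrable (fun ω => X i t ω - X i s ω - ∫ u in (s : ℝ)..t, f i u.toNNReal ω) μ :=
        i5.sub i4
      simp only [e5]
      rw [integral_add i6.integrableOn (hM.integrable s).integrableOn,
        integral_sub i5.integrableOn i4.integrableOn,
        integral_sub ((hX i).integrable t).integrableOn ((hX i).integrable s).integrableOn,
        (hf i).setIntegral_primitive hst ht, hfB, sub_self, zero_add]
    have hconst : ∀ (r : ℝ≥0) (ω : Ω), X i r ω - ∫ u in (0 : ℝ)..(min r T : ℝ≥0),
        f i u.toNNReal ω = X i (min r T) ω - ∫ u in (0 : ℝ)..(min (min r T) T : ℝ≥0),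
        f i u.toNNReal ω := fun r ω => (hM.stopped r ω).symm
    rcases le_total s T with hs | hs
    · rw [hred s (min t T) (le_min hst hs) (min_le_right _ _) B hB]
      exact setIntegral_congr_fun (𝓕.le s _ hB) fun ω _ => (hconst t ω).symm
    · refine setIntegral_congr_fun (𝓕.le s _ hB) fun ω _ => ?_
      rw [hconst s, hconst t, min_eq_right hs, min_eq_right (hs.trans hst)]
  have hbwd : ∀ i, ¬ fwd i → ∀ t ≤ T, ∀ ω, ((C * flow F (T - t)) *ᵥ fun k => X k t ω) i =
      l i t ω := by
    intro i hi t ht ω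
    have ht' : (t : ℝ) ∈ Set.Icc 0 (T : ℝ) := ⟨t.2, NNReal.coe_le_coe.2 ht⟩
    have hXt : (fun k => X k t ω) = (flow F t * transportInv F C fwd T t) *ᵥ (fun k => l k t ω) +
        flow F t *ᵥ fun k => a k t ω := by
      funext k
      have := hX' k ω ht'
      rwa [Real.toNNReal_coe] at this
    have hB : ∀ v : ι → ℝ, ((C * flow F (T - t)) *ᵥ v) i =
        (boundaryMatrix F C fwd T t *ᵥ v) i := by
      intro v
      unfold boundaryMatrix
      rw [add_mulVec, Pi.add_apply, hproj0 _ _ hi, ← mulVec_mulVec _ (1 - fwdProj fwd), sub_mulVec,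
        Pi.sub_apply, hproj0 _ _ hi, one_mulVec]
      ring
    rw [hB, hXt, mulVec_add, mulVec_mulVec, mulVec_mulVec, ← mul_assoc, boundaryMatrix_mul_flow,
      transport_mul_inv (hdet _ ht'), one_mulVec, Pi.add_apply]
    -- the backward rows of `transportMatrix` do not depend on time
    have hrow : ∀ (u : ℝ) (v : ι → ℝ), (transportMatrix F C fwd T u *ᵥ v) i =
        ((C * flow F T) *ᵥ v) i := by
      intro u v
      unfold transportMatrix
      rw [add_mulVec, Pi.add_apply, ← mulVec_mulVec, hproj0 _ _ hi,
        ← mulVec_mulVec _ (1 - fwdProj fwd), sub_mulVec, Pi.sub_apply, hproj0 _ _ hi, one_mulVec]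
      ring
    have hz : ∀ u ∈ Set.Icc 0 (T : ℝ), ∀ v : ι → ℝ,
        ((C * flow F T) *ᵥ (transportInv F C fwd T u *ᵥ (fwdProj fwd *ᵥ v))) i = 0 := by
      intro u hu v
      rw [← hrow u, mulVec_mulVec, transport_mul_inv (hdet u hu), one_mulVec, hproj0 _ _ hi]
    rw [hrow]
    have e1 : (fun k => a k t ω) = c + fun k => ∫ u in (0 : ℝ)..t, q k u.toNNReal ω := by
      funext k; simp [ha_def, min_eq_left (NNReal.coe_le_coe.2 ht)]
    have e2 : ((C * flow F T) *ᵥ fun k => ∫ u in (0 : ℝ)..t, q k u.toNNReal ω) i = 0 := by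
      simp only [mulVec, dotProduct]
      have : ∀ k, (C * flow F T) i k * ∫ u in (0 : ℝ)..t, q k u.toNNReal ω =
          ∫ u in (0 : ℝ)..t, (C * flow F T) i k * q k u.toNNReal ω := fun k =>
        (intervalIntegral.integral_const_mul _ _).symm
      simp only [this]
      rw [← intervalIntegral.integral_finsetSum fun k _ =>
        (((hq k).cadlag ω).intervalIntegrable _ _).const_mul _]
      refine Eq.trans (intervalIntegral.integral_congr fun u hu => ?_)
        intervalIntegral.integral_zero
      have hu' : u ∈ Set.Icc 0 (T : ℝ) := hsub (s := 0) zero_le ht hu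
      have hqu : (fun k => q k u.toNNReal ω) = transportInv F C fwd T u *ᵥ (fwdProj fwd *ᵥ
          ((fun k => h k u.toNNReal ω) + (F * (flow F u * transportInv F C fwd T u)) *ᵥ
            fun k => l k u.toNNReal ω)) := by
        funext k
        rw [hq' k ω hu']
        simp only [hA1, hA2, mulVec_add, mulVec_mulVec]
      have := hz u hu' ((fun k => h k u.toNNReal ω) + (F * (flow F u * transportInv F C fwd T u)) *ᵥ
            fun k => l k u.toNNReal ω)
      rw [← hqu] at this
      exact this
    rw [e1, mulVec_add, Pi.add_apply, e2, hc, hz 0 ⟨le_rfl, T.2⟩, add_zero, add_zero]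
  have hΓrow : ∀ (i : ι), ¬ fwd i → ∀ (u : ℝ) (v : ι → ℝ), (Γ u *ᵥ v) i =
      ((C * flow F (T - u)) *ᵥ v) i := by
    intro i hi u v
    simp only [hΓ]
    rw [← mulVec_mulVec, sub_mulVec, Pi.sub_apply, hproj0 _ _ hi, one_mulVec, sub_zero]
  refine ⟨X, hX, hfwd, fun i => ⟨_, (hX i).sub (hf i).primitive, hmart i, fun ω t ht => ?_⟩,
    fun i hi => ?_, fun i hi t ht => ?_⟩
  · simp only [min_eq_left ht, min_eq_left (zero_le : 0 ≤ T), NNReal.coe_zero,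
      intervalIntegral.integral_same]
    simp only [hf_def]
    ring
  · filter_upwards [hN3 i] with ω hω
    have := hbwd i hi T le_rfl ω
    rw [sub_self, flow_zero, mul_one] at this
    rw [this]
    simp only [hl_def, hi, if_false, hω, hξ]
    ring
  · have hgi : ∀ ω, ∫ u in (0 : ℝ)..(min T T : ℝ≥0), g i u.toNNReal ω =
        (∫ u in (0 : ℝ)..(min t T : ℝ≥0), g i u.toNNReal ω) + ∫ r in (t : ℝ)..T,
          ((C * flow F (T - r)) *ᵥ fun k => h k r.toNNReal ω) i := fun ω => by
      rw [(hg i).primitive_increment ω ht le_rfl]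
      congr 1
      refine intervalIntegral.integral_congr fun u hu => ?_
      simp only [hg_def]
      rw [hmin (hsub ht le_rfl hu), hΓrow i hi]
    have hsplit : (fun ω => ζ i ω - ∫ r in (t : ℝ)..T,
          ((C * flow F (T - r)) *ᵥ fun k => h k r.toNNReal ω) i) =
        ξ i + fun ω => ∫ u in (0 : ℝ)..(min t T : ℝ≥0), g i u.toNNReal ω := by
      funext ω
      simp only [Pi.add_apply, hξ]
      rw [hgi ω]; ring
    have hξi : Integrable (ξ i) μ := ((hζ i).sub ((hgT i).memLp T)).integrable (by norm_num)
    have hce := condExp_add hξi ((hgT i).integrable t) (𝓕 t)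
    rw [condExp_of_stronglyMeasurable (𝓕.le t) ((hgT i).adapted t) ((hgT i).integrable t)] at hce
    filter_upwards [hce, hN4 i t] with ω h1 h2
    rw [hbwd i hi t ht, hsplit, h1, Pi.add_apply, ← h2]
    simp [hl_def, hi]

end LinearFBSDE

end

section

/-! ### The quadratic structure of the objective along a path -/

/-- The exponentially weighted running integral `e^{-rt} ∫₀ᵗ e^{rs} v_s ds`. -/
def expConv (r : ℝ) (v : ℝ → ℝ) (t : ℝ) : ℝ :=
  Real.exp (-r * t) * ∫ s in (0 : ℝ)..t, Real.exp (r * s) * v s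

/-- Square integrability of a path on `[0, T]`. -/
abbrev PathL2 (T : ℝ≥0) (f : ℝ → ℝ) : Prop := MemLp f 2 (volume.restrict (Set.Icc (0 : ℝ) T))

section Path

variable {T : ℝ≥0} {u v w P Y : ℝ → ℝ}

lemma pathL2_of_continuousOn (h : ContinuousOn u (Set.Icc 0 (T : ℝ))) : PathL2 T u := by
  obtain ⟨C, hC⟩ := isCompact_Icc.exists_bound_of_continuousOn h
  exact MemLp.of_bound (h.aestronglyMeasurable measurableSet_Icc) C
    ((ae_restrict_mem measurableSet_Icc).mono fun t ht => hC t ht)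

lemma PathL2.congr (h : PathL2 T u) (e : ∀ t ∈ Set.Icc 0 (T : ℝ), u t = v t) : PathL2 T v :=
  MemLp.ae_eq ((ae_restrict_mem measurableSet_Icc).mono fun t ht => e t ht) h

lemma PathL2.interval (h : PathL2 T u) : IntervalIntegrable u volume 0 T :=
  memLp_intervalIntegrable h

lemma PathL2.mul (h : PathL2 T u) (h' : PathL2 T v) :
    IntervalIntegrable (fun t => u t * v t) volume 0 T := memLp_mul_intervalIntegrable h h'

lemma PathL2.sq (h : PathL2 T u) : IntervalIntegrable (fun t => u t ^ 2) volume 0 T := by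
  simpa [pow_two] using h.mul h

lemma continuousOn_primitive (h : IntervalIntegrable u volume 0 T) :
    ContinuousOn (fun t => ∫ s in (0 : ℝ)..t, u s) (Set.Icc 0 (T : ℝ)) := by
  have := intervalIntegral.continuousOn_primitive_interval' h Set.left_mem_uIcc
  rwa [Set.uIcc_of_le T.coe_nonneg] at this

lemma PathL2.primitive (h : PathL2 T u) : PathL2 T fun t => ∫ s in (0 : ℝ)..t, u s :=
  pathL2_of_continuousOn (continuousOn_primitive h.interval)

lemma PathL2.exp_mul (r : ℝ) (h : PathL2 T u) :
    IntervalIntegrable (fun s => Real.exp (r * s) * u s) volume 0 T :=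
  h.interval.continuousOn_mul (by fun_prop)

lemma continuousOn_expConv (r : ℝ) (h : PathL2 T u) :
    ContinuousOn (expConv r u) (Set.Icc 0 (T : ℝ)) :=
  ContinuousOn.mul (by fun_prop) (continuousOn_primitive (h.exp_mul r))

lemma PathL2.expConv (r : ℝ) (h : PathL2 T u) : PathL2 T (expConv r u) :=
  pathL2_of_continuousOn (continuousOn_expConv r h)

lemma PathL2.inventory (x : ℝ) (h : PathL2 T u) : PathL2 T fun t => x - ∫ s in (0 : ℝ)..t, u s :=
  pathL2_of_continuousOn (continuousOn_const.sub (continuousOn_primitive h.interval))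

lemma expConv_sub (r : ℝ) (hu : PathL2 T u) (hv : PathL2 T v) {t : ℝ}
    (ht : t ∈ Set.Icc 0 (T : ℝ)) :
    expConv r (fun s => u s - v s) t = expConv r u t - expConv r v t := by
  have hsub : Set.uIcc 0 t ⊆ Set.uIcc 0 (T : ℝ) := by
    rw [Set.uIcc_of_le ht.1, Set.uIcc_of_le T.coe_nonneg]
    exact Set.Icc_subset_Icc_right ht.2
  unfold CrowdedGame.expConv
  simp only [mul_sub]
  rw [intervalIntegral.integral_sub ((hu.exp_mul r).mono_set hsub) ((hv.exp_mul r).mono_set hsub)]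
  ring

lemma primitive_sub (hu : PathL2 T u) (hv : PathL2 T v) {t : ℝ} (ht : t ∈ Set.Icc 0 (T : ℝ)) :
    ∫ s in (0 : ℝ)..t, (u s - v s) = (∫ s in (0 : ℝ)..t, u s) - ∫ s in (0 : ℝ)..t, v s := by
  have hsub : Set.uIcc 0 t ⊆ Set.uIcc 0 (T : ℝ) := by
    rw [Set.uIcc_of_le ht.1, Set.uIcc_of_le T.coe_nonneg]
    exact Set.Icc_subset_Icc_right ht.2
  exact intervalIntegral.integral_sub (hu.interval.mono_set hsub) (hv.interval.mono_set hsub)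

variable (p : Params) (N : ℕ) (x : ℝ)

/-- The marginal reward at time `t`, along a path, of trading faster: the derivative of the
realized reward of a player trading at rate `u` from inventory `x`, when the price is `P`, the
aggregated impact is `Y`, and the player's own trades contribute a fraction `1 / N` to the impact.
It looks into the future, and is therefore not adapted. -/
def marginal (P Y u : ℝ → ℝ) (t : ℝ) : ℝ :=
  P t - P p.T - p.kappa * Y t
    - p.gamma * p.kappa / N * (Real.exp (p.rho * t) * ∫ s in t..p.T, Real.exp (-p.rho * s) * u s)
    - 2 * p.lam * u t + 2 * p.phi * (∫ s in t..p.T, (x - ∫ r in (0 : ℝ)..s, u r))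
    + 2 * p.varrho * (x - ∫ s in (0 : ℝ)..p.T, u s)

variable {p N x}

/-- The marginal reward tested against a perturbation `v`, with the order of integration
exchanged in the terms that look into the future. -/
lemma integral_mul_marginal (hP : PathL2 p.T P) (hY : PathL2 p.T Y) (hu : PathL2 p.T u)
    (hv : PathL2 p.T v) :
    ∫ t in (0 : ℝ)..p.T, v t * marginal p N x P Y u t =
      (∫ t in (0 : ℝ)..p.T, (P t - p.kappa * Y t) * v t) - P p.T * (∫ t in (0 : ℝ)..p.T, v t)
      - p.gamma * p.kappa / N * (∫ t in (0 : ℝ)..p.T, expConv p.rho v t * u t)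
      - 2 * p.lam * (∫ t in (0 : ℝ)..p.T, u t * v t)
      + 2 * p.phi * (∫ t in (0 : ℝ)..p.T, (∫ s in (0 : ℝ)..t, v s) * (x - ∫ s in (0 : ℝ)..t, u s))
      + 2 * p.varrho * (x - ∫ s in (0 : ℝ)..p.T, u s) * ∫ t in (0 : ℝ)..p.T, v t := by
  have hT := p.T.coe_nonneg
  have e1 : ∫ t in (0 : ℝ)..p.T, (Real.exp (p.rho * t) * v t) *
        (∫ s in t..p.T, Real.exp (-p.rho * s) * u s) =
      ∫ t in (0 : ℝ)..p.T, expConv p.rho v t * u t := by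
    rw [integral_primitive_swap (hv.exp_mul p.rho) (hu.exp_mul (-p.rho))]
    refine intervalIntegral.integral_congr fun t _ => ?_
    simp only [expConv]; ring
  have e2 := integral_primitive_swap hv.interval (hu.inventory x).interval
  have htail : ∀ {k : ℝ → ℝ}, IntervalIntegrable k volume 0 p.T →
      ContinuousOn (fun t => ∫ s in t..p.T, k s) (Set.uIcc 0 (p.T : ℝ)) := by
    intro k hk
    refine ContinuousOn.congr (continuousOn_const (c := ∫ s in (0 : ℝ)..p.T, k s) |>.sub
      (intervalIntegral.continuousOn_primitive_interval' hk Set.left_mem_uIcc)) fun t ht => ?_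
    exact (intervalIntegral.integral_interval_sub_left hk
      (hk.mono_set (Set.uIcc_subset_uIcc_left ht))).symm
  have hPY : PathL2 p.T fun t => P t - p.kappa * Y t := hP.sub (hY.const_mul p.kappa)
  have i1 := hPY.mul hv
  have i2 := hv.interval
  have i3 := (hv.exp_mul p.rho).mul_continuousOn (htail (hu.exp_mul (-p.rho)))
  have i4 := hu.mul hv
  have i5 := hv.interval.mul_continuousOn (htail (hu.inventory x).interval)
  have i6 := (i1.sub (i2.const_mul (P p.T))).sub (i3.const_mul (p.gamma * p.kappa / N))
  have i7 := (i6.sub (i4.const_mul (2 * p.lam))).add (i5.const_mul (2 * p.phi))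
  have hsum : ∫ t in (0 : ℝ)..p.T, v t * marginal p N x P Y u t =
      ∫ t in (0 : ℝ)..p.T, ((P t - p.kappa * Y t) * v t - P p.T * v t
        - p.gamma * p.kappa / N * (Real.exp (p.rho * t) * v t *
          ∫ s in t..p.T, Real.exp (-p.rho * s) * u s)
        - 2 * p.lam * (u t * v t) + 2 * p.phi * (v t * ∫ s in t..p.T, (x - ∫ r in (0 : ℝ)..s, u r))
        + 2 * p.varrho * (x - ∫ s in (0 : ℝ)..p.T, u s) * v t) := by
    refine intervalIntegral.integral_congr fun t _ => ?_
    simp only [marginal]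
    ring
  rw [hsum, intervalIntegral.integral_add i7 (i2.const_mul _),
    intervalIntegral.integral_add (i6.sub (i4.const_mul _)) (i5.const_mul _),
    intervalIntegral.integral_sub i6 (i4.const_mul _),
    intervalIntegral.integral_sub (i1.sub (i2.const_mul _)) (i3.const_mul _),
    intervalIntegral.integral_sub i1 (i2.const_mul _)]
  simp only [intervalIntegral.integral_const_mul]
  rw [e1, e2]

lemma expConv_energy_nonneg (hv : PathL2 p.T v) :
    0 ≤ ∫ t in (0 : ℝ)..p.T, expConv p.rho v t * v t :=
  integral_exp_kernel_nonneg p.rho_pos.le p.T.coe_nonneg hv.interval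

/-- Strict monotonicity of the marginal reward in the strategy. -/
lemma integral_sub_mul_marginal_le {Y' u' : ℝ → ℝ} (hP : PathL2 p.T P) (hY : PathL2 p.T Y)
    (hY' : PathL2 p.T Y') (hu : PathL2 p.T u) (hu' : PathL2 p.T u') :
    (∫ t in (0 : ℝ)..p.T, (u t - u' t) * marginal p N x P Y u t) -
      (∫ t in (0 : ℝ)..p.T, (u t - u' t) * marginal p N x P Y' u' t) ≤
    - p.kappa * (∫ t in (0 : ℝ)..p.T, (Y t - Y' t) * (u t - u' t)) -
      2 * p.lam * ∫ t in (0 : ℝ)..p.T, (u t - u' t) ^ 2 := by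
  have hT := p.T.coe_nonneg
  have hd : PathL2 p.T fun t => u t - u' t := hu.sub hu'
  rw [integral_mul_marginal hP hY hu hd, integral_mul_marginal hP hY' hu' hd]
  have a1 : (∫ t in (0 : ℝ)..p.T, (P t - p.kappa * Y t) * (u t - u' t)) -
      (∫ t in (0 : ℝ)..p.T, (P t - p.kappa * Y' t) * (u t - u' t)) =
      - p.kappa * (∫ t in (0 : ℝ)..p.T, (Y t - Y' t) * (u t - u' t)) := by
    have hPY : PathL2 p.T fun t => P t - p.kappa * Y t := hP.sub (hY.const_mul p.kappa)
    have hPY' : PathL2 p.T fun t => P t - p.kappa * Y' t := hP.sub (hY'.const_mul p.kappa)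
    rw [← intervalIntegral.integral_sub (hPY.mul hd) (hPY'.mul hd),
      ← intervalIntegral.integral_const_mul]
    exact intervalIntegral.integral_congr fun t _ => by ring
  have a2 : (∫ t in (0 : ℝ)..p.T, expConv p.rho (fun t => u t - u' t) t * u t) -
      (∫ t in (0 : ℝ)..p.T, expConv p.rho (fun t => u t - u' t) t * u' t) =
      ∫ t in (0 : ℝ)..p.T, expConv p.rho (fun t => u t - u' t) t * (u t - u' t) := by
    rw [← intervalIntegral.integral_sub ((hd.expConv _).mul hu) ((hd.expConv _).mul hu')]
    exact intervalIntegral.integral_congr fun t _ => by ring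
  have a3 : (∫ t in (0 : ℝ)..p.T, u t * (u t - u' t)) - (∫ t in (0 : ℝ)..p.T, u' t * (u t - u' t))
      = ∫ t in (0 : ℝ)..p.T, (u t - u' t) ^ 2 := by
    rw [← intervalIntegral.integral_sub (hu.mul hd) (hu'.mul hd)]
    exact intervalIntegral.integral_congr fun t _ => by ring
  have a4 : (∫ t in (0 : ℝ)..p.T, (∫ s in (0 : ℝ)..t, (u s - u' s)) *
        (x - ∫ s in (0 : ℝ)..t, u s)) -
      (∫ t in (0 : ℝ)..p.T, (∫ s in (0 : ℝ)..t, (u s - u' s)) * (x - ∫ s in (0 : ℝ)..t, u' s)) =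
      - ∫ t in (0 : ℝ)..p.T, (∫ s in (0 : ℝ)..t, (u s - u' s)) ^ 2 := by
    rw [← intervalIntegral.integral_sub (hd.primitive.mul (hu.inventory x))
      (hd.primitive.mul (hu'.inventory x)), ← intervalIntegral.integral_neg]
    refine intervalIntegral.integral_congr fun t ht => ?_
    rw [Set.uIcc_of_le hT] at ht
    rw [primitive_sub hu hu' ht]
    ring
  have a5 := primitive_sub hu hu' (Set.right_mem_Icc.2 hT)
  have n1 := expConv_energy_nonneg hd
  have n2 : 0 ≤ ∫ t in (0 : ℝ)..p.T, (∫ s in (0 : ℝ)..t, (u s - u' s)) ^ 2 :=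
    intervalIntegral.integral_nonneg hT fun t _ => sq_nonneg _
  set D := ∫ s in (0 : ℝ)..p.T, (u s - u' s)
  have n3 := mul_nonneg p.varrho_pos.le (sq_nonneg D)
  have hc : 0 ≤ p.gamma * p.kappa / N :=
    div_nonneg (mul_pos p.gamma_pos p.kappa_pos).le (Nat.cast_nonneg N)
  have n4 := mul_nonneg hc n1
  have n5 := mul_nonneg p.phi_pos.le n2
  have a5' : 2 * p.varrho * (x - ∫ s in (0 : ℝ)..p.T, u s) * D -
      2 * p.varrho * (x - ∫ s in (0 : ℝ)..p.T, u' s) * D = - 2 * (p.varrho * D ^ 2) := by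
    rw [a5]; ring
  linear_combination a1 + (-p.gamma * p.kappa / N) * a2 - 2 * p.lam * a3 + 2 * p.phi * a4 + a5' +
    n4 + 2 * n5 + 2 * n3

/-- The realized reward along a path. -/
def pathReward (p : Params) (x : ℝ) (P Y u : ℝ → ℝ) : ℝ :=
  (∫ t in (0 : ℝ)..p.T, (P t - p.kappa * Y t) * u t) - p.lam * (∫ t in (0 : ℝ)..p.T, u t ^ 2)
    - p.phi * (∫ t in (0 : ℝ)..p.T, (x - ∫ s in (0 : ℝ)..t, u s) ^ 2)
    + (x - ∫ s in (0 : ℝ)..p.T, u s) * (P p.T - p.varrho * (x - ∫ s in (0 : ℝ)..p.T, u s))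

/-- The second order term in the expansion of the realized reward. -/
def pathCost (p : Params) (N : ℕ) (v : ℝ → ℝ) : ℝ :=
  p.gamma * p.kappa / N * (∫ t in (0 : ℝ)..p.T, expConv p.rho v t * v t)
    + p.lam * (∫ t in (0 : ℝ)..p.T, v t ^ 2)
    + p.phi * (∫ t in (0 : ℝ)..p.T, (∫ s in (0 : ℝ)..t, v s) ^ 2)
    + p.varrho * (∫ s in (0 : ℝ)..p.T, v s) ^ 2

lemma pathCost_nonneg (hv : PathL2 p.T v) : 0 ≤ pathCost p N v := by
  have hT := p.T.coe_nonneg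
  have n1 := expConv_energy_nonneg hv
  have n2 : 0 ≤ ∫ t in (0 : ℝ)..p.T, (∫ s in (0 : ℝ)..t, v s) ^ 2 :=
    intervalIntegral.integral_nonneg hT fun t _ => sq_nonneg _
  have n3 : 0 ≤ ∫ t in (0 : ℝ)..p.T, v t ^ 2 :=
    intervalIntegral.integral_nonneg hT fun t _ => sq_nonneg _
  have := p.gamma_pos; have := p.kappa_pos; have := p.lam_pos; have := p.phi_pos
  have := p.varrho_pos
  unfold pathCost
  positivity

/-- The exact second order expansion of the realized reward: a perturbation `v` of the strategy
moves the aggregated impact by `γ / N` times its exponentially weighted running integral. -/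
lemma pathReward_add {Y' u' : ℝ → ℝ} (hP : PathL2 p.T P) (hY : PathL2 p.T Y) (hu : PathL2 p.T u)
    (hv : PathL2 p.T v) (hu' : ∀ t, u' t = u t + v t)
    (hY' : ∀ t ∈ Set.Icc 0 (p.T : ℝ), Y' t = Y t + p.gamma / N * expConv p.rho v t) :
    pathReward p x P Y' u' - pathReward p x P Y u =
      (∫ t in (0 : ℝ)..p.T, v t * marginal p N x P Y u t) - pathCost p N v := by
  have hT := p.T.coe_nonneg
  obtain rfl : u' = fun t => u t + v t := funext hu'
  have hI := hv.expConv p.rho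
  rw [integral_mul_marginal hP hY hu hv]
  have hPY : PathL2 p.T fun t => P t - p.kappa * Y t := hP.sub (hY.const_mul p.kappa)
  have a1 : ∫ t in (0 : ℝ)..p.T, (P t - p.kappa * Y' t) * (u t + v t) =
      (∫ t in (0 : ℝ)..p.T, (P t - p.kappa * Y t) * u t) +
      (∫ t in (0 : ℝ)..p.T, (P t - p.kappa * Y t) * v t) -
      p.gamma * p.kappa / N * (∫ t in (0 : ℝ)..p.T, expConv p.rho v t * u t) -
      p.gamma * p.kappa / N * (∫ t in (0 : ℝ)..p.T, expConv p.rho v t * v t) := by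
    simp only [← intervalIntegral.integral_const_mul]
    rw [← intervalIntegral.integral_add (hPY.mul hu) (hPY.mul hv),
      ← intervalIntegral.integral_sub ((hPY.mul hu).add (hPY.mul hv)) ((hI.mul hu).const_mul _),
      ← intervalIntegral.integral_sub (((hPY.mul hu).add (hPY.mul hv)).sub
        ((hI.mul hu).const_mul _)) ((hI.mul hv).const_mul _)]
    refine intervalIntegral.integral_congr fun t ht => ?_
    rw [Set.uIcc_of_le hT] at ht
    rw [hY' t ht]
    ring
  have a2 : ∫ t in (0 : ℝ)..p.T, (u t + v t) ^ 2 = (∫ t in (0 : ℝ)..p.T, u t ^ 2) +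
      2 * (∫ t in (0 : ℝ)..p.T, u t * v t) + ∫ t in (0 : ℝ)..p.T, v t ^ 2 := by
    simp only [← intervalIntegral.integral_const_mul]
    rw [← intervalIntegral.integral_add hu.sq ((hu.mul hv).const_mul _),
      ← intervalIntegral.integral_add (hu.sq.add ((hu.mul hv).const_mul _)) hv.sq]
    exact intervalIntegral.integral_congr fun t _ => by ring
  have hprim : ∀ t ∈ Set.Icc 0 (p.T : ℝ), ∫ s in (0 : ℝ)..t, (u s + v s) =
      (∫ s in (0 : ℝ)..t, u s) + ∫ s in (0 : ℝ)..t, v s := by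
    intro t ht
    have := primitive_sub hu hv.neg ht
    simpa [sub_eq_add_neg] using this
  have a3 : ∫ t in (0 : ℝ)..p.T, (x - ∫ s in (0 : ℝ)..t, (u s + v s)) ^ 2 =
      (∫ t in (0 : ℝ)..p.T, (x - ∫ s in (0 : ℝ)..t, u s) ^ 2) -
      2 * (∫ t in (0 : ℝ)..p.T, (∫ s in (0 : ℝ)..t, v s) * (x - ∫ s in (0 : ℝ)..t, u s)) +
      ∫ t in (0 : ℝ)..p.T, (∫ s in (0 : ℝ)..t, v s) ^ 2 := by
    have b1 := (hu.inventory x).sq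
    have b2 := hv.primitive.mul (hu.inventory x)
    simp only [← intervalIntegral.integral_const_mul]
    rw [← intervalIntegral.integral_sub b1 (b2.const_mul _),
      ← intervalIntegral.integral_add (b1.sub (b2.const_mul _)) hv.primitive.sq]
    refine intervalIntegral.integral_congr fun t ht => ?_
    rw [Set.uIcc_of_le hT] at ht
    rw [hprim t ht]
    ring
  unfold pathReward pathCost
  rw [a1, a2, a3, hprim _ (Set.right_mem_Icc.2 hT)]
  ring

/-- The adjoint variable of the player's system, compensated by its martingale part, solves a linear
backward equation along each path. -/
lemma adjoint_eq_of_path {Z K : ℝ → ℝ} {c : ℝ} (hu : IntervalIntegrable u volume 0 p.T)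
    (hZ : IntervalIntegrable Z volume 0 p.T) (hK : IntervalIntegrable K volume 0 p.T)
    (eqZ : ∀ t ∈ Set.Icc 0 (p.T : ℝ), Z t = Z 0
        + (∫ s in (0 : ℝ)..t, (p.rho * Z s + c * u s)) + (K t - K 0))
    (terminal_Z : Z p.T = 0) : ∀ t ∈ Set.Icc 0 (p.T : ℝ),
    Z t + (K p.T - K t) =
      - c * (Real.exp (p.rho * t) * ∫ s in t..p.T, Real.exp (-p.rho * s) * u s) +
      p.rho * (Real.exp (p.rho * t) *
        ∫ s in t..p.T, Real.exp (-p.rho * s) * (K p.T - K s)) := by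
  intro t ht
  have hT := p.T.coe_nonneg
  have hsub : Set.uIcc 0 t ⊆ Set.uIcc 0 (p.T : ℝ) := by
    rw [Set.uIcc_of_le ht.1, Set.uIcc_of_le hT]
    exact Set.Icc_subset_Icc_right ht.2
  have hsub' : Set.uIcc t p.T ⊆ Set.uIcc 0 (p.T : ℝ) := by
    rw [Set.uIcc_of_le ht.2, Set.uIcc_of_le hT]
    exact Set.Icc_subset_Icc_left ht.1
  set a : ℝ → ℝ := fun s => Z s + (K p.T - K s) with ha
  set k : ℝ → ℝ := fun s => c * u s - p.rho * (K p.T - K s) with hk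
  have hKi : IntervalIntegrable (fun s => K p.T - K s) volume 0 p.T :=
    intervalIntegrable_const.sub hK
  have hki : IntervalIntegrable k volume 0 p.T := (hu.const_mul _).sub (hKi.const_mul _)
  have hai : IntervalIntegrable a volume 0 p.T := hZ.add hKi
  have hODE := exp_mul_eq_of_linear_integral_eq (r := p.rho) (c := a 0) hki hai (fun s hs => by
    rw [Set.uIcc_of_le hT] at hs
    simp only [ha]
    rw [eqZ s hs]
    have : ∫ r in (0 : ℝ)..s, (p.rho * (Z r + (K p.T - K r)) + k r) =
        ∫ r in (0 : ℝ)..s, (p.rho * Z r + c * u r) :=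
      intervalIntegral.integral_congr fun r _ => by simp only [hk]; ring
    rw [this]
    ring)
  have h1 := hODE t (by rwa [Set.uIcc_of_le hT])
  have h2 := hODE p.T (by simp)
  have haT : a p.T = 0 := by simp [ha, terminal_Z]
  rw [haT, mul_zero] at h2
  have hki' : IntervalIntegrable (fun s => Real.exp (-p.rho * s) * k s) volume 0 p.T :=
    hki.continuousOn_mul (by fun_prop)
  have h3 : Real.exp (-p.rho * t) * a t = - ∫ s in t..p.T, Real.exp (-p.rho * s) * k s := by
    rw [← intervalIntegral.integral_interval_sub_left hki' (hki'.mono_set hsub), h1]; linarith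
  have h4 : ∫ s in t..p.T, Real.exp (-p.rho * s) * k s =
      c * (∫ s in t..p.T, Real.exp (-p.rho * s) * u s) -
      p.rho * ∫ s in t..p.T, Real.exp (-p.rho * s) * (K p.T - K s) := by
    rw [← intervalIntegral.integral_const_mul, ← intervalIntegral.integral_const_mul,
      ← intervalIntegral.integral_sub]
    · exact intervalIntegral.integral_congr fun s _ => by simp only [hk]; ring
    · exact ((hu.mono_set hsub').continuousOn_mul (by fun_prop)).const_mul _
    · exact ((hKi.mono_set hsub').continuousOn_mul (by fun_prop)).const_mul _
  have hee : Real.exp (p.rho * t) * Real.exp (-p.rho * t) = 1 := by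
    rw [← Real.exp_add]; simp
  calc a t = Real.exp (p.rho * t) * (Real.exp (-p.rho * t) * a t) := by
        rw [← mul_assoc, hee, one_mul]
    _ = _ := by rw [h3, h4]; ring

/-- Along a solution of the player's system the marginal reward is a combination of future
martingale increments. -/
lemma marginal_eq_of_path {X Z M K : ℝ → ℝ} (hN : 1 ≤ N) (hu : IntervalIntegrable u volume 0 p.T)
    (hX : IntervalIntegrable X volume 0 p.T)
    (hZ : IntervalIntegrable Z volume 0 p.T) (hK : IntervalIntegrable K volume 0 p.T)
    (eqX : ∀ t ∈ Set.Icc 0 (p.T : ℝ), X t = x - ∫ s in (0 : ℝ)..t, u s)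
    (equ : ∀ t ∈ Set.Icc 0 (p.T : ℝ), u t = u 0
        + 1 / (2 * p.lam) * ((P t - P 0) - p.kappa * (Y t - Y 0))
        + (∫ s in (0 : ℝ)..t, (p.gamma * p.kappa / (2 * p.lam * N) * u s - p.phi * X s / p.lam
              + p.rho * Z s / (2 * p.lam))) + (M t - M 0))
    (eqZ : ∀ t ∈ Set.Icc 0 (p.T : ℝ), Z t = Z 0
        + (∫ s in (0 : ℝ)..t, (p.rho * Z s + p.gamma * p.kappa / N * u s)) + (K t - K 0))
    (terminal_u : u p.T = p.varrho / p.lam * X p.T - p.kappa / (2 * p.lam) * Y p.T)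
    (terminal_Z : Z p.T = 0) : ∀ t ∈ Set.Icc 0 (p.T : ℝ),
    marginal p N x P Y u t = 2 * p.lam * (M p.T - M t)
      - p.rho * (Real.exp (p.rho * t) * ∫ s in t..p.T, Real.exp (-p.rho * s) * (K p.T - K s)) := by
  intro t ht
  have hT := p.T.coe_nonneg
  have hTm : (p.T : ℝ) ∈ Set.Icc 0 (p.T : ℝ) := Set.right_mem_Icc.2 hT
  have hl := p.lam_pos.ne'
  have hN0 : (N : ℝ) ≠ 0 := by positivity
  have hsub : Set.uIcc 0 t ⊆ Set.uIcc 0 (p.T : ℝ) := by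
    rw [Set.uIcc_of_le ht.1, Set.uIcc_of_le hT]
    exact Set.Icc_subset_Icc_right ht.2
  have tail : ∀ {k : ℝ → ℝ}, IntervalIntegrable k volume 0 p.T →
      ∫ s in t..p.T, k s = (∫ s in (0 : ℝ)..p.T, k s) - ∫ s in (0 : ℝ)..t, k s := fun {k} hk =>
    (intervalIntegral.integral_interval_sub_left hk (hk.mono_set hsub)).symm
  have hsub' : Set.uIcc t p.T ⊆ Set.uIcc 0 (p.T : ℝ) := by
    rw [Set.uIcc_of_le ht.2, Set.uIcc_of_le hT]
    exact Set.Icc_subset_Icc_left ht.1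
  set c := p.gamma * p.kappa / N with hc
  have h5 := adjoint_eq_of_path hu hZ hK eqZ terminal_Z t ht
  -- the equation for the strategy between `t` and `T`
  have hut := equ t ht
  have huT := equ p.T hTm
  have hfi : IntervalIntegrable (fun s => p.gamma * p.kappa / (2 * p.lam * N) * u s
      - p.phi * X s / p.lam + p.rho * Z s / (2 * p.lam)) volume 0 p.T :=
    ((hu.const_mul _).sub ((hX.const_mul _).div_const _)).add ((hZ.const_mul _).div_const _)
  have hgi : IntervalIntegrable (fun s => p.rho * Z s + c * u s) volume 0 p.T :=
    (hZ.const_mul _).add (hu.const_mul _)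
  have hZt := eqZ t ht
  have hZT := eqZ p.T hTm
  have e1 := tail hfi
  have e2 := tail hgi
  have e3 : ∫ s in t..p.T, (p.gamma * p.kappa / (2 * p.lam * N) * u s
      - p.phi * X s / p.lam + p.rho * Z s / (2 * p.lam)) =
      1 / (2 * p.lam) * (∫ s in t..p.T, (p.rho * Z s + c * u s)) -
      p.phi / p.lam * ∫ s in t..p.T, X s := by
    rw [← intervalIntegral.integral_const_mul, ← intervalIntegral.integral_const_mul,
      ← intervalIntegral.integral_sub]
    · refine intervalIntegral.integral_congr fun s _ => ?_
      simp only [hc]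
      field_simp
      ring
    · exact (hgi.mono_set hsub').const_mul _
    · exact (hX.mono_set hsub').const_mul _
  have e4 : ∫ s in t..p.T, (x - ∫ r in (0 : ℝ)..s, u r) = ∫ s in t..p.T, X s := by
    refine intervalIntegral.integral_congr fun s hs => ?_
    rw [Set.uIcc_of_le ht.2] at hs
    exact (eqX s ⟨ht.1.trans hs.1, hs.2⟩).symm
  unfold marginal
  rw [e4, ← eqX _ hTm]
  have q1 : ∫ s in t..p.T, (p.rho * Z s + c * u s) = -Z t - (K p.T - K t) := by
    rw [e2]; linarith
  have q2 : u p.T - u t = 1 / (2 * p.lam) * ((P p.T - P t) - p.kappa * (Y p.T - Y t)) +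
      (1 / (2 * p.lam) * (-Z t - (K p.T - K t)) - p.phi / p.lam * ∫ s in t..p.T, X s) +
      (M p.T - M t) := by
    rw [← q1, ← e3, e1]; linarith
  rw [terminal_u] at q2
  field_simp at q2
  linear_combination q2 - h5

end Path

end

section

variable {Ω : Type*} {mΩ : MeasurableSpace Ω} {μ : Measure Ω} {𝓕 : Filtration ℝ≥0 mΩ} {T : ℝ≥0}

/-! ### Processes over the horizon and martingale increments -/

lemma memLp_horizon_const [IsFiniteMeasure μ] {g : Ω → ℝ} (hg : MemLp g 2 μ) :
    MemLp (fun z : Ω × ℝ => g z.1) 2 (horizonMeasure μ T) := hg.comp_fst _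

lemma memLp_horizon_mul [SFinite μ] {f : Ω × ℝ → ℝ} (hf : MemLp f 2 (horizonMeasure μ T))
    {c : ℝ → ℝ} (hc : Continuous c) : MemLp (fun z => c z.2 * f z) 2 (horizonMeasure μ T) := by
  obtain ⟨C, hC⟩ := (isCompact_Icc (a := (0 : ℝ)) (b := T)).exists_bound_of_continuousOn
    hc.continuousOn
  refine hf.of_le_mul (c := C)
    ((hc.measurable.comp measurable_snd).aestronglyMeasurable.mul hf.1) ?_
  filter_upwards [ae_horizon_mem (μ := μ) (T := T)] with z hz
  rw [norm_mul]
  exact mul_le_mul_of_nonneg_right (hC _ hz) (norm_nonneg _)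

/-- The running time integral of a square integrable process, as a process. -/
lemma memLp_horizon_primitive [SFinite μ] {f : Ω × ℝ → ℝ} (hf : MemLp f 2 (horizonMeasure μ T)) :
    MemLp (fun z : Ω × ℝ => ∫ r in (0 : ℝ)..z.2, f (z.1, r)) 2 (horizonMeasure μ T) := by
  obtain ⟨g, hg, hfg⟩ := hf.1
  have hm : AEStronglyMeasurable (fun z : Ω × ℝ => ∫ r in (0 : ℝ)..z.2, f (z.1, r))
      (horizonMeasure μ T) := by
    set k : (Ω × ℝ) × ℝ → ℝ := fun q => {q : (Ω × ℝ) × ℝ | q.2 ≤ q.1.2}.indicator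
      (fun q => g (q.1.1, q.2)) q with hk
    have hkm : StronglyMeasurable k := by
      refine StronglyMeasurable.indicator (hg.comp_measurable (by fun_prop)) ?_
      exact measurableSet_le (by fun_prop) (by fun_prop)
    refine ⟨fun z => ∫ r in Set.Ioc (0 : ℝ) T, k (z, r), hkm.integral_prod_right', ?_⟩
    have h1 := Measure.ae_ae_of_ae_prod hfg
    filter_upwards [Measure.quasiMeasurePreserving_fst.ae h1, ae_horizon_mem (μ := μ) (T := T)]
      with z hz hz2
    rw [intervalIntegral.integral_of_le hz2.1]
    have e : ∀ r, k (z, r) = (Set.Iic z.2).indicator (fun r => g (z.1, r)) r := fun r => by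
      simp only [hk, Set.indicator, Set.mem_ofPred_eq, Set.mem_Iic]
    simp only [e]
    rw [setIntegral_indicator measurableSet_Iic]
    have e2 : Set.Ioc (0 : ℝ) T ∩ Set.Iic z.2 = Set.Ioc 0 z.2 := by
      ext r
      simp only [Set.mem_inter_iff, Set.mem_Ioc, Set.mem_Iic]
      exact ⟨fun h => ⟨h.1.1, h.2⟩, fun h => ⟨⟨h.1, h.2.trans hz2.2⟩, h.2⟩⟩
    rw [e2]
    refine integral_congr_ae ?_
    refine ae_restrict_of_ae_restrict_of_subset (fun r hr => ?_) hz
    exact ⟨hr.1.le, hr.2.trans hz2.2⟩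
  refine ⟨hm, ?_⟩
  obtain ⟨C, hC, h⟩ := exists_bound_eLpNorm_primitive hf
  have hfin : (T : ℝ≥0∞) * C ^ 2 ≠ ∞ := by finiteness
  obtain ⟨D, hD, hD2⟩ := exists_sq_eq hfin
  refine lt_of_le_of_lt (eLpNorm_two_le_of_sq_le ?_) (lt_top_iff_ne_top.2 hD)
  rw [hD2, lintegral_prod_symm _ (hm.enorm.pow_const 2)]
  calc ∫⁻ s in Set.Icc (0 : ℝ) T, ∫⁻ ω, ‖∫ r in (0 : ℝ)..s, f (ω, r)‖ₑ ^ 2 ∂μ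
      ≤ ∫⁻ s in Set.Icc (0 : ℝ) T, C ^ 2 := by
        refine setLIntegral_mono' measurableSet_Icc fun s hs => ?_
        rw [← eLpNorm_two_sq]
        gcongr
        exact h 0 s le_rfl hs.1 hs.2
    _ = T * C ^ 2 := by simp [mul_comm]

lemma memLp_horizon_integral [SFinite μ] {f : Ω × ℝ → ℝ} (hf : MemLp f 2 (horizonMeasure μ T)) :
    MemLp (fun ω => ∫ r in (0 : ℝ)..T, f (ω, r)) 2 μ := by
  obtain ⟨C, hC, h⟩ := exists_bound_eLpNorm_primitive hf
  refine ⟨?_, (h 0 T le_rfl T.coe_nonneg le_rfl).trans_lt (lt_top_iff_ne_top.2 hC)⟩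
  simp only [intervalIntegral.integral_of_le T.coe_nonneg, ← integral_Icc_eq_integral_Ioc]
  exact hf.1.integral_prod_right'

lemma integrable_horizon_integral [SFinite μ] {f : Ω × ℝ → ℝ}
    (hf : Integrable f (horizonMeasure μ T)) :
    Integrable (fun ω => ∫ r in (0 : ℝ)..T, f (ω, r)) μ := by
  simp only [intervalIntegral.integral_of_le T.coe_nonneg, ← integral_Icc_eq_integral_Ioc]
  exact hf.integral_prod_left

section AdmissibleClosure

variable [SFinite μ] {u v : ℝ≥0 → Ω → ℝ}

lemma Admissible.add (hu : Admissible μ 𝓕 T u) (hv : Admissible μ 𝓕 T v) :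
    Admissible μ 𝓕 T fun t ω => u t ω + v t ω :=
  admissible_of_memLp (fun i => (hu.1 i).add (hv.1 i)) (hu.memLp.add hv.memLp)

lemma Admissible.const_mul (hu : Admissible μ 𝓕 T u) (c : ℝ) :
    Admissible μ 𝓕 T fun t ω => c * u t ω :=
  admissible_of_memLp (fun i => (hu.1 i).const_mul c) (hu.memLp.const_mul c)

lemma Admissible.sub (hu : Admissible μ 𝓕 T u) (hv : Admissible μ 𝓕 T v) :
    Admissible μ 𝓕 T fun t ω => u t ω - v t ω :=
  admissible_of_memLp (fun i => (hu.1 i).sub (hv.1 i)) (hu.memLp.sub hv.memLp)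

lemma Admissible.zero : Admissible μ 𝓕 T fun _ _ => 0 :=
  admissible_of_memLp (fun _ => stronglyMeasurable_const) MemLp.zero

lemma Admissible.sum {κ : Type*} (s : Finset κ) {w : κ → ℝ≥0 → Ω → ℝ}
    (hw : ∀ k, Admissible μ 𝓕 T (w k)) : Admissible μ 𝓕 T fun t ω => ∑ k ∈ s, w k t ω := by
  classical
  induction s using Finset.induction_on with
  | empty => simpa using Admissible.zero
  | insert a s ha ih =>
    simp only [Finset.sum_insert ha]
    exact (hw a).add ih

lemma Admissible.ae_pathL2 (hu : Admissible μ 𝓕 T u) :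
    ∀ᵐ ω ∂μ, PathL2 T fun t => u t.toNNReal ω := ae_memLp_path hu.memLp

omit [SFinite μ] in
lemma Admissible.stronglyMeasurable (hu : Admissible μ 𝓕 T u) {t : ℝ≥0} (ht : t ≤ T) :
    StronglyMeasurable[𝓕 t] (u t) := by
  have := hu.1.stronglyAdapted t
  have e : stopAt T u t = u t := by funext ω; simp [stopAt, min_eq_left ht]
  rwa [e] at this

end AdmissibleClosure

/-- Càdlàg paths are square integrable. -/
lemma AeCadlag.ae_pathL2 {X : ℝ≥0 → Ω → ℝ} (hX : AeCadlag μ T X) :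
    ∀ᵐ ω ∂μ, PathL2 T fun t => X t.toNNReal ω := by
  filter_upwards [hX] with ω hω
  have h1 := hω.memLp 0 T 2
  rw [Set.uIoc_of_le T.coe_nonneg, Measure.restrict_congr_set Ioc_ae_eq_Icc] at h1
  refine MemLp.ae_eq ?_ h1
  filter_upwards [ae_restrict_mem measurableSet_Icc] with t ht
  simp [stopAt, min_eq_left (Real.toNNReal_le_iff_le_coe.2 ht.2)]

/-- A square integrable martingale has a version all of whose paths are càdlàg. -/
lemma IsSqIntMartingale.exists_version [IsFiniteMeasure μ] (h𝓕 : UsualConditions 𝓕 μ)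
    {M : ℝ≥0 → Ω → ℝ} (hM : IsSqIntMartingale μ 𝓕 T M) :
    ∃ M', CadlagL2 μ 𝓕 T M' ∧ Martingale M' 𝓕 μ ∧ Indist μ T M M' := by
  obtain ⟨M', h1, h2, h3, h4⟩ := h𝓕.exists_cadlag_version hM.martingale.1 hM.cadlag
  have h5 : ∀ t, stopAt T M t =ᵐ[μ] M' t := by
    intro t
    filter_upwards [h4] with ω hω
    rw [← h3, ← hω _ (min_le_right _ _)]
    rfl
  have h6 : ∀ t, M' t =ᵐ[μ] μ[M T|𝓕 t] := by
    intro t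
    rcases le_total t T with h | h
    · have := hM.martingale.2 t T h
      have e : stopAt T M T = M T := by funext ω; simp [stopAt]
      rw [e] at this
      exact (this.trans (h5 t)).symm
    · have e : stopAt T M t = M T := by funext ω; simp [stopAt, min_eq_right h]
      have e' : stopAt T M t = stopAt T M T := by
        funext ω; simp [stopAt, min_eq_right h]
      have hsm : StronglyMeasurable[𝓕 t] (M T) := e ▸ hM.martingale.1 t
      rw [condExp_of_stronglyMeasurable (𝓕.le t) hsm (hM.memLp.integrable (by norm_num))]
      exact (h5 t).symm.trans (by rw [e])
  refine ⟨M', ⟨h1, h2, h3, eLpNorm (M T) 2 μ, hM.memLp.2.ne, fun t => ?_⟩, ⟨h2, fun s t hst => ?_⟩,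
    h4⟩
  · rw [eLpNorm_congr_ae (h6 t)]
    exact eLpNorm_condExp_le_eLpNorm _ (by norm_num)
  · exact ((condExp_congr_ae (h5 t)).symm.trans (hM.martingale.2 s t hst)).trans (h5 s)

lemma CadlagL2.isSqIntMartingale {M : ℝ≥0 → Ω → ℝ} (hM : CadlagL2 μ 𝓕 T M)
    (hM' : Martingale M 𝓕 μ) : IsSqIntMartingale μ 𝓕 T M :=
  ⟨by rwa [hM.stopAt_eq], hM.memLp T, hM.aeCadlag⟩

/-- Adapted square integrable processes are orthogonal to future martingale increments. -/
lemma integral_mul_martingale_increment [IsFiniteMeasure μ] {v M : ℝ≥0 → Ω → ℝ}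
    (hva : ∀ t ≤ T, StronglyMeasurable[𝓕 t] (v t)) (hv : MemLp (lift v) 2 (horizonMeasure μ T))
    (hM : CadlagL2 μ 𝓕 T M) (hM' : Martingale M 𝓕 μ) :
    Integrable (fun ω => ∫ t in (0 : ℝ)..T, v t.toNNReal ω * (M T ω - M t.toNNReal ω)) μ ∧
      ∫ ω, (∫ t in (0 : ℝ)..T, v t.toNNReal ω * (M T ω - M t.toNNReal ω)) ∂μ = 0 := by
  have h1 : Integrable (fun z => lift v z * M T z.1) (horizonMeasure μ T) :=
    hv.integrable_mul (memLp_horizon_const (hM.memLp T))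
  have h2 : Integrable (fun z => lift v z * lift M z) (horizonMeasure μ T) :=
    hv.integrable_mul hM.memLp_lift
  have h3 : Integrable (fun z : Ω × ℝ => v z.2.toNNReal z.1 * (M T z.1 - M z.2.toNNReal z.1))
      (horizonMeasure μ T) := by
    refine (h1.sub h2).congr (Eventually.of_forall fun z => ?_)
    simp only [Pi.sub_apply, lift]; ring
  refine ⟨integrable_horizon_integral h3, ?_⟩
  simp only [intervalIntegral.integral_of_le T.coe_nonneg, ← integral_Icc_eq_integral_Ioc]
  rw [integral_integral_swap h3]
  refine integral_eq_zero_of_ae ?_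
  filter_upwards [h1.prod_left_ae, h2.prod_left_ae, ae_restrict_mem measurableSet_Icc]
    with t i1 i2 ht
  have htT : t.toNNReal ≤ T := Real.toNNReal_le_iff_le_coe.2 ht.2
  replace i1 : Integrable (fun ω => v t.toNNReal ω * M T ω) μ := i1
  replace i2 : Integrable (fun ω => v t.toNNReal ω * M t.toNNReal ω) μ := i2
  have hce := condExp_mul_of_stronglyMeasurable_left (hva _ htT) i1 (hM.integrable T)
  have hmt := hM'.2 _ _ htT
  have e1 : ∫ ω, v t.toNNReal ω * M T ω ∂μ = ∫ ω, v t.toNNReal ω * M t.toNNReal ω ∂μ := by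
    rw [← integral_condExp (𝓕.le t.toNNReal)]
    refine integral_congr_ae ?_
    filter_upwards [hce, hmt] with ω h4 h5
    change (μ[v t.toNNReal * M T|𝓕 t.toNNReal]) ω = _
    rw [h4, Pi.mul_apply, h5]
  have e2 : ∀ ω, v t.toNNReal ω * (M T ω - M t.toNNReal ω) =
      v t.toNNReal ω * M T ω - v t.toNNReal ω * M t.toNNReal ω := fun ω => by ring
  simp only [e2, Pi.zero_apply]
  rw [integral_sub i1 i2, e1, sub_self]

/-- Admissible processes are orthogonal to the discounted tails of martingale increments. -/
lemma integral_mul_martingale_tail [IsFiniteMeasure μ] {v M : ℝ≥0 → Ω → ℝ} (r : ℝ)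
    (hv : Admissible μ 𝓕 T v) (hM : CadlagL2 μ 𝓕 T M) (hM' : Martingale M 𝓕 μ) :
    Integrable (fun ω => ∫ t in (0 : ℝ)..T, v t.toNNReal ω * (Real.exp (r * t) *
      ∫ s in t..T, Real.exp (-r * s) * (M T ω - M s.toNNReal ω))) μ ∧
    ∫ ω, (∫ t in (0 : ℝ)..T, v t.toNNReal ω * (Real.exp (r * t) *
      ∫ s in t..T, Real.exp (-r * s) * (M T ω - M s.toNNReal ω))) ∂μ = 0 := by
  set v' : ℝ≥0 → Ω → ℝ := fun t ω => expConv r (fun s => v s.toNNReal ω) t with hv'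
  have hvE : Admissible μ 𝓕 T fun t ω => Real.exp (r * (t : ℝ)) * v t ω := by
    refine admissible_of_memLp (fun i => ?_) ?_
    · refine StronglyMeasurable.mul ?_ (hv.1 i)
      refine (Continuous.stronglyMeasurable ?_).comp_measurable (measurable_subtype_coe.comp
        measurable_fst) (f := fun t : ℝ≥0 => Real.exp (r * ((min t T : ℝ≥0) : ℝ)))
      fun_prop
    · refine (memLp_horizon_mul hv.memLp (c := fun t => Real.exp (r * t)) (by fun_prop)).ae_eq ?_
      filter_upwards [ae_horizon_mem (μ := μ) (T := T)] with z hz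
      simp [lift, Real.coe_toNNReal _ hz.1]
  have hprim : ∀ (t : ℝ≥0) (ω : Ω), ∫ s in (0 : ℝ)..t, Real.exp (r * s) * v s.toNNReal ω =
      ∫ s in (0 : ℝ)..t, Real.exp (r * (s.toNNReal : ℝ)) * v s.toNNReal ω := fun t ω => by
    refine intervalIntegral.integral_congr fun s hs => ?_
    rw [Set.uIcc_of_le t.coe_nonneg] at hs
    simp only [Real.coe_toNNReal _ hs.1]
  have hva' : ∀ t ≤ T, StronglyMeasurable[𝓕 t] (v' t) := by
    intro t ht
    have := (stronglyMeasurable_primitive hvE.1 ht).const_mul (Real.exp (-r * t))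
    have e : v' t = fun ω => Real.exp (-r * t) *
        ∫ s in (0 : ℝ)..t, Real.exp (r * (s.toNNReal : ℝ)) * v s.toNNReal ω := by
      funext ω; simp only [hv', expConv, hprim]
    rwa [e]
  have hvL' : MemLp (lift v') 2 (horizonMeasure μ T) := by
    refine (memLp_horizon_mul (memLp_horizon_primitive hvE.memLp)
      (c := fun t => Real.exp (-r * t)) (by fun_prop)).ae_eq ?_
    filter_upwards [ae_horizon_mem (μ := μ) (T := T)] with z hz
    have := hprim z.2.toNNReal z.1
    rw [Real.coe_toNNReal _ hz.1] at this
    simp only [lift, hv', expConv, Real.coe_toNNReal _ hz.1]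
    rw [this]
  have key := integral_mul_martingale_increment hva' hvL' hM hM'
  have hpath : ∀ᵐ ω ∂μ, ∫ t in (0 : ℝ)..T, v' t.toNNReal ω * (M T ω - M t.toNNReal ω) =
      ∫ t in (0 : ℝ)..T, v t.toNNReal ω * (Real.exp (r * t) *
      ∫ s in t..T, Real.exp (-r * s) * (M T ω - M s.toNNReal ω)) := by
    filter_upwards [hv.ae_pathL2, hM.aeCadlag.ae_pathL2] with ω h1 h2
    have h3 : PathL2 T fun t => M T ω - M t.toNNReal ω := (memLp_const _).sub h2
    have := integral_primitive_swap (h1.exp_mul r) (h3.exp_mul (-r))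
    have e : ∀ t, v t.toNNReal ω * (Real.exp (r * t) *
        ∫ s in t..T, Real.exp (-r * s) * (M T ω - M s.toNNReal ω)) =
        Real.exp (r * t) * v t.toNNReal ω *
        ∫ s in t..T, Real.exp (-r * s) * (M T ω - M s.toNNReal ω) := fun t => by ring
    simp only [e]
    rw [this]
    refine intervalIntegral.integral_congr fun t ht => ?_
    rw [Set.uIcc_of_le T.coe_nonneg] at ht
    simp only [hv', expConv, Real.coe_toNNReal _ ht.1]
    ring
  exact ⟨key.1.congr hpath, (integral_congr_ae hpath).symm.trans key.2⟩

end

section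

variable {Ω : Type*} {mΩ : MeasurableSpace Ω} {μ : Measure Ω} {𝓕 : Filtration ℝ≥0 mΩ} {T : ℝ≥0}

/-! ### Stationarity and uniqueness -/

/-- The path of a process, as a function of a real time. -/
abbrev path (X : ℝ≥0 → Ω → ℝ) (ω : Ω) : ℝ → ℝ := fun t => X t.toNNReal ω

/-- The marginal reward vanishes in the mean against every admissible perturbation. -/
def IsStationary (p : Params) (μ : Measure Ω) (𝓕 : Filtration ℝ≥0 mΩ) (N : ℕ) (x : ℝ)
    (P Y u : ℝ≥0 → Ω → ℝ) : Prop :=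
  ∀ v, Admissible μ 𝓕 p.T v →
    Integrable (fun ω => ∫ t in (0 : ℝ)..p.T,
      v t.toNNReal ω * marginal p N x (path P ω) (path Y ω) (path u ω) t) μ ∧
    ∫ ω, (∫ t in (0 : ℝ)..p.T,
      v t.toNNReal ω * marginal p N x (path P ω) (path Y ω) (path u ω) t) ∂μ = 0

lemma continuousOn_tail {k : ℝ → ℝ} (hk : IntervalIntegrable k volume 0 T) :
    ContinuousOn (fun t => ∫ s in t..T, k s) (Set.Icc 0 (T : ℝ)) := by
  refine ContinuousOn.congr (continuousOn_const (c := ∫ s in (0 : ℝ)..T, k s) |>.sub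
    (continuousOn_primitive hk)) fun t ht => ?_
  rw [← Set.uIcc_of_le T.coe_nonneg] at ht
  exact (intervalIntegral.integral_interval_sub_left hk
    (hk.mono_set (Set.uIcc_subset_uIcc_left ht))).symm

lemma pathL2_exp_tail {k : ℝ → ℝ} (r : ℝ) (hk : IntervalIntegrable k volume 0 T) :
    PathL2 T fun t => Real.exp (r * t) * ∫ s in t..T, k s :=
  pathL2_of_continuousOn (ContinuousOn.mul (by fun_prop) (continuousOn_tail hk))

lemma forall_real_time {q : ℝ≥0 → Prop} (h : ∀ t ≤ T, q t) :
    ∀ t ∈ Set.Icc 0 (T : ℝ), q t.toNNReal :=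
  fun _ ht => h _ (Real.toNNReal_le_iff_le_coe.2 ht.2)

/-- The first order condition holds along every solution of the player's system. -/
lemma SolvesPlayerFBSDE.isStationary [IsFiniteMeasure μ] (h𝓕 : UsualConditions 𝓕 μ) {p : Params}
    {N : ℕ} (hN : 1 ≤ N) {x : ℝ} {P Y X u Z : ℝ≥0 → Ω → ℝ}
    (h : SolvesPlayerFBSDE p μ 𝓕 N x P Y X u Z) : IsStationary p μ 𝓕 N x P Y u := by
  obtain ⟨M, K, hM, hK, eu, eZ⟩ := h.eq_u_Z
  obtain ⟨M', hM1, hM2, hM3⟩ := hM.exists_version h𝓕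
  obtain ⟨K', hK1, hK2, hK3⟩ := hK.exists_version h𝓕
  intro v hv
  obtain ⟨i1, j1⟩ := integral_mul_martingale_increment (fun t ht => hv.stronglyMeasurable ht)
    hv.memLp hM1 hM2
  obtain ⟨i2, j2⟩ := integral_mul_martingale_tail p.rho hv hK1 hK2
  have hpath : ∀ᵐ ω ∂μ, 2 * p.lam * (∫ t in (0 : ℝ)..p.T,
      v t.toNNReal ω * (M' p.T ω - M' t.toNNReal ω)) - p.rho * (∫ t in (0 : ℝ)..p.T,
      v t.toNNReal ω * (Real.exp (p.rho * t) *
        ∫ s in t..p.T, Real.exp (-p.rho * s) * (K' p.T ω - K' s.toNNReal ω))) =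
      ∫ t in (0 : ℝ)..p.T, v t.toNNReal ω * marginal p N x (path P ω) (path Y ω) (path u ω) t := by
    filter_upwards [hv.ae_pathL2, hM1.aeCadlag.ae_pathL2, hK1.aeCadlag.ae_pathL2,
      h.admissible.ae_pathL2, h.cadlag_X.ae_pathL2, h.cadlag_Z.ae_pathL2, h.eq_X, eu, eZ,
      h.terminal_u, h.terminal_Z, hM3, hK3] with ω lv lM lK lu lX lZ h1 h2 h3 h4 h5 h6 h7
    have key := marginal_eq_of_path (x := x) (P := path P ω) (Y := path Y ω) (X := path X ω)
      (Z := path Z ω) (M := path M' ω) (K := path K' ω) (u := path u ω) hN lu.interval lX.interval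
      lZ.interval lK.interval
      (fun t ht => by
        have := forall_real_time h1 t ht
        rwa [Real.coe_toNNReal _ ht.1] at this)
      (fun t ht => by
        have := forall_real_time h2 t ht
        rw [Real.coe_toNNReal _ ht.1, forall_real_time h6 t ht, h6 0 zero_le] at this
        simpa only [path, Real.toNNReal_zero] using this)
      (fun t ht => by
        have := forall_real_time h3 t ht
        rw [Real.coe_toNNReal _ ht.1, forall_real_time h7 t ht, h7 0 zero_le] at this
        simpa only [path, Real.toNNReal_zero] using this)
      (by simpa only [path, Real.toNNReal_coe] using h4)
      (by simpa only [path, Real.toNNReal_coe] using h5)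
    have l1 : PathL2 p.T fun t => M' p.T ω - M' t.toNNReal ω := (memLp_const _).sub lM
    have l2 : PathL2 p.T fun t => K' p.T ω - K' t.toNNReal ω := (memLp_const _).sub lK
    have l3 := pathL2_exp_tail p.rho (l2.exp_mul (-p.rho))
    rw [← intervalIntegral.integral_const_mul, ← intervalIntegral.integral_const_mul,
      ← intervalIntegral.integral_sub ((lv.mul l1).const_mul _) ((lv.mul l3).const_mul _)]
    refine intervalIntegral.integral_congr fun t ht => ?_
    rw [Set.uIcc_of_le p.T.coe_nonneg] at ht
    have := key t ht
    simp only [path, Real.toNNReal_coe] at this ⊢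
    rw [this]
    ring
  have i3 := (i1.const_mul (2 * p.lam)).sub (i2.const_mul p.rho)
  refine ⟨i3.congr hpath, ?_⟩
  rw [← integral_congr_ae hpath, integral_sub (i1.const_mul _) (i2.const_mul _),
    integral_const_mul, integral_const_mul, j1, j2]
  simp

/-- Stationary families of strategies are determined by their aggregated impacts, up to the sign of
the interaction term: the marginal reward is strictly monotone. -/
lemma ae_eq_of_isStationary [IsFiniteMeasure μ] {κ : Type*} [Fintype κ] {p : Params} {N : ℕ}
    {x : κ → ℝ} {P Y Y' : ℝ≥0 → Ω → ℝ} {u u' : κ → ℝ≥0 → Ω → ℝ}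
    (hP : ∀ᵐ ω ∂μ, PathL2 p.T (path P ω)) (hY : ∀ᵐ ω ∂μ, PathL2 p.T (path Y ω))
    (hY' : ∀ᵐ ω ∂μ, PathL2 p.T (path Y' ω)) (hu : ∀ k, Admissible μ 𝓕 p.T (u k))
    (hu' : ∀ k, Admissible μ 𝓕 p.T (u' k)) (hs : ∀ k, IsStationary p μ 𝓕 N (x k) P Y (u k))
    (hs' : ∀ k, IsStationary p μ 𝓕 N (x k) P Y' (u' k))
    (hmono : ∀ᵐ ω ∂μ, 0 ≤ ∑ k, ∫ t in (0 : ℝ)..p.T,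
      (path Y ω t - path Y' ω t) * (path (u k) ω t - path (u' k) ω t)) (k : κ) :
    lift (u k) =ᵐ[horizonMeasure μ p.T] lift (u' k) := by
  have hd : ∀ k, Admissible μ 𝓕 p.T fun t ω => u k t ω - u' k t ω := fun k => (hu k).sub (hu' k)
  set g : κ → Ω → ℝ := fun k ω => (∫ t in (0 : ℝ)..p.T,
      (u k t.toNNReal ω - u' k t.toNNReal ω) *
      marginal p N (x k) (path P ω) (path Y ω) (path (u k) ω) t) -
    ∫ t in (0 : ℝ)..p.T, (u k t.toNNReal ω - u' k t.toNNReal ω) *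
      marginal p N (x k) (path P ω) (path Y' ω) (path (u' k) ω) t with hg
  set G : Ω → ℝ := fun ω => ∑ k, g k ω with hG
  have hgi : ∀ k, Integrable (g k) μ := fun k => (hs k _ (hd k)).1.sub (hs' k _ (hd k)).1
  set f : Ω → ℝ := fun ω => ∑ k, ∫ t in (0 : ℝ)..p.T,
    (path (u k) ω t - path (u' k) ω t) ^ 2 with hf
  have hGi : Integrable G μ := integrable_finsetSum _ fun k _ => hgi k
  have hG0 : ∫ ω, G ω ∂μ = 0 := by
    rw [integral_finsetSum _ fun k _ => hgi k]
    refine Finset.sum_eq_zero fun k _ => ?_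
    rw [hg, integral_sub (hs k _ (hd k)).1 (hs' k _ (hd k)).1, (hs k _ (hd k)).2, (hs' k _ (hd k)).2,
      sub_zero]
  have hle : ∀ᵐ ω ∂μ, 2 * p.lam * f ω ≤ - G ω := by
    filter_upwards [hP, hY, hY', ae_all_iff.2 fun k => (hu k).ae_pathL2,
      ae_all_iff.2 fun k => (hu' k).ae_pathL2, hmono] with ω l1 l2 l3 l4 l5 hm
    have hk : G ω ≤ ∑ k, (- p.kappa * (∫ t in (0 : ℝ)..p.T,
        (path Y ω t - path Y' ω t) * (path (u k) ω t - path (u' k) ω t)) -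
        2 * p.lam * ∫ t in (0 : ℝ)..p.T, (path (u k) ω t - path (u' k) ω t) ^ 2) :=
      Finset.sum_le_sum fun k _ => integral_sub_mul_marginal_le l1 l2 l3 (l4 k) (l5 k)
    rw [Finset.sum_sub_distrib, ← Finset.mul_sum, ← Finset.mul_sum] at hk
    have := mul_nonneg p.kappa_pos.le hm
    simp only [hf]
    linarith
  have hfk : ∀ ω k, 0 ≤ ∫ t in (0 : ℝ)..p.T, (path (u k) ω t - path (u' k) ω t) ^ 2 := fun ω k =>
    intervalIntegral.integral_nonneg p.T.coe_nonneg fun t _ => sq_nonneg _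
  have hf0 : ∀ ω, 0 ≤ f ω := fun ω => Finset.sum_nonneg fun k _ => hfk ω k
  have hGz : (fun ω => - G ω) =ᵐ[μ] 0 := by
    refine (integral_eq_zero_iff_of_nonneg_ae (f := fun ω => - G ω) ?_ hGi.neg).1 ?_
    · filter_upwards [hle] with ω hω
      exact (mul_nonneg (by linarith [p.lam_pos]) (hf0 ω)).trans hω
    · rw [integral_neg, hG0, neg_zero]
  have hz : ∀ᵐ ω ∂μ, ∀ᵐ t ∂(volume.restrict (Set.Icc (0 : ℝ) p.T)),
      lift (u k) (ω, t) = lift (u' k) (ω, t) := by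
    filter_upwards [hle, hGz, (hd k).ae_pathL2] with ω h1 h2 h3
    have h4 : f ω = 0 := by
      simp only [Pi.zero_apply] at h2
      rw [h2] at h1
      nlinarith [hf0 ω, p.lam_pos]
    have h5 := (Finset.sum_eq_zero_iff_of_nonneg fun k _ => hfk ω k).1 h4 k (Finset.mem_univ k)
    rw [intervalIntegral.integral_of_le p.T.coe_nonneg, ← integral_Icc_eq_integral_Ioc] at h5
    have h6 := (integral_eq_zero_iff_of_nonneg (fun t => sq_nonneg _) h3.integrable_sq).1 h5
    filter_upwards [h6] with t ht
    simp only [Pi.zero_apply] at ht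
    exact sub_eq_zero.1 (pow_eq_zero_iff two_ne_zero |>.1 ht)
  have hm := (hu k).memLp.1.sub (hu' k).memLp.1
  have hl : ∫⁻ z, ‖(lift (u k) - lift (u' k)) z‖ₑ ∂(horizonMeasure μ p.T) = 0 := by
    rw [lintegral_prod _ hm.enorm, ← lintegral_zero (μ := μ)]
    refine lintegral_congr_ae ?_
    filter_upwards [hz] with ω hω
    rw [← lintegral_zero (μ := volume.restrict (Set.Icc (0 : ℝ) p.T))]
    refine lintegral_congr_ae ?_
    filter_upwards [hω] with t ht
    simp [ht]
  rw [lintegral_eq_zero_iff' hm.enorm] at hl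
  filter_upwards [hl] with z hz
  simpa [sub_eq_zero] using hz

/-- Càdlàg processes that agree almost everywhere agree before the horizon. -/
lemma forall_lt_eq_of_lift_ae_eq [SFinite μ] {X X' : ℝ≥0 → Ω → ℝ} (hX : AeCadlag μ T X)
    (hX' : AeCadlag μ T X') (h : lift X =ᵐ[horizonMeasure μ T] lift X') :
    ∀ᵐ ω ∂μ, ∀ t < T, X t ω = X' t ω := by
  filter_upwards [hX, hX', Measure.ae_ae_of_ae_prod h] with ω h1 h2 h3 t ht
  have h3' := (ae_restrict_iff' measurableSet_Icc).1 h3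
  have := eq_of_ae_eq_of_rightContinuous (fun t => (h1 t).1) (fun t => (h2 t).1) (T := T) (t := t)
    (h3'.mono fun s hs hsT => by
      have e := hs hsT
      have : min s.toNNReal T = s.toNNReal :=
        min_eq_left (Real.toNNReal_le_iff_le_coe.2 hsT.2)
      simpa [stopAt, this, lift] using e) ht
  simpa [stopAt, min_eq_left ht.le] using this

lemma integral_eq_of_lift_ae_eq [SFinite μ] {u u' : ℝ≥0 → Ω → ℝ}
    (h : lift u =ᵐ[horizonMeasure μ T] lift u') : ∀ᵐ ω ∂μ, ∀ (g : ℝ → ℝ), ∀ s ∈ Set.Icc 0 (T : ℝ),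
      ∀ t ∈ Set.Icc 0 (T : ℝ), ∫ r in s..t, g r * u r.toNNReal ω =
        ∫ r in s..t, g r * u' r.toNNReal ω := by
  filter_upwards [Measure.ae_ae_of_ae_prod h] with ω h3 g s hs t ht
  have h3' := (ae_restrict_iff' measurableSet_Icc).1 h3
  refine intervalIntegral.integral_congr_ae ?_
  filter_upwards [h3'] with r hr hrt
  have hr' : r ∈ Set.Icc 0 (T : ℝ) := by
    have := Set.uIcc_subset_Icc hs ht (Set.uIoc_subset_uIcc hrt)
    exact this
  have := hr hr'
  simp only [lift] at this
  rw [this]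

/-- The adjoint variable is determined by the strategy. -/
lemma indist_adjoint [IsFiniteMeasure μ] (h𝓕 : UsualConditions 𝓕 μ) {p : Params} {c : ℝ}
    {u u' Z Z' K K' : ℝ≥0 → Ω → ℝ} (hu : Admissible μ 𝓕 p.T u) (hu' : Admissible μ 𝓕 p.T u')
    (huu : lift u =ᵐ[horizonMeasure μ p.T] lift u')
    (hZ : StronglyAdapted 𝓕 (stopAt p.T Z)) (hZ' : StronglyAdapted 𝓕 (stopAt p.T Z'))
    (cZ : AeCadlag μ p.T Z) (cZ' : AeCadlag μ p.T Z')
    (hK : IsSqIntMartingale μ 𝓕 p.T K) (hK' : IsSqIntMartingale μ 𝓕 p.T K')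
    (eZ : ∀ᵐ ω ∂μ, ∀ t ≤ p.T, Z t ω = Z 0 ω
        + (∫ s in (0 : ℝ)..t, (p.rho * Z s.toNNReal ω + c * u s.toNNReal ω)) + (K t ω - K 0 ω))
    (eZ' : ∀ᵐ ω ∂μ, ∀ t ≤ p.T, Z' t ω = Z' 0 ω
        + (∫ s in (0 : ℝ)..t, (p.rho * Z' s.toNNReal ω + c * u' s.toNNReal ω)) + (K' t ω - K' 0 ω))
    (tZ : ∀ᵐ ω ∂μ, Z p.T ω = 0) (tZ' : ∀ᵐ ω ∂μ, Z' p.T ω = 0) : Indist μ p.T Z Z' := by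
  obtain ⟨K1, hK1, mK1, iK1⟩ := hK.exists_version h𝓕
  obtain ⟨K2, hK2, mK2, iK2⟩ := hK'.exists_version h𝓕
  obtain ⟨Z1, cZ1, aZ1, sZ1, iZ1⟩ := h𝓕.exists_cadlag_version hZ cZ
  obtain ⟨Z2, cZ2, aZ2, sZ2, iZ2⟩ := h𝓕.exists_cadlag_version hZ' cZ'
  set φ : ℝ → ℝ := fun a => a / (1 + a ^ 2) with hφ
  have hφc : Continuous φ := by
    refine continuous_id.div (by fun_prop) fun a => ?_
    positivity
  have hφb : ∀ a, |φ a| ≤ 1 := fun a => by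
    have h1 : 0 < 1 + a ^ 2 := by positivity
    rw [hφ]
    simp only
    rw [abs_div, abs_of_pos h1, div_le_one h1]
    nlinarith [sq_abs a, sq_nonneg (|a| - 1), abs_nonneg a]
  -- a bounded test process with the sign of the difference
  set v : ℝ≥0 → Ω → ℝ := fun t ω => φ (Z1 t ω - Z2 t ω) with hv_def
  have hv : CadlagL2 μ 𝓕 p.T v := by
    refine ⟨fun ω t => ?_, fun t => hφc.comp_stronglyMeasurable ((aZ1 t).sub (aZ2 t)),
      fun t ω => by simp only [hv_def, sZ1, sZ2], ‖(1 : ℝ)‖ₑ * μ Set.univ ^ (1 / 2 : ℝ),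
      by finiteness, fun t => ?_⟩
    · obtain ⟨h1, l, hl⟩ := (cZ1 ω).sub (cZ2 ω) t
      exact ⟨hφc.continuousAt.comp_continuousWithinAt h1, φ l, (hφc.tendsto l).comp hl⟩
    · refine (eLpNorm_mono (g := fun _ => (1 : ℝ)) fun ω => ?_).trans ?_
      · simpa using hφb _
      · rw [eLpNorm_const' _ (by norm_num) (by norm_num)]
        norm_num
  have hD : CadlagL2 μ 𝓕 p.T fun t ω => K1 t ω - K2 t ω := hK1.sub hK2
  have mD : Martingale (fun t ω => K1 t ω - K2 t ω) 𝓕 μ := mK1.sub mK2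
  obtain ⟨i1, j1⟩ := integral_mul_martingale_increment
    (fun t ht => hv.admissible.stronglyMeasurable ht) hv.memLp_lift hD mD
  obtain ⟨i2, j2⟩ := integral_mul_martingale_tail p.rho hv.admissible hD mD
  have hpath : ∀ᵐ ω ∂μ, (-1) * (∫ t in (0 : ℝ)..p.T, v t.toNNReal ω *
      ((K1 p.T ω - K2 p.T ω) - (K1 t.toNNReal ω - K2 t.toNNReal ω))) +
      p.rho * (∫ t in (0 : ℝ)..p.T, v t.toNNReal ω * (Real.exp (p.rho * t) *
        ∫ s in t..p.T, Real.exp (-p.rho * s) *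
          ((K1 p.T ω - K2 p.T ω) - (K1 s.toNNReal ω - K2 s.toNNReal ω)))) =
      ∫ t in (0 : ℝ)..p.T, v t.toNNReal ω * (Z1 t.toNNReal ω - Z2 t.toNNReal ω) := by
    filter_upwards [hv.aeCadlag.ae_pathL2, hK1.aeCadlag.ae_pathL2, hK2.aeCadlag.ae_pathL2,
      hu.ae_pathL2, hu'.ae_pathL2, cZ.ae_pathL2, cZ'.ae_pathL2, eZ, eZ', tZ, tZ', iK1, iK2,
      iZ1, iZ2, integral_eq_of_lift_ae_eq huu]
      with ω lv lK1 lK2 lu lu' lZ lZ' h1 h2 h3 h4 h5 h6 h7 h8 h9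
    have k1 := adjoint_eq_of_path (u := path u ω) (Z := path Z ω) (K := path K1 ω) (c := c)
      lu.interval lZ.interval lK1.interval (fun t ht => by
        have := forall_real_time h1 t ht
        rw [Real.coe_toNNReal _ ht.1, forall_real_time h5 t ht, h5 0 zero_le] at this
        simpa only [path, Real.toNNReal_zero] using this)
      (by simpa only [path, Real.toNNReal_coe] using h3)
    have k2 := adjoint_eq_of_path (u := path u' ω) (Z := path Z' ω) (K := path K2 ω) (c := c)
      lu'.interval lZ'.interval lK2.interval (fun t ht => by
        have := forall_real_time h2 t ht
        rw [Real.coe_toNNReal _ ht.1, forall_real_time h6 t ht, h6 0 zero_le] at this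
        simpa only [path, Real.toNNReal_zero] using this)
      (by simpa only [path, Real.toNNReal_coe] using h4)
    have l1 : PathL2 p.T fun t => (K1 p.T ω - K2 p.T ω) - (K1 t.toNNReal ω - K2 t.toNNReal ω) :=
      (memLp_const _).sub (lK1.sub lK2)
    have l2 := pathL2_exp_tail p.rho (l1.exp_mul (-p.rho))
    rw [← intervalIntegral.integral_const_mul, ← intervalIntegral.integral_const_mul,
      ← intervalIntegral.integral_add ((lv.mul l1).const_mul _) ((lv.mul l2).const_mul _)]
    refine intervalIntegral.integral_congr fun t ht => ?_
    rw [Set.uIcc_of_le p.T.coe_nonneg] at ht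
    have hTm : (p.T : ℝ) ∈ Set.Icc 0 (p.T : ℝ) := Set.right_mem_Icc.2 p.T.coe_nonneg
    have k1 := k1 t ht
    have k2 := k2 t ht
    have lK1' : PathL2 p.T fun t => K1 p.T ω - K1 t.toNNReal ω := (memLp_const _).sub lK1
    have lK2' : PathL2 p.T fun t => K2 p.T ω - K2 t.toNNReal ω := (memLp_const _).sub lK2
    have hsub' : Set.uIcc t p.T ⊆ Set.uIcc 0 (p.T : ℝ) := by
      rw [Set.uIcc_of_le ht.2, Set.uIcc_of_le p.T.coe_nonneg]
      exact Set.Icc_subset_Icc_left ht.1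
    have e1 : ∫ s in t..p.T, Real.exp (-p.rho * s) *
          ((K1 p.T ω - K2 p.T ω) - (K1 s.toNNReal ω - K2 s.toNNReal ω)) =
        (∫ s in t..p.T, Real.exp (-p.rho * s) * (K1 p.T ω - K1 s.toNNReal ω)) -
        ∫ s in t..p.T, Real.exp (-p.rho * s) * (K2 p.T ω - K2 s.toNNReal ω) := by
      rw [← intervalIntegral.integral_sub ((lK1'.exp_mul _).mono_set hsub')
        ((lK2'.exp_mul _).mono_set hsub')]
      exact intervalIntegral.integral_congr fun s _ => by ring
    have e2 := h9 (fun s => Real.exp (-p.rho * s)) t ht p.T hTm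
    simp only [path, Real.toNNReal_coe] at k1 k2 ⊢
    rw [← forall_real_time h7 t ht, ← forall_real_time h8 t ht, e1]
    rw [e2] at k1
    linear_combination (-v t.toNNReal ω) * k1 + v t.toNNReal ω * k2
  have i3 := ((i1.const_mul (-1)).add (i2.const_mul p.rho)).congr hpath
  have j3 : ∫ ω, (∫ t in (0 : ℝ)..p.T, v t.toNNReal ω * (Z1 t.toNNReal ω - Z2 t.toNNReal ω)) ∂μ
      = 0 := by
    rw [← integral_congr_ae hpath, integral_add (i1.const_mul _) (i2.const_mul _),
      integral_const_mul, integral_const_mul, j1, j2]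
    simp
  have hpos : ∀ t ω, 0 ≤ v t ω * (Z1 t ω - Z2 t ω) := fun t ω => by
    have : v t ω * (Z1 t ω - Z2 t ω) = (Z1 t ω - Z2 t ω) ^ 2 / (1 + (Z1 t ω - Z2 t ω) ^ 2) := by
      simp only [hv_def, hφ]; ring
    rw [this]; positivity
  have hz := (integral_eq_zero_iff_of_nonneg (fun ω =>
    intervalIntegral.integral_nonneg p.T.coe_nonneg fun t _ => hpos t.toNNReal ω) i3).1 j3
  filter_upwards [hz, iZ1, iZ2, tZ, tZ'] with ω h1 h2 h3 h4 h5 t ht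
  rcases ht.lt_or_eq with ht | rfl
  · have h6 : PathL2 p.T fun t => v t.toNNReal ω := by
      have := (hv.cadlag ω).memLp 0 p.T 2
      rwa [Set.uIoc_of_le p.T.coe_nonneg, Measure.restrict_congr_set Ioc_ae_eq_Icc] at this
    have h7 : PathL2 p.T fun t => Z1 t.toNNReal ω - Z2 t.toNNReal ω := by
      have := ((cZ1 ω).sub (cZ2 ω)).memLp 0 p.T 2
      rwa [Set.uIoc_of_le p.T.coe_nonneg, Measure.restrict_congr_set Ioc_ae_eq_Icc] at this
    have h8 := h6.integrable_mul h7
    simp only [Pi.zero_apply] at h1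
    rw [intervalIntegral.integral_of_le p.T.coe_nonneg, ← integral_Icc_eq_integral_Ioc] at h1
    have h9 := (integral_eq_zero_iff_of_nonneg (fun t : ℝ => hpos t.toNNReal ω) h8).1 h1
    have h10 := eq_of_ae_eq_of_rightContinuous (fun t => (cZ1 ω t).1) (fun t => (cZ2 ω t).1)
      (T := p.T) (t := t) (by
        filter_upwards [(ae_restrict_iff' measurableSet_Icc).1 h9] with s hs hsT
        have h11 := hs hsT
        simp only [Pi.zero_apply, hv_def, hφ] at h11
        have h12 : (1 : ℝ) + (Z1 s.toNNReal ω - Z2 s.toNNReal ω) ^ 2 ≠ 0 := by positivity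
        refine sub_eq_zero.1 ((mul_eq_zero.1 h11).elim (fun h => ?_) id)
        exact (div_eq_zero_iff.1 h).resolve_right h12) ht
    rw [h2 t ht.le, h3 t ht.le, h10]
  · rw [h4, h5]

end

section

variable {Ω : Type*} {mΩ : MeasurableSpace Ω} {μ : Measure Ω} {𝓕 : Filtration ℝ≥0 mΩ}
variable {p : Params} {N : ℕ}

/-! ### Uniqueness of the solutions of the two systems -/

/-- A solution of the aggregated system also solves the player's system, for the average inventory
and with its own impact process as input. -/
lemma SolvesMeanFBSDE.solvesPlayer [SFinite μ] (hN : 1 ≤ N) {x y : ℝ}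
    {P X Y u Z : ℝ≥0 → Ω → ℝ} (h : SolvesMeanFBSDE p μ 𝓕 N x y P X Y u Z) :
    SolvesPlayerFBSDE p μ 𝓕 N x P Y X u Z := by
  obtain ⟨M, K, hM, hK, eu, eZ⟩ := h.eq_u_Z
  refine ⟨h.admissible, h.adapted_Z, h.cadlag_X, h.cadlag_u, h.cadlag_Z, h.eq_X,
    ⟨M, K, hM, hK, ?_, eZ⟩, h.terminal_u, h.terminal_Z⟩
  filter_upwards [eu, h.eq_Y, h.admissible.ae_pathL2, h.cadlag_X.ae_pathL2, h.cadlag_Y.ae_pathL2,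
    h.cadlag_Z.ae_pathL2] with ω h1 h2 lu lX lY lZ t ht
  have hN0 : (N : ℝ) ≠ 0 := by positivity
  have hl := p.lam_pos.ne'
  have hsub : Set.uIcc 0 (t : ℝ) ⊆ Set.uIcc 0 (p.T : ℝ) := by
    rw [Set.uIcc_of_le t.coe_nonneg, Set.uIcc_of_le p.T.coe_nonneg]
    exact Set.Icc_subset_Icc_right (NNReal.coe_le_coe.2 ht)
  have iu := lu.interval.mono_set hsub
  have iX := lX.interval.mono_set hsub
  have iY := lY.interval.mono_set hsub
  have iZ := lZ.interval.mono_set hsub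
  have hY0 : Y 0 ω = y := by simpa using h2 0 zero_le
  have i1 := (iY.const_mul (-p.rho)).add (iu.const_mul p.gamma)
  have i2 : IntervalIntegrable (fun s => p.gamma * p.kappa / (2 * p.lam * N) * u s.toNNReal ω
      - p.phi * X s.toNNReal ω / p.lam + p.rho * Z s.toNNReal ω / (2 * p.lam)) volume 0 t :=
    ((iu.const_mul _).sub ((iX.const_mul _).div_const _)).add ((iZ.const_mul _).div_const _)
  have e : ∫ s in (0 : ℝ)..t, (p.kappa * p.rho * Y s.toNNReal ω / (2 * p.lam)
              - p.gamma * p.kappa * ((N : ℝ) - 1) * u s.toNNReal ω / (2 * p.lam * N)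
              - p.phi * X s.toNNReal ω / p.lam + p.rho * Z s.toNNReal ω / (2 * p.lam)) =
      (-p.kappa / (2 * p.lam)) *
        (∫ s in (0 : ℝ)..t, (-p.rho * Y s.toNNReal ω + p.gamma * u s.toNNReal ω)) +
      ∫ s in (0 : ℝ)..t, (p.gamma * p.kappa / (2 * p.lam * N) * u s.toNNReal ω
        - p.phi * X s.toNNReal ω / p.lam + p.rho * Z s.toNNReal ω / (2 * p.lam)) := by
    rw [← intervalIntegral.integral_const_mul, ← intervalIntegral.integral_add (i1.const_mul _) i2]
    refine intervalIntegral.integral_congr fun s _ => ?_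
    field_simp
    ring
  rw [h1 t ht, e, hY0, h2 t ht]
  field_simp
  ring

lemma SolvesMeanFBSDE.impact_eq [SFinite μ] {x y : ℝ} {P X Y u Z : ℝ≥0 → Ω → ℝ}
    (h : SolvesMeanFBSDE p μ 𝓕 N x y P X Y u Z) : ∀ᵐ ω ∂μ, ∀ t ∈ Set.Icc 0 (p.T : ℝ),
    path Y ω t = Real.exp (-p.rho * t) * y + p.gamma * expConv p.rho (path u ω) t := by
  filter_upwards [h.eq_Y, h.admissible.ae_pathL2, h.cadlag_Y.ae_pathL2] with ω h2 lu lY t ht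
  have key := exp_mul_eq_of_linear_integral_eq (r := -p.rho) (c := y) (T := p.T)
    (lu.interval.const_mul p.gamma) lY.interval (fun s hs => by
      rw [Set.uIcc_of_le p.T.coe_nonneg] at hs
      have := forall_real_time h2 s hs
      rwa [Real.coe_toNNReal _ hs.1] at this) t (by rwa [Set.uIcc_of_le p.T.coe_nonneg])
  rw [neg_neg] at key
  have hee : Real.exp (-p.rho * t) * Real.exp (p.rho * t) = 1 := by rw [← Real.exp_add]; simp
  have e : ∫ s in (0 : ℝ)..t, Real.exp (p.rho * s) * (p.gamma * u s.toNNReal ω) =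
      p.gamma * ∫ s in (0 : ℝ)..t, Real.exp (p.rho * s) * u s.toNNReal ω := by
    rw [← intervalIntegral.integral_const_mul]
    exact intervalIntegral.integral_congr fun s _ => by ring
  calc path Y ω t = Real.exp (-p.rho * t) * (Real.exp (p.rho * t) * Y t.toNNReal ω) := by
        rw [← mul_assoc, hee, one_mul]
    _ = _ := by rw [key, e]; simp only [expConv, path]; ring

/-- Two solutions of the player's system with the same strategy agree. -/
lemma SolvesPlayerFBSDE.indist_of_lift [IsFiniteMeasure μ] (h𝓕 : UsualConditions 𝓕 μ) {x : ℝ}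
    {P Y Y' X u Z X' u' Z' : ℝ≥0 → Ω → ℝ} (h : SolvesPlayerFBSDE p μ 𝓕 N x P Y X u Z)
    (h' : SolvesPlayerFBSDE p μ 𝓕 N x P Y' X' u' Z') (hY : Indist μ p.T Y Y')
    (huu : lift u =ᵐ[horizonMeasure μ p.T] lift u') :
    Indist μ p.T X X' ∧ Indist μ p.T u u' ∧ Indist μ p.T Z Z' := by
  obtain ⟨M, K, hM, hK, eu, eZ⟩ := h.eq_u_Z
  obtain ⟨M', K', hM', hK', eu', eZ'⟩ := h'.eq_u_Z
  have hX : Indist μ p.T X X' := by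
    filter_upwards [h.eq_X, h'.eq_X, integral_eq_of_lift_ae_eq huu] with ω h1 h2 h3 t ht
    have := h3 (fun _ => 1) 0 ⟨le_rfl, p.T.coe_nonneg⟩ t ⟨t.coe_nonneg, NNReal.coe_le_coe.2 ht⟩
    simp only [one_mul] at this
    rw [h1 t ht, h2 t ht, this]
  refine ⟨hX, ?_, indist_adjoint h𝓕 h.admissible h'.admissible huu h.adapted_Z h'.adapted_Z
    h.cadlag_Z h'.cadlag_Z hK hK' eZ eZ' h.terminal_Z h'.terminal_Z⟩
  filter_upwards [forall_lt_eq_of_lift_ae_eq h.cadlag_u h'.cadlag_u huu, hX, hY, h.terminal_u,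
    h'.terminal_u] with ω h1 h2 h3 h4 h5 t ht
  rcases ht.lt_or_eq with ht | rfl
  · exact h1 t ht
  · rw [h4, h5, h2 _ le_rfl, h3 _ le_rfl]

lemma SolvesPlayerFBSDE.unique [IsFiniteMeasure μ] (h𝓕 : UsualConditions 𝓕 μ) (hN : 1 ≤ N) {x : ℝ}
    {P Y X u Z X' u' Z' : ℝ≥0 → Ω → ℝ} (hP : AeCadlag μ p.T P) (hY : AeCadlag μ p.T Y)
    (h : SolvesPlayerFBSDE p μ 𝓕 N x P Y X u Z)
    (h' : SolvesPlayerFBSDE p μ 𝓕 N x P Y X' u' Z') :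
    Indist μ p.T X X' ∧ Indist μ p.T u u' ∧ Indist μ p.T Z Z' := by
  refine h.indist_of_lift h𝓕 h' (ae_of_all _ fun _ _ _ => rfl) ?_
  exact ae_eq_of_isStationary (κ := Unit) (u := fun _ => u) (u' := fun _ => u') (x := fun _ => x)
    hP.ae_pathL2 hY.ae_pathL2 hY.ae_pathL2 (fun _ => h.admissible) (fun _ => h'.admissible)
    (fun _ => h.isStationary h𝓕 hN) (fun _ => h'.isStationary h𝓕 hN)
    (ae_of_all _ fun ω => by simp) ()

lemma SolvesMeanFBSDE.unique [IsFiniteMeasure μ] (h𝓕 : UsualConditions 𝓕 μ) (hN : 1 ≤ N) {x y : ℝ}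
    {P X Y u Z X' Y' u' Z' : ℝ≥0 → Ω → ℝ} (hP : AeCadlag μ p.T P)
    (h : SolvesMeanFBSDE p μ 𝓕 N x y P X Y u Z)
    (h' : SolvesMeanFBSDE p μ 𝓕 N x y P X' Y' u' Z') :
    Indist μ p.T X X' ∧ Indist μ p.T Y Y' ∧ Indist μ p.T u u' ∧ Indist μ p.T Z Z' := by
  have huu : lift u =ᵐ[horizonMeasure μ p.T] lift u' := by
    refine ae_eq_of_isStationary (κ := Unit) (u := fun _ => u) (u' := fun _ => u')
      (x := fun _ => x) hP.ae_pathL2 h.cadlag_Y.ae_pathL2 h'.cadlag_Y.ae_pathL2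
      (fun _ => h.admissible) (fun _ => h'.admissible)
      (fun _ => (h.solvesPlayer hN).isStationary h𝓕 hN)
      (fun _ => (h'.solvesPlayer hN).isStationary h𝓕 hN) ?_ ()
    filter_upwards [h.impact_eq, h'.impact_eq, h.admissible.ae_pathL2, h'.admissible.ae_pathL2]
      with ω h1 h2 lu lu'
    have hn := expConv_energy_nonneg (p := p) (v := fun t => path u ω t - path u' ω t)
      (PathL2.congr (lu.sub lu') fun t _ => rfl)
    have e : ∫ t in (0 : ℝ)..p.T, (path Y ω t - path Y' ω t) * (path u ω t - path u' ω t) =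
        p.gamma * ∫ t in (0 : ℝ)..p.T, expConv p.rho (fun t => path u ω t - path u' ω t) t *
          (path u ω t - path u' ω t) := by
      rw [← intervalIntegral.integral_const_mul]
      refine intervalIntegral.integral_congr fun t ht => ?_
      rw [Set.uIcc_of_le p.T.coe_nonneg] at ht
      have h1 := h1 t ht
      have h2 := h2 t ht
      have h3 := expConv_sub p.rho lu lu' ht
      simp only [path] at h1 h2 h3 ⊢
      rw [h1, h2, h3]
      ring
    simp only [Finset.univ_unique, Finset.sum_const, Finset.card_singleton, one_smul]
    rw [e]
    exact mul_nonneg p.gamma_pos.le hn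
  have hY : Indist μ p.T Y Y' := by
    filter_upwards [h.impact_eq, h'.impact_eq, integral_eq_of_lift_ae_eq huu] with ω h1 h2 h3 t ht
    have ht' : (t : ℝ) ∈ Set.Icc 0 (p.T : ℝ) := ⟨t.coe_nonneg, NNReal.coe_le_coe.2 ht⟩
    have h1 := h1 t ht'
    have h2 := h2 t ht'
    have h3 := h3 (fun s => Real.exp (p.rho * s)) 0 ⟨le_rfl, p.T.coe_nonneg⟩ t ht'
    simp only [path, Real.toNNReal_coe, expConv] at h1 h2
    rw [h1, h2, h3]
  obtain ⟨a, b, c⟩ := (h.solvesPlayer hN).indist_of_lift h𝓕 (h'.solvesPlayer hN) hY huu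
  exact ⟨a, hY, b, c⟩

/-! ### The game -/

lemma path_impact (y : ℝ) (u : Fin N → ℝ≥0 → Ω → ℝ) (ω : Ω) {t : ℝ}
    (ht : 0 ≤ t) : path (impact p y u) ω t = Real.exp (-p.rho * t) * y +
      p.gamma * expConv p.rho (fun s => (1 / (N : ℝ)) * ∑ j, u j s.toNNReal ω) t := by
  simp only [path, impact, Real.coe_toNNReal _ ht, expConv]
  rw [← intervalIntegral.integral_const_mul (Real.exp (-p.rho * t))]
  congr 2
  refine intervalIntegral.integral_congr fun s _ => ?_
  have : Real.exp (-p.rho * (t - s)) = Real.exp (-p.rho * t) * Real.exp (p.rho * s) := by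
    rw [← Real.exp_add]; congr 1; ring
  simp only [this]
  ring

lemma IsStationary.congr_impact {x : ℝ} {P Y Y' u : ℝ≥0 → Ω → ℝ}
    (h : IsStationary p μ 𝓕 N x P Y u) (hY : Indist μ p.T Y Y') :
    IsStationary p μ 𝓕 N x P Y' u := by
  intro v hv
  obtain ⟨h1, h2⟩ := h v hv
  have e : (fun ω => ∫ t in (0 : ℝ)..p.T,
      v t.toNNReal ω * marginal p N x (path P ω) (path Y ω) (path u ω) t) =ᵐ[μ]
      fun ω => ∫ t in (0 : ℝ)..p.T,
      v t.toNNReal ω * marginal p N x (path P ω) (path Y' ω) (path u ω) t := by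
    filter_upwards [hY] with ω hω
    refine intervalIntegral.integral_congr fun t ht => ?_
    rw [Set.uIcc_of_le p.T.coe_nonneg] at ht
    simp only [marginal, path, forall_real_time hω t ht]
  exact ⟨h1.congr e, (integral_congr_ae e).symm.trans h2⟩

lemma pathL2_marginal {x : ℝ} {P Y u : ℝ → ℝ} (hP : PathL2 p.T P) (hY : PathL2 p.T Y)
    (hu : PathL2 p.T u) : PathL2 p.T (marginal p N x P Y u) := by
  have h1 : PathL2 p.T fun t => P t - P p.T := hP.sub (memLp_const _)
  have h2 := pathL2_exp_tail p.rho (hu.exp_mul (-p.rho))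
  have h3 : PathL2 p.T fun t => ∫ s in t..p.T, (x - ∫ r in (0 : ℝ)..s, u r) :=
    pathL2_of_continuousOn (continuousOn_tail (hu.inventory x).interval)
  have := ((((h1.sub (hY.const_mul p.kappa)).sub (h2.const_mul (p.gamma * p.kappa / N))).sub
    (hu.const_mul (2 * p.lam))).add (h3.const_mul (2 * p.phi))).add
    (memLp_const (2 * p.varrho * (x - ∫ s in (0 : ℝ)..p.T, u s)))
  exact this

/-- The marginal reward is affine in the strategy and the initial inventory. -/
lemma marginal_average (hN : 1 ≤ N) {x : Fin N → ℝ} {P Y : ℝ → ℝ} {u : Fin N → ℝ → ℝ}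
    (hu : ∀ i, PathL2 p.T (u i)) {t : ℝ} (ht : t ∈ Set.Icc 0 (p.T : ℝ)) :
    marginal p N ((1 / (N : ℝ)) * ∑ i, x i) P Y (fun s => (1 / (N : ℝ)) * ∑ i, u i s) t =
      (1 / (N : ℝ)) * ∑ i, marginal p N (x i) P Y (u i) t := by
  have hN0 : (N : ℝ) ≠ 0 := by positivity
  have hT := p.T.coe_nonneg
  have hsub' : Set.uIcc t p.T ⊆ Set.uIcc 0 (p.T : ℝ) := by
    rw [Set.uIcc_of_le ht.2, Set.uIcc_of_le hT]
    exact Set.Icc_subset_Icc_left ht.1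
  have e1 : ∫ s in t..p.T, Real.exp (-p.rho * s) * ((1 / (N : ℝ)) * ∑ i, u i s) =
      (1 / (N : ℝ)) * ∑ i, ∫ s in t..p.T, Real.exp (-p.rho * s) * u i s := by
    rw [← intervalIntegral.integral_finsetSum fun i _ => ((hu i).exp_mul _).mono_set hsub',
      ← intervalIntegral.integral_const_mul]
    refine intervalIntegral.integral_congr fun s _ => ?_
    simp only [← Finset.mul_sum]
    ring
  have e2 : ∀ s ∈ Set.Icc 0 (p.T : ℝ), ((1 / (N : ℝ)) * ∑ i, x i) -
      ∫ r in (0 : ℝ)..s, (1 / (N : ℝ)) * ∑ i, u i r =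
      (1 / (N : ℝ)) * ∑ i, (x i - ∫ r in (0 : ℝ)..s, u i r) := by
    intro s hs
    have hsub : Set.uIcc 0 s ⊆ Set.uIcc 0 (p.T : ℝ) := by
      rw [Set.uIcc_of_le hs.1, Set.uIcc_of_le hT]
      exact Set.Icc_subset_Icc_right hs.2
    rw [intervalIntegral.integral_const_mul,
      intervalIntegral.integral_finsetSum fun i _ => (hu i).interval.mono_set hsub,
      Finset.sum_sub_distrib]
    ring
  have e3 : ∫ s in t..p.T, (((1 / (N : ℝ)) * ∑ i, x i) -
      ∫ r in (0 : ℝ)..s, (1 / (N : ℝ)) * ∑ i, u i r) =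
      (1 / (N : ℝ)) * ∑ i, ∫ s in t..p.T, (x i - ∫ r in (0 : ℝ)..s, u i r) := by
    rw [← intervalIntegral.integral_finsetSum fun i _ =>
      ((hu i).inventory (x i)).interval.mono_set hsub', ← intervalIntegral.integral_const_mul]
    refine intervalIntegral.integral_congr fun s hs => ?_
    rw [Set.uIcc_of_le ht.2] at hs
    exact e2 s ⟨ht.1.trans hs.1, hs.2⟩
  unfold marginal
  rw [e1, e3, e2 _ (Set.right_mem_Icc.2 hT)]
  simp only [Finset.sum_add_distrib, Finset.sum_sub_distrib, ← Finset.mul_sum, Finset.sum_const,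
    Finset.card_univ, Fintype.card_fin, nsmul_eq_mul]
  field_simp

lemma IsStationary.average [IsFiniteMeasure μ] (hN : 1 ≤ N) {x : Fin N → ℝ} {P Y : ℝ≥0 → Ω → ℝ}
    {u : Fin N → ℝ≥0 → Ω → ℝ} (hP : AeCadlag μ p.T P) (hY : AeCadlag μ p.T Y)
    (hu : ∀ i, Admissible μ 𝓕 p.T (u i)) (hs : ∀ i, IsStationary p μ 𝓕 N (x i) P Y (u i)) :
    IsStationary p μ 𝓕 N ((1 / (N : ℝ)) * ∑ i, x i) P Y
      fun t ω => (1 / (N : ℝ)) * ∑ i, u i t ω := by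
  intro v hv
  have e : (fun ω => (1 / (N : ℝ)) * ∑ i, ∫ t in (0 : ℝ)..p.T,
      v t.toNNReal ω * marginal p N (x i) (path P ω) (path Y ω) (path (u i) ω) t) =ᵐ[μ]
      fun ω => ∫ t in (0 : ℝ)..p.T, v t.toNNReal ω * marginal p N ((1 / (N : ℝ)) * ∑ i, x i)
        (path P ω) (path Y ω) (path (fun t ω => (1 / (N : ℝ)) * ∑ i, u i t ω) ω) t := by
    filter_upwards [hP.ae_pathL2, hY.ae_pathL2, hv.ae_pathL2,
      ae_all_iff.2 fun i => (hu i).ae_pathL2] with ω lP lY lv lu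
    rw [← intervalIntegral.integral_finsetSum fun i _ =>
      PathL2.mul lv (pathL2_marginal lP lY (lu i)), ← intervalIntegral.integral_const_mul]
    refine intervalIntegral.integral_congr fun t ht => ?_
    rw [Set.uIcc_of_le p.T.coe_nonneg] at ht
    have := marginal_average (p := p) (x := x) (P := path P ω) (Y := path Y ω) hN lu ht
    beta_reduce at this ⊢
    rw [this, Finset.mul_sum, Finset.mul_sum, Finset.mul_sum]
    exact Finset.sum_congr rfl fun i _ => by ring
  have hi : Integrable (fun ω => (1 / (N : ℝ)) * ∑ i, ∫ t in (0 : ℝ)..p.T,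
      v t.toNNReal ω * marginal p N (x i) (path P ω) (path Y ω) (path (u i) ω) t) μ :=
    (integrable_finsetSum _ fun i _ => (hs i v hv).1).const_mul _
  refine ⟨hi.congr e, (integral_congr_ae e).symm.trans ?_⟩
  rw [integral_const_mul, integral_finsetSum _ fun i _ => (hs i v hv).1]
  simp [fun i => (hs i v hv).2]

/-- The players' solutions generate the aggregated impact they were computed from: their average and
the solution of the aggregated system satisfy the same first order condition. -/
lemma indist_impact [IsFiniteMeasure μ] (h𝓕 : UsualConditions 𝓕 μ) (hN : 1 ≤ N) {x : Fin N → ℝ}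
    {y : ℝ} {P X Y ub Z : ℝ≥0 → Ω → ℝ} {u : Fin N → ℝ≥0 → Ω → ℝ} (hP : AeCadlag μ p.T P)
    (h : SolvesMeanFBSDE p μ 𝓕 N ((1 / (N : ℝ)) * ∑ i, x i) y P X Y ub Z)
    (hu : ∀ i, Admissible μ 𝓕 p.T (u i)) (hs : ∀ i, IsStationary p μ 𝓕 N (x i) P Y (u i)) :
    Indist μ p.T Y (impact p y u) := by
  have ha : Admissible μ 𝓕 p.T fun t ω => (1 / (N : ℝ)) * ∑ i, u i t ω :=
    (Admissible.sum Finset.univ hu).const_mul _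
  have hs' := IsStationary.average hN hP h.cadlag_Y hu hs
  have huu := ae_eq_of_isStationary (κ := Unit) (u := fun _ => ub)
    (u' := fun _ t ω => (1 / (N : ℝ)) * ∑ i, u i t ω) (x := fun _ => (1 / (N : ℝ)) * ∑ i, x i)
    hP.ae_pathL2 h.cadlag_Y.ae_pathL2 h.cadlag_Y.ae_pathL2 (fun _ => h.admissible) (fun _ => ha)
    (fun _ => (h.solvesPlayer hN).isStationary h𝓕 hN) (fun _ => hs')
    (ae_of_all _ fun ω => by simp) ()
  filter_upwards [h.impact_eq, integral_eq_of_lift_ae_eq huu] with ω h1 h3 t ht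
  have ht' : (t : ℝ) ∈ Set.Icc 0 (p.T : ℝ) := ⟨t.coe_nonneg, NNReal.coe_le_coe.2 ht⟩
  have h1 := h1 t ht'
  have h2 := path_impact (p := p) y u ω t.coe_nonneg
  have h3 := h3 (fun s => Real.exp (p.rho * s)) 0 ⟨le_rfl, p.T.coe_nonneg⟩ t ht'
  simp only [path, Real.toNNReal_coe, expConv] at h1 h2
  rw [h1, h2, h3]

lemma ae_pathL2_impact [SFinite μ] {y : ℝ} {u : Fin N → ℝ≥0 → Ω → ℝ}
    (hu : ∀ i, Admissible μ 𝓕 p.T (u i)) : ∀ᵐ ω ∂μ, PathL2 p.T (path (impact p y u) ω) := by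
  filter_upwards [((Admissible.sum Finset.univ hu).const_mul (1 / (N : ℝ))).ae_pathL2] with ω l
  have h1 : PathL2 p.T fun t => Real.exp (-p.rho * t) * y :=
    pathL2_of_continuousOn (by fun_prop)
  exact PathL2.congr (h1.add ((l.expConv p.rho).const_mul p.gamma)) fun t ht =>
    (path_impact y u ω ht.1).symm

lemma memLp_lift_impact [IsFiniteMeasure μ] {y : ℝ} {u : Fin N → ℝ≥0 → Ω → ℝ}
    (hu : ∀ i, Admissible μ 𝓕 p.T (u i)) :
    MemLp (lift (impact p y u)) 2 (horizonMeasure μ p.T) := by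
  have h1 := ((Admissible.sum Finset.univ hu).const_mul (1 / (N : ℝ))).memLp
  have h2 := memLp_horizon_mul h1 (c := fun t => Real.exp (p.rho * t)) (by fun_prop)
  have h3 := memLp_horizon_mul (memLp_horizon_primitive h2)
    (c := fun t => Real.exp (-p.rho * t)) (by fun_prop)
  have h4 := memLp_horizon_mul (memLp_const y (μ := horizonMeasure μ p.T))
    (c := fun t => Real.exp (-p.rho * t)) (by fun_prop)
  refine (h4.add (h3.const_mul p.gamma)).ae_eq ?_
  filter_upwards [ae_horizon_mem (μ := μ) (T := p.T)] with z hz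
  exact (path_impact y u z.1 hz.1).symm

lemma objective_eq (μ : Measure Ω) (x : Fin N → ℝ) (y : ℝ) (P : ℝ≥0 → Ω → ℝ)
    (u : Fin N → ℝ≥0 → Ω → ℝ) (i : Fin N) : objective p μ x y P u i =
      ∫ ω, pathReward p (x i) (path P ω) (path (impact p y u) ω) (path (u i) ω) ∂μ := by
  unfold objective pathReward
  refine integral_congr_ae (ae_of_all _ fun ω => ?_)
  have e : ∫ t in (0 : ℝ)..p.T, (inventory (x i) (u i) t.toNNReal ω) ^ 2 =
      ∫ t in (0 : ℝ)..p.T, (x i - ∫ s in (0 : ℝ)..t, u i s.toNNReal ω) ^ 2 := by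
    refine intervalIntegral.integral_congr fun t ht => ?_
    rw [Set.uIcc_of_le p.T.coe_nonneg] at ht
    simp only [inventory, Real.coe_toNNReal _ ht.1]
  simp only [e]
  simp only [execPrice, path, inventory, Real.toNNReal_coe]

/-- The realized reward is integrable although the initial price need not be square integrable: its
total coefficient is the deterministic initial inventory. -/
lemma integrable_pathReward [IsFiniteMeasure μ] {x : ℝ} {P S Y u : ℝ≥0 → Ω → ℝ}
    (hS : CadlagL2 μ 𝓕 p.T S) (hPS : ∀ᵐ ω ∂μ, ∀ t ≤ p.T, P t ω = P 0 ω + S t ω)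
    (hP0 : Integrable (P 0) μ) (hY : MemLp (lift Y) 2 (horizonMeasure μ p.T))
    (hYp : ∀ᵐ ω ∂μ, PathL2 p.T (path Y ω)) (hu : Admissible μ 𝓕 p.T u) :
    Integrable (fun ω => pathReward p x (path P ω) (path Y ω) (path u ω)) μ := by
  have hXT : MemLp (fun ω => x - ∫ s in (0 : ℝ)..p.T, u s.toNNReal ω) 2 μ :=
    (memLp_const x).sub (memLp_horizon_integral hu.memLp)
  have i1 := integrable_horizon_integral
    ((hS.memLp_lift.sub (hY.const_mul p.kappa)).integrable_mul hu.memLp)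
  have i2 := integrable_horizon_integral hu.memLp.integrable_sq
  have i3 := integrable_horizon_integral (((memLp_const x (μ := horizonMeasure μ p.T)).sub
    (memLp_horizon_primitive hu.memLp)).integrable_sq)
  have i4 := hXT.integrable_mul ((hS.memLp p.T).sub (hXT.const_mul p.varrho))
  refine (((((hP0.mul_const x).add i1).sub (i2.const_mul p.lam)).sub (i3.const_mul p.phi)).add
    i4).congr ?_
  filter_upwards [hPS, hu.ae_pathL2, hYp, hS.aeCadlag.ae_pathL2] with ω h1 lu lY lS
  have e1 : ∫ t in (0 : ℝ)..p.T, (path P ω t - p.kappa * path Y ω t) * path u ω t =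
      P 0 ω * (∫ t in (0 : ℝ)..p.T, path u ω t) +
      ∫ t in (0 : ℝ)..p.T, (path S ω t - p.kappa * path Y ω t) * path u ω t := by
    have l1 : PathL2 p.T fun t => path S ω t - p.kappa * path Y ω t := lS.sub (lY.const_mul _)
    rw [← intervalIntegral.integral_const_mul,
      ← intervalIntegral.integral_add (lu.interval.const_mul _) (l1.mul lu)]
    refine intervalIntegral.integral_congr fun t ht => ?_
    rw [Set.uIcc_of_le p.T.coe_nonneg] at ht
    have := forall_real_time h1 t ht
    simp only [path, this]
    ring
  unfold pathReward
  rw [e1]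
  simp only [path, Real.toNNReal_coe, h1 p.T le_rfl, Pi.add_apply, Pi.sub_apply, Pi.mul_apply, lift]
  ring

lemma path_impact_update [SFinite μ] (hN : 1 ≤ N) {y : ℝ} {u : Fin N → ℝ≥0 → Ω → ℝ}
    {v δ : ℝ≥0 → Ω → ℝ} (i : Fin N)
    (hδ : ∀ t ω, v t ω = u i t ω + δ t ω) (hu : ∀ i, Admissible μ 𝓕 p.T (u i))
    (hv : Admissible μ 𝓕 p.T δ) : ∀ᵐ ω ∂μ, ∀ t ∈ Set.Icc 0 (p.T : ℝ),
      path (impact p y (Function.update u i v)) ω t =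
        path (impact p y u) ω t + p.gamma / N * expConv p.rho (path δ ω) t := by
  filter_upwards [((Admissible.sum Finset.univ hu).const_mul (1 / (N : ℝ))).ae_pathL2,
    (hv.const_mul (- (1 / (N : ℝ)))).ae_pathL2] with ω l1 l2 t ht
  have hN0 : (N : ℝ) ≠ 0 := by positivity
  rw [path_impact y _ ω ht.1, path_impact y u ω ht.1]
  have e : ∀ s : ℝ, (1 / (N : ℝ)) * ∑ j, Function.update u i v j s.toNNReal ω =
      (1 / (N : ℝ)) * (∑ j, u j s.toNNReal ω) - (-(1 / (N : ℝ)) * δ s.toNNReal ω) := by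
    intro s
    have : ∑ j, Function.update u i v j s.toNNReal ω =
        (∑ j, u j s.toNNReal ω) + δ s.toNNReal ω := by
      rw [← Finset.add_sum_erase _ _ (Finset.mem_univ i),
        ← Finset.add_sum_erase _ (fun j => u j s.toNNReal ω) (Finset.mem_univ i),
        Function.update_self, hδ]
      have : ∑ j ∈ Finset.univ.erase i, Function.update u i v j s.toNNReal ω =
          ∑ j ∈ Finset.univ.erase i, u j s.toNNReal ω :=
        Finset.sum_congr rfl fun j hj => by
          rw [Function.update_of_ne (Finset.ne_of_mem_erase hj)]
      rw [this]; ring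
    rw [this]; ring
  simp only [e]
  rw [expConv_sub p.rho l1 l2 ht]
  have e2 : expConv p.rho (fun s => -(1 / (N : ℝ)) * δ s.toNNReal ω) t =
      -(1 / (N : ℝ)) * expConv p.rho (path δ ω) t := by
    simp only [expConv, path]
    rw [mul_left_comm, ← intervalIntegral.integral_const_mul (-(1 / (N : ℝ)))]
    congr 1
    exact intervalIntegral.integral_congr fun s _ => by ring
  rw [e2]
  ring

/-- A unilateral deviation changes the reward by the marginal term minus a nonnegative cost. -/
lemma pathReward_update [SFinite μ] (hN : 1 ≤ N) {x y : ℝ} {P : ℝ≥0 → Ω → ℝ}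
    {u : Fin N → ℝ≥0 → Ω → ℝ} {v δ : ℝ≥0 → Ω → ℝ} (i : Fin N) (hP : AeCadlag μ p.T P)
    (hδ : ∀ t ω, v t ω = u i t ω + δ t ω) (hu : ∀ i, Admissible μ 𝓕 p.T (u i))
    (hv : Admissible μ 𝓕 p.T δ) : ∀ᵐ ω ∂μ,
      pathReward p x (path P ω) (path (impact p y (Function.update u i v)) ω) (path v ω) -
        pathReward p x (path P ω) (path (impact p y u) ω) (path (u i) ω) =
      (∫ t in (0 : ℝ)..p.T, δ t.toNNReal ω *
        marginal p N x (path P ω) (path (impact p y u) ω) (path (u i) ω) t) -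
        pathCost p N (path δ ω) := by
  filter_upwards [hP.ae_pathL2, ae_pathL2_impact (y := y) hu, (hu i).ae_pathL2, hv.ae_pathL2,
    path_impact_update hN i hδ hu hv (y := y)] with ω l1 l2 l3 l4 h
  exact pathReward_add l1 l2 l3 l4 (fun t => hδ _ _) h

/-- Stationary profiles are equilibria, by concavity of the reward. -/
lemma isNash_of_isStationary [IsFiniteMeasure μ] (hN : 1 ≤ N) {x : Fin N → ℝ} {y : ℝ}
    {P S : ℝ≥0 → Ω → ℝ} {u : Fin N → ℝ≥0 → Ω → ℝ} (hP : AeCadlag μ p.T P)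
    (hS : CadlagL2 μ 𝓕 p.T S) (hPS : ∀ᵐ ω ∂μ, ∀ t ≤ p.T, P t ω = P 0 ω + S t ω)
    (hP0 : Integrable (P 0) μ) (hu : ∀ i, Admissible μ 𝓕 p.T (u i))
    (hs : ∀ i, IsStationary p μ 𝓕 N (x i) P (impact p y u) (u i)) :
    IsNash p μ 𝓕 x y P u := by
  refine ⟨hu, fun i v hv => ?_⟩
  have hu' : ∀ j, Admissible μ 𝓕 p.T (Function.update u i v j) := fun j => by
    by_cases hj : j = i
    · subst hj; rwa [Function.update_self]
    · rw [Function.update_of_ne hj]; exact hu j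
  obtain ⟨i1, j1⟩ := hs i _ (hv.sub (hu i))
  rw [objective_eq, objective_eq, Function.update_self]
  have r1 := integrable_pathReward (x := x i) hS hPS hP0 (memLp_lift_impact (y := y) hu')
    (ae_pathL2_impact hu') hv
  have r2 := integrable_pathReward (x := x i) hS hPS hP0 (memLp_lift_impact (y := y) hu)
    (ae_pathL2_impact hu) (hu i)
  rw [← sub_nonpos, ← integral_sub r1 r2, ← j1]
  refine integral_mono_ae (r1.sub r2) i1 ?_
  filter_upwards [pathReward_update (x := x i) (y := y) hN i hP (v := v)
    (δ := fun t ω => v t ω - u i t ω) (fun t ω => by ring) hu (hv.sub (hu i)),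
    (hv.sub (hu i)).ae_pathL2] with ω h1 h2
  rw [h1]
  linarith [pathCost_nonneg (N := N) h2]

lemma pathCost_const_mul (c : ℝ) (v : ℝ → ℝ) :
    pathCost p N (fun t => c * v t) = c ^ 2 * pathCost p N v := by
  have e1 : ∀ t, expConv p.rho (fun t => c * v t) t = c * expConv p.rho v t := fun t => by
    simp only [expConv]
    rw [mul_left_comm, ← intervalIntegral.integral_const_mul c]
    congr 1
    exact intervalIntegral.integral_congr fun s _ => by ring
  unfold pathCost
  have e2 : ∫ t in (0 : ℝ)..p.T, expConv p.rho (fun t => c * v t) t * (c * v t) =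
      c ^ 2 * ∫ t in (0 : ℝ)..p.T, expConv p.rho v t * v t := by
    rw [← intervalIntegral.integral_const_mul]
    exact intervalIntegral.integral_congr fun s _ => by simp only [e1]; ring
  rw [e2]
  simp only [intervalIntegral.integral_const_mul, mul_pow]
  ring

/-- Equilibria are stationary: the reward along a line is a concave quadratic polynomial. -/
lemma IsNash.isStationary [IsFiniteMeasure μ] (hN : 1 ≤ N) {x : Fin N → ℝ} {y : ℝ}
    {P S : ℝ≥0 → Ω → ℝ} {u : Fin N → ℝ≥0 → Ω → ℝ} (hP : AeCadlag μ p.T P)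
    (hS : CadlagL2 μ 𝓕 p.T S) (hPS : ∀ᵐ ω ∂μ, ∀ t ≤ p.T, P t ω = P 0 ω + S t ω)
    (hP0 : Integrable (P 0) μ) (h : IsNash p μ 𝓕 x y P u) (i : Fin N) :
    IsStationary p μ 𝓕 N (x i) P (impact p y u) (u i) := by
  obtain ⟨hu, hopt⟩ := h
  intro v hv
  set R : ℝ → Ω → ℝ := fun e ω => pathReward p (x i) (path P ω)
    (path (impact p y (Function.update u i fun t ω => u i t ω + e * v t ω)) ω)
    (path (fun t ω => u i t ω + e * v t ω) ω) with hR
  set R0 : Ω → ℝ := fun ω => pathReward p (x i) (path P ω) (path (impact p y u) ω)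
    (path (u i) ω) with hR0
  set a : Ω → ℝ := fun ω => ∫ t in (0 : ℝ)..p.T, v t.toNNReal ω *
        marginal p N (x i) (path P ω) (path (impact p y u) ω) (path (u i) ω) t with ha
  set b : Ω → ℝ := fun ω => pathCost p N (path v ω) with hb
  have hadm : ∀ e : ℝ, Admissible μ 𝓕 p.T fun t ω => u i t ω + e * v t ω := fun e =>
    (hu i).add (hv.const_mul e)
  have hu' : ∀ (e : ℝ) j,
      Admissible μ 𝓕 p.T (Function.update u i (fun t ω => u i t ω + e * v t ω) j) := fun e j => by
    by_cases hj : j = i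
    · subst hj; rw [Function.update_self]; exact hadm e
    · rw [Function.update_of_ne hj]; exact hu j
  have hRi : ∀ e, Integrable (R e) μ := fun e =>
    integrable_pathReward hS hPS hP0 (memLp_lift_impact (hu' e)) (ae_pathL2_impact (hu' e)) (hadm e)
  have hR0i : Integrable R0 μ :=
    integrable_pathReward hS hPS hP0 (memLp_lift_impact hu) (ae_pathL2_impact hu) (hu i)
  have hexp : ∀ e : ℝ, ∀ᵐ ω ∂μ, R e ω - R0 ω = e * a ω - e ^ 2 * b ω := by
    intro e
    filter_upwards [pathReward_update (x := x i) (y := y) hN i hP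
      (v := fun t ω => u i t ω + e * v t ω) (δ := fun t ω => e * v t ω) (fun t ω => rfl) hu
      (hv.const_mul e)] with ω h1
    have h2 := pathCost_const_mul (p := p) (N := N) e (path v ω)
    simp only [hR, hR0]
    rw [h1]
    simp only [path] at h2 ⊢
    rw [h2]
    simp only [ha, hb, mul_assoc, intervalIntegral.integral_const_mul]
  have hai : Integrable a μ := by
    refine (((hRi 1).sub (hRi (-1))).const_mul (1 / 2)).congr ?_
    filter_upwards [hexp 1, hexp (-1)] with ω h1 h2
    simp only [Pi.sub_apply]
    linarith
  have hbi : Integrable b μ := by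
    refine (hai.sub ((hRi 1).sub hR0i)).congr ?_
    filter_upwards [hexp 1] with ω h1
    simp only [Pi.sub_apply]
    linarith
  have hb0 : 0 ≤ ∫ ω, b ω ∂μ := by
    refine integral_nonneg_of_ae ?_
    filter_upwards [hv.ae_pathL2] with ω hω using pathCost_nonneg hω
  have hineq : ∀ e : ℝ, e * (∫ ω, a ω ∂μ) - e ^ 2 * (∫ ω, b ω ∂μ) ≤ 0 := by
    intro e
    have h1 := hopt i _ (hadm e)
    rw [objective_eq, objective_eq, Function.update_self] at h1
    have h2 : ∫ ω, (R e ω - R0 ω) ∂μ ≤ 0 := by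
      rw [integral_sub (hRi e) hR0i]
      exact sub_nonpos.2 h1
    rw [integral_congr_ae (hexp e), integral_sub (hai.const_mul _) (hbi.const_mul _),
      integral_const_mul, integral_const_mul] at h2
    exact h2
  refine ⟨hai, ?_⟩
  have h1 := hineq ((∫ ω, a ω ∂μ) / (1 + ∫ ω, b ω ∂μ))
  set α := ∫ ω, a ω ∂μ
  set β := ∫ ω, b ω ∂μ
  have hβ : 0 < 1 + β := by linarith
  have h2 : α / (1 + β) * α - (α / (1 + β)) ^ 2 * β = (α / (1 + β)) ^ 2 := by
    field_simp; ring
  rw [h2] at h1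
  have h3 := pow_eq_zero_iff two_ne_zero |>.1 (le_antisymm h1 (sq_nonneg _))
  exact (div_eq_zero_iff.1 h3).resolve_right hβ.ne'

/-- Two stationary profiles agree: the interaction through the average impact is monotone. -/
lemma ae_eq_of_isStationary_impact [IsFiniteMeasure μ] (hN : 1 ≤ N) {x : Fin N → ℝ} {y : ℝ}
    {P : ℝ≥0 → Ω → ℝ} {u w : Fin N → ℝ≥0 → Ω → ℝ} (hP : AeCadlag μ p.T P)
    (hu : ∀ i, Admissible μ 𝓕 p.T (u i)) (hw : ∀ i, Admissible μ 𝓕 p.T (w i))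
    (hs : ∀ i, IsStationary p μ 𝓕 N (x i) P (impact p y u) (u i))
    (hs' : ∀ i, IsStationary p μ 𝓕 N (x i) P (impact p y w) (w i)) (i : Fin N) :
    lift (w i) =ᵐ[horizonMeasure μ p.T] lift (u i) := by
  refine ae_eq_of_isStationary hP.ae_pathL2 (ae_pathL2_impact hw) (ae_pathL2_impact hu) hw hu hs'
    hs ?_ i
  filter_upwards [ae_all_iff.2 fun i => (hu i).ae_pathL2, ae_all_iff.2 fun i => (hw i).ae_pathL2,
    ae_pathL2_impact (y := y) hu, ae_pathL2_impact (y := y) hw,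
    ((Admissible.sum Finset.univ hu).const_mul (1 / (N : ℝ))).ae_pathL2,
    ((Admissible.sum Finset.univ hw).const_mul (1 / (N : ℝ))).ae_pathL2] with ω l1 l2 l3 l4 l5 l6
  have hN0 : (0 : ℝ) < N := by positivity
  have lY : PathL2 p.T fun t => path (impact p y w) ω t - path (impact p y u) ω t := l4.sub l3
  have ld : ∀ i, PathL2 p.T fun t => path (w i) ω t - path (u i) ω t := fun i => (l2 i).sub (l1 i)
  rw [← intervalIntegral.integral_finsetSum fun i _ => lY.mul (ld i)]
  have hn := expConv_energy_nonneg (p := p) (v := fun t => (1 / (N : ℝ)) * ∑ i, w i t.toNNReal ω -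
    (1 / (N : ℝ)) * ∑ i, u i t.toNNReal ω) (l6.sub l5)
  have e : ∫ t in (0 : ℝ)..p.T, ∑ i, (path (impact p y w) ω t - path (impact p y u) ω t) *
      (path (w i) ω t - path (u i) ω t) = (N * p.gamma) * ∫ t in (0 : ℝ)..p.T,
      expConv p.rho (fun t => (1 / (N : ℝ)) * ∑ i, w i t.toNNReal ω -
        (1 / (N : ℝ)) * ∑ i, u i t.toNNReal ω) t *
      ((1 / (N : ℝ)) * ∑ i, w i t.toNNReal ω - (1 / (N : ℝ)) * ∑ i, u i t.toNNReal ω) := by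
    rw [← intervalIntegral.integral_const_mul]
    refine intervalIntegral.integral_congr fun t ht => ?_
    rw [Set.uIcc_of_le p.T.coe_nonneg] at ht
    rw [path_impact y w ω ht.1, path_impact y u ω ht.1, expConv_sub p.rho l6 l5 ht,
      ← Finset.mul_sum, Finset.sum_sub_distrib]
    simp only [path]
    field_simp
    ring
  rw [e]
  exact mul_nonneg (mul_nonneg hN0.le p.gamma_pos.le) hn

end

section

variable {Ω : Type*} {mΩ : MeasurableSpace Ω} {μ : Measure Ω} {𝓕 : Filtration ℝ≥0 mΩ}

/-! ### Existence of solutions of the two systems -/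

open Matrix

section Forcing

variable {ι : Type*} [Fintype ι] [DecidableEq ι] {T : ℝ≥0}

lemma mulVec_add_single (A : Matrix ι ι ℝ) (f : ι → ℝ) (e : ι) (v : ℝ) (i : ι) :
    (A *ᵥ fun k => f k + if k = e then v else 0) i = (A *ᵥ f) i + A i e * v := by
  simp only [mulVec, dotProduct, mul_add, Finset.sum_add_distrib, mul_ite, mul_zero,
    Finset.sum_ite_eq', Finset.mem_univ, if_true]

/-- A linear forward-backward system one backward coordinate `e` of which is driven by an
additional semimartingale increment `dV`.  Subtracting `V` from that coordinate turns the
increment into the absolutely continuous forcing `F e_e V`. -/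
theorem exists_forced_forward_backward [IsFiniteMeasure μ] (h𝓕 : UsualConditions 𝓕 μ)
    (F C : Matrix ι ι ℝ) (fwd : ι → Prop) [DecidablePred fwd]
    (hdet : ∀ t ∈ Set.Icc 0 (T : ℝ), (boundaryMatrix F C fwd T t).det ≠ 0) (x0 : ι → ℝ)
    {e : ι} (he : ¬ fwd e) {V : ℝ≥0 → Ω → ℝ} (hV : CadlagL2 μ 𝓕 T V) {ζ : ι → Ω → ℝ}
    (hζm : ∀ i, StronglyMeasurable[𝓕 T] (ζ i)) (hζ : ∀ i, MemLp (ζ i) 2 μ) :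
    ∃ X : ι → ℝ≥0 → Ω → ℝ, (∀ i, CadlagL2 μ 𝓕 T (X i)) ∧
      (∀ i, fwd i → ∀ ω, ∀ t ≤ T, X i t ω = x0 i +
        ∫ r in (0 : ℝ)..t, (F *ᵥ fun k => X k r.toNNReal ω) i) ∧
      (∀ i, ∃ M, CadlagL2 μ 𝓕 T M ∧ Martingale M 𝓕 μ ∧ ∀ ω, ∀ t ≤ T, X i t ω = X i 0 ω +
        (if i = e then V t ω - V 0 ω else 0) +
        (∫ r in (0 : ℝ)..t, (F *ᵥ fun k => X k r.toNNReal ω) i) + (M t ω - M 0 ω)) ∧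
      (∀ i, ¬ fwd i → ∀ᵐ ω ∂μ, (C *ᵥ fun k => X k T ω) i = ζ i ω) ∧
      (∀ i, ¬ fwd i → ∀ t ≤ T, ∀ᵐ ω ∂μ, ((C * flow F (T - t)) *ᵥ fun k => X k t ω) i =
        (C * flow F (T - t)) i e * V t ω +
        (μ[fun ω => ζ i ω - C i e * V T ω - ∫ r in (t : ℝ)..T,
          (C * flow F (T - r) * F) i e * V r.toNNReal ω | 𝓕 t]) ω) := by
  obtain ⟨X, h1, h2, h3, h4, h5⟩ := exists_linear_forward_backward h𝓕 F C fwd hdet x0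
    (h := fun i t ω => F i e * V t ω) (fun i => hV.const_mul _)
    (ζ := fun i ω => ζ i ω - C i e * V T ω)
    (fun i => (hζm i).sub ((hV.adapted T).const_mul _))
    (fun i => (hζ i).sub ((hV.memLp T).const_mul _))
  refine ⟨fun k t ω => X k t ω + if k = e then V t ω else 0, fun i => ?_, fun i hi ω t ht => ?_,
    fun i => ?_, fun i hi => ?_, fun i hi t ht => ?_⟩
  · by_cases h : i = e
    · simpa only [h, if_true] using (h1 e).add hV
    · simpa only [h, if_false, add_zero] using h1 i
  · have : i ≠ e := fun h => he (h ▸ hi)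
    simp only [mulVec_add_single, this, if_false, add_zero]
    exact h2 i hi ω t ht
  · obtain ⟨M, m1, m2, m3⟩ := h3 i
    refine ⟨M, m1, m2, fun ω t ht => ?_⟩
    simp only [mulVec_add_single]
    rw [m3 ω t ht]
    by_cases h : i = e
    · simp only [h, if_true]; ring
    · simp only [h, if_false]; ring
  · filter_upwards [h4 i hi] with ω h
    rw [mulVec_add_single, h]; ring
  · filter_upwards [h5 i hi t ht] with ω h
    rw [mulVec_add_single, h, add_comm]
    congr 3
    funext ω'
    congr 1
    refine intervalIntegral.integral_congr fun r _ => ?_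
    simp only [mulVec, dotProduct, Matrix.mul_apply (N := F), Finset.sum_mul, mul_assoc]

end Forcing

variable {p : Params} {N : ℕ}

/-- A positive infimum keeps all values away from zero. -/
lemma ne_zero_of_sInf_abs_pos {f : ℝ → ℝ} {s : Set ℝ} (h : 0 < sInf ((fun t => |f t|) '' s)) {t : ℝ}
    (ht : t ∈ s) : f t ≠ 0 := fun h0 => by
  have : sInf ((fun t => |f t|) '' s) ≤ |f t| :=
    csInf_le ⟨0, by rintro _ ⟨r, _, rfl⟩; exact abs_nonneg _⟩ ⟨t, ht, rfl⟩
  rw [h0, abs_zero] at this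
  exact absurd h this.not_gt

lemma boundaryMatrix_apply {ι : Type*} [Fintype ι] [DecidableEq ι] (F C : Matrix ι ι ℝ)
    (fwd : ι → Prop) [DecidablePred fwd] (T t : ℝ) (i j : ι) :
    boundaryMatrix F C fwd T t i j =
      if fwd i then (1 : Matrix ι ι ℝ) i j else (C * flow F (T - t)) i j := by
  have : (1 : Matrix ι ι ℝ) - fwdProj fwd = Matrix.diagonal fun i => if fwd i then 0 else 1 := by
    rw [fwdProj, ← Matrix.diagonal_one, Matrix.diagonal_sub]
    congr 1; funext i; split_ifs <;> simp
  rw [boundaryMatrix, this, Matrix.add_apply, Matrix.diagonal_mul, fwdProj]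
  by_cases h : fwd i
  · simp [h, Matrix.diagonal_apply, Matrix.one_apply]
  · simp [h, Matrix.diagonal_apply]

/-- The terminal conditions of the aggregated system, in its two backward coordinates. -/
def meanTerminal (p : Params) : Matrix (Fin 4) (Fin 4) ℝ :=
  !![0, 0, 0, 0; 0, 0, 0, 0; p.varrho / p.lam, -(p.kappa / (2 * p.lam)), -1, 0; 0, 0, 0, 1]

lemma meanTerminal_mul_flow_two (t : ℝ) (j : Fin 4) :
    (meanTerminal p * flow (Fbar p N) t) 2 j = Gbar p N t j := by
  rw [Matrix.mul_apply_eq_vecMul]; rfl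

lemma meanTerminal_mul_flow_three (t : ℝ) (j : Fin 4) :
    (meanTerminal p * flow (Fbar p N) t) 3 j = Hbar p N t j := by
  rw [Matrix.mul_apply_eq_vecMul]; rfl

lemma MeanNondegenerate.det_boundaryMatrix_ne_zero (h : MeanNondegenerate p N) {t : ℝ}
    (ht : t ∈ Set.Icc 0 (p.T : ℝ)) :
    (boundaryMatrix (Fbar p N) (meanTerminal p) (fun i => i < 2) p.T t).det ≠ 0 := by
  have := ne_zero_of_sInf_abs_pos h.det (t := p.T - t) ⟨by linarith [ht.2], by linarith [ht.1]⟩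
  have e : boundaryMatrix (Fbar p N) (meanTerminal p) (fun i => i < 2) p.T t =
      !![1, 0, 0, 0; 0, 1, 0, 0;
        Gbar p N (p.T - t) 0, Gbar p N (p.T - t) 1, Gbar p N (p.T - t) 2, Gbar p N (p.T - t) 3;
        Hbar p N (p.T - t) 0, Hbar p N (p.T - t) 1, Hbar p N (p.T - t) 2, Hbar p N (p.T - t) 3] := by
    ext i j
    rw [boundaryMatrix_apply]
    fin_cases i
    · fin_cases j <;> simp
    · fin_cases j <;> simp
    · refine (meanTerminal_mul_flow_two (p.T - t) j).trans ?_
      fin_cases j <;> rfl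
    · refine (meanTerminal_mul_flow_three (p.T - t) j).trans ?_
      fin_cases j <;> rfl
  rw [e]
  convert this using 1
  simp [Matrix.det_succ_row_zero, Fin.sum_univ_succ, Fin.succAbove]
  ring

/-- The terminal conditions of a player's system, in its two backward coordinates. -/
def playerTerminal (p : Params) : Matrix (Fin 3) (Fin 3) ℝ :=
  !![0, 0, 0; p.varrho / p.lam, -1, 0; 0, 0, 1]

lemma playerTerminal_mul_flow_one (t : ℝ) (j : Fin 3) :
    (playerTerminal p * flow (F p N) t) 1 j = G p N t j := by
  rw [Matrix.mul_apply_eq_vecMul]; rfl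

lemma playerTerminal_mul_flow_two (t : ℝ) (j : Fin 3) :
    (playerTerminal p * flow (F p N) t) 2 j = H p N t j := by
  rw [Matrix.mul_apply_eq_vecMul]; rfl

lemma PlayerNondegenerate.det_boundaryMatrix_ne_zero (h : PlayerNondegenerate p N) {t : ℝ}
    (ht : t ∈ Set.Icc 0 (p.T : ℝ)) :
    (boundaryMatrix (F p N) (playerTerminal p) (fun i => i < 1) p.T t).det ≠ 0 := by
  have := ne_zero_of_sInf_abs_pos h.det (t := p.T - t) ⟨by linarith [ht.2], by linarith [ht.1]⟩
  have e : boundaryMatrix (F p N) (playerTerminal p) (fun i => i < 1) p.T t =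
      !![1, 0, 0;
        G p N (p.T - t) 0, G p N (p.T - t) 1, G p N (p.T - t) 2;
        H p N (p.T - t) 0, H p N (p.T - t) 1, H p N (p.T - t) 2] := by
    ext i j
    rw [boundaryMatrix_apply]
    fin_cases i
    · fin_cases j <;> simp
    · refine (playerTerminal_mul_flow_one (p.T - t) j).trans ?_
      fin_cases j <;> rfl
    · refine (playerTerminal_mul_flow_two (p.T - t) j).trans ?_
      fin_cases j <;> rfl
  rw [e]
  convert this using 1
  simp [Matrix.det_fin_three]

/-- The aggregated system has a solution whose components are càdlàg and bounded in `L²`. -/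
theorem exists_solvesMeanFBSDE [IsFiniteMeasure μ] (h𝓕 : UsualConditions 𝓕 μ) (hN : 1 ≤ N)
    (hF : MeanNondegenerate p N) {P W A : ℝ≥0 → Ω → ℝ} (hW : CadlagL2 μ 𝓕 p.T W)
    (hWm : Martingale W 𝓕 μ) (hA : CadlagL2 μ 𝓕 p.T A)
    (hP : ∀ᵐ ω ∂μ, ∀ t ≤ p.T, P t ω - P 0 ω = W t ω - W 0 ω + (A t ω - A 0 ω)) (x y : ℝ) :
    ∃ X Y u Z, CadlagL2 μ 𝓕 p.T Y ∧ SolvesMeanFBSDE p μ 𝓕 N x y P X Y u Z := by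
  have hl := p.lam_pos.ne'
  have hN0 : (N : ℝ) ≠ 0 := by positivity
  obtain ⟨S, h1, h2, h3, h4, -⟩ := exists_forced_forward_backward h𝓕 (Fbar p N) (meanTerminal p)
    (fun i => i < 2) (fun t ht => hF.det_boundaryMatrix_ne_zero ht) ![x, y, 0, 0] (e := 2)
    (by decide) (hA.const_mul (1 / (2 * p.lam))) (ζ := fun _ _ => 0)
    (fun _ => stronglyMeasurable_const) (fun _ => MemLp.zero)
  obtain ⟨M, m1, m2, m3⟩ := h3 2
  obtain ⟨K, k1, k2, k3⟩ := h3 3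
  have f0 : ∀ f : Fin 4 → ℝ, (Fbar p N *ᵥ f) 0 = -f 2 := fun f => by
    simp [Fbar, Matrix.mulVec, dotProduct, Fin.sum_univ_four]
  have f1 : ∀ f : Fin 4 → ℝ, (Fbar p N *ᵥ f) 1 = -p.rho * f 1 + p.gamma * f 2 := fun f => by
    simp [Fbar, Matrix.mulVec, dotProduct, Fin.sum_univ_four]
  have f2 : ∀ f : Fin 4 → ℝ, (Fbar p N *ᵥ f) 2 = p.kappa * p.rho * f 1 / (2 * p.lam)
      - p.gamma * p.kappa * ((N : ℝ) - 1) * f 2 / (2 * p.lam * N) - p.phi * f 0 / p.lam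
      + p.rho * f 3 / (2 * p.lam) := fun f => by
    simp [Fbar, Matrix.mulVec, dotProduct, Fin.sum_univ_four]; ring
  have f3 : ∀ f : Fin 4 → ℝ, (Fbar p N *ᵥ f) 3 = p.rho * f 3 + p.gamma * p.kappa / N * f 2 :=
    fun f => by
      simp [Fbar, Matrix.mulVec, dotProduct, Fin.sum_univ_four]; ring
  refine ⟨S 0, S 1, S 2, S 3, h1 1, ?_⟩
  refine ⟨(h1 2).admissible, by rw [(h1 3).stopAt_eq]; exact (h1 3).adapted, (h1 0).aeCadlag,
    (h1 1).aeCadlag, (h1 2).aeCadlag, (h1 3).aeCadlag, ae_of_all _ fun ω t ht => ?_,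
    ae_of_all _ fun ω t ht => ?_, ⟨fun t ω => M t ω - 1 / (2 * p.lam) * W t ω, K, ?_, ?_, ?_, ?_⟩,
    ?_, ?_⟩
  · have := h2 0 (by decide) ω t ht
    simp only [f0, intervalIntegral.integral_neg] at this
    rw [this]; rfl
  · have := h2 1 (by decide) ω t ht
    simp only [f1] at this
    rw [this]; rfl
  · exact (m1.sub (hW.const_mul _)).isSqIntMartingale (m2.sub (hWm.smul _))
  · exact k1.isSqIntMartingale k2
  · filter_upwards [hP] with ω h t ht
    have := m3 ω t ht
    simp only [f2, if_true] at this
    rw [this, h t ht]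
    ring
  · refine ae_of_all _ fun ω t ht => ?_
    have := k3 ω t ht
    simp only [f3, show (3 : Fin 4) ≠ 2 by decide, if_false, add_zero] at this
    exact this
  · filter_upwards [h4 2 (by decide)] with ω h
    simp [meanTerminal, Matrix.mulVec, dotProduct, Fin.sum_univ_four] at h
    linarith
  · filter_upwards [h4 3 (by decide)] with ω h
    simpa [meanTerminal, Matrix.mulVec, dotProduct, Fin.sum_univ_four] using h

/-- A player's system has a solution, which satisfies two linear relations at every time: the
terminal conditions propagated backwards along the flow. -/
theorem exists_solvesPlayerFBSDE [IsFiniteMeasure μ] (h𝓕 : UsualConditions 𝓕 μ)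
    (hF : PlayerNondegenerate p N) {P W A Y : ℝ≥0 → Ω → ℝ} (hW : CadlagL2 μ 𝓕 p.T W)
    (hWm : Martingale W 𝓕 μ) (hA : CadlagL2 μ 𝓕 p.T A) (hY : CadlagL2 μ 𝓕 p.T Y)
    (hP : ∀ᵐ ω ∂μ, ∀ t ≤ p.T, P t ω - P 0 ω = W t ω - W 0 ω + (A t ω - A 0 ω)) (x : ℝ) :
    ∃ X u Z, SolvesPlayerFBSDE p μ 𝓕 N x P Y X u Z ∧
      ∀ t ≤ p.T,
        (∀ᵐ ω ∂μ, G p N (p.T - t) 0 * X t ω + G p N (p.T - t) 1 * u t ω + G p N (p.T - t) 2 * Z t ω =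
          G p N (p.T - t) 1 * (1 / (2 * p.lam) * (A t ω - p.kappa * Y t ω)) +
          (μ[fun ω => p.kappa / (2 * p.lam) * Y p.T ω +
            1 / (2 * p.lam) * (A p.T ω - p.kappa * Y p.T ω) - ∫ r in (t : ℝ)..p.T,
            (Matrix.vecMul (G p N (p.T - r)) (F p N)) 1 *
              (1 / (2 * p.lam) * (A r.toNNReal ω - p.kappa * Y r.toNNReal ω)) | 𝓕 t]) ω) ∧
        (∀ᵐ ω ∂μ, H p N (p.T - t) 0 * X t ω + H p N (p.T - t) 1 * u t ω + H p N (p.T - t) 2 * Z t ω =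
          H p N (p.T - t) 1 * (1 / (2 * p.lam) * (A t ω - p.kappa * Y t ω)) +
          (μ[fun ω => - ∫ r in (t : ℝ)..p.T,
            (Matrix.vecMul (H p N (p.T - r)) (F p N)) 1 *
              (1 / (2 * p.lam) * (A r.toNNReal ω - p.kappa * Y r.toNNReal ω)) | 𝓕 t]) ω) := by
  have hl := p.lam_pos.ne'
  obtain ⟨S, h1, h2, h3, h4, h5⟩ := exists_forced_forward_backward h𝓕 (F p N) (playerTerminal p)
    (fun i => i < 1) (fun t ht => hF.det_boundaryMatrix_ne_zero ht) ![x, 0, 0] (e := 1)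
    (by decide) ((hA.sub (hY.const_mul p.kappa)).const_mul (1 / (2 * p.lam)))
    (ζ := ![fun _ => 0, fun ω => p.kappa / (2 * p.lam) * Y p.T ω, fun _ => 0])
    (fun i => by
      fin_cases i
      · exact stronglyMeasurable_const
      · exact (hY.adapted p.T).const_mul _
      · exact stronglyMeasurable_const)
    (fun i => by
      fin_cases i
      · exact MemLp.zero
      · exact (hY.memLp p.T).const_mul _
      · exact MemLp.zero)
  obtain ⟨M, m1, m2, m3⟩ := h3 1
  obtain ⟨K, k1, k2, k3⟩ := h3 2
  have f0 : ∀ f : Fin 3 → ℝ, (F p N *ᵥ f) 0 = -f 1 := fun f => by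
    simp [F, Matrix.mulVec, dotProduct, Fin.sum_univ_three]
  have f1 : ∀ f : Fin 3 → ℝ, (F p N *ᵥ f) 1 = p.gamma * p.kappa / (2 * p.lam * N) * f 1
      - p.phi * f 0 / p.lam + p.rho * f 2 / (2 * p.lam) := fun f => by
    simp [F, Matrix.mulVec, dotProduct, Fin.sum_univ_three]; ring
  have f2 : ∀ f : Fin 3 → ℝ, (F p N *ᵥ f) 2 = p.rho * f 2 + p.gamma * p.kappa / N * f 1 :=
    fun f => by
      simp [F, Matrix.mulVec, dotProduct, Fin.sum_univ_three]; ring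
  have c1 : ∀ t, (playerTerminal p * flow (F p N) t) 1 = G p N t := fun t =>
    funext (playerTerminal_mul_flow_one t)
  have c2 : ∀ t, (playerTerminal p * flow (F p N) t) 2 = H p N t := fun t =>
    funext (playerTerminal_mul_flow_two t)
  refine ⟨S 0, S 1, S 2, ?_, fun t ht => ⟨?_, ?_⟩⟩
  · refine ⟨(h1 1).admissible, by rw [(h1 2).stopAt_eq]; exact (h1 2).adapted, (h1 0).aeCadlag,
      (h1 1).aeCadlag, (h1 2).aeCadlag, ae_of_all _ fun ω t ht => ?_,
      ⟨fun t ω => M t ω - 1 / (2 * p.lam) * W t ω, K, ?_, ?_, ?_, ?_⟩, ?_, ?_⟩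
    · have := h2 0 (by decide) ω t ht
      simp only [f0, intervalIntegral.integral_neg] at this
      rw [this]; rfl
    · exact (m1.sub (hW.const_mul _)).isSqIntMartingale (m2.sub (hWm.smul _))
    · exact k1.isSqIntMartingale k2
    · filter_upwards [hP] with ω h t ht
      have := m3 ω t ht
      simp only [f1, if_true] at this
      rw [this, h t ht]
      ring
    · refine ae_of_all _ fun ω t ht => ?_
      have := k3 ω t ht
      simp only [f2, show (2 : Fin 3) ≠ 1 by decide, if_false, add_zero] at this
      exact this
    · filter_upwards [h4 1 (by decide)] with ω h
      simp [playerTerminal, Matrix.mulVec, dotProduct, Fin.sum_univ_three] at h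
      rw [div_mul_eq_mul_div, div_mul_eq_mul_div] at h ⊢
      linarith
    · filter_upwards [h4 2 (by decide)] with ω h
      simpa [playerTerminal, Matrix.mulVec, dotProduct, Fin.sum_univ_three] using h
  · filter_upwards [h5 1 (by decide) t ht] with ω h
    simp only [Matrix.mul_apply_eq_vecMul _ (F p N), c1] at h
    rw [Matrix.mulVec, dotProduct, Fin.sum_univ_three, c1] at h
    rw [h]
    congr 3
    funext ω'
    simp [playerTerminal]
  · filter_upwards [h5 2 (by decide) t ht] with ω h
    simp only [Matrix.mul_apply_eq_vecMul _ (F p N), c2] at h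
    rw [Matrix.mulVec, dotProduct, Fin.sum_univ_three, c2] at h
    rw [h]
    congr 3
    funext ω'
    simp [playerTerminal]

end

section

variable {Ω : Type*} {mΩ : MeasurableSpace Ω} {μ : Measure Ω} {𝓕 : Filtration ℝ≥0 mΩ}

/-! ### Paths of bounded variation and Stieltjes integrals -/

lemma sum_edist_monotone_le (h : ℕ → ℝ) {k : ℕ → ℕ} (hk : Monotone k) (n : ℕ) :
    ∑ i ∈ Finset.range n, edist (h (k (i + 1))) (h (k i)) ≤
      ∑ j ∈ Finset.range (k n), edist (h (j + 1)) (h j) := by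
  have key : ∑ i ∈ Finset.range n, edist (h (k (i + 1))) (h (k i)) ≤
      ∑ j ∈ Finset.Ico (k 0) (k n), edist (h (j + 1)) (h j) := by
    induction n with
    | zero => simp
    | succ n ih =>
      rw [Finset.sum_range_succ, ← Finset.sum_Ico_consecutive _ (hk n.zero_le) (hk n.le_succ)]
      refine add_le_add ih ?_
      rw [edist_comm]
      refine (edist_le_Ico_sum_edist h (hk n.le_succ)).trans (le_of_eq ?_)
      exact Finset.sum_congr rfl fun j _ => edist_comm _ _
  refine key.trans (Finset.sum_le_sum_of_subset ?_)
  rw [Finset.range_eq_Ico]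
  exact Finset.Ico_subset_Ico_left (Nat.zero_le _)

/-- The variation of `f` along the grids of mesh `1/(n+1)`: a countable supremum of evaluations,
hence a measurable functional of the path. -/
def gridVariation (f : ℝ≥0 → ℝ) : ℝ≥0∞ :=
  ⨆ n : ℕ, ⨆ m : ℕ, ∑ j ∈ Finset.range m,
    edist (f (((j + 1 : ℕ) : ℝ≥0) / (n + 1))) (f ((j : ℝ≥0) / (n + 1)))

lemma gridVariation_le (f : ℝ≥0 → ℝ) : gridVariation f ≤ eVariationOn f Set.univ := by
  refine iSup_le fun n => iSup_le fun m => ?_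
  refine eVariationOn.sum_le (u := fun j : ℕ => (j : ℝ≥0) / (n + 1)) (fun i j hij => ?_)
    fun _ => Set.mem_univ _
  simp only
  gcongr

lemma tendsto_ceil_grid (t : ℝ≥0) :
    Tendsto (fun n : ℕ => ((⌈t * (n + 1)⌉₊ : ℕ) : ℝ≥0) / (n + 1)) atTop (𝓝[≥] t) := by
  have hlow : ∀ n : ℕ, t ≤ ((⌈t * (n + 1)⌉₊ : ℕ) : ℝ≥0) / (n + 1) := fun n => by
    rw [le_div_iff₀ (by positivity)]; exact Nat.le_ceil _
  have hup : ∀ n : ℕ, ((⌈t * (n + 1)⌉₊ : ℕ) : ℝ≥0) / (n + 1) ≤ t + 1 / (n + 1) := fun n => by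
    rw [div_le_iff₀ (by positivity), add_mul, one_div, inv_mul_cancel₀ (by positivity)]
    exact (Nat.ceil_lt_add_one (by positivity)).le
  refine tendsto_nhdsWithin_iff.2 ⟨?_, Eventually.of_forall hlow⟩
  refine tendsto_of_tendsto_of_tendsto_of_le_of_le tendsto_const_nhds ?_ hlow hup
  simpa using (tendsto_const_nhds (x := t)).add (tendsto_one_div_add_atTop_nhds_zero_nat (𝕜 := ℝ≥0))

/-- For right-continuous paths the variation is attained along the grids. -/
lemma eVariationOn_le_gridVariation {f : ℝ≥0 → ℝ} (hf : ∀ t, ContinuousWithinAt f (Set.Ici t) t) :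
    eVariationOn f Set.univ ≤ gridVariation f := by
  refine iSup_le fun ⟨m, u, hu, _⟩ => ?_
  have hlim : ∀ t : ℝ≥0, Tendsto (fun n : ℕ => f (((⌈t * (n + 1)⌉₊ : ℕ) : ℝ≥0) / (n + 1))) atTop
      (𝓝 (f t)) := fun t => (hf t).tendsto.comp (tendsto_ceil_grid t)
  refine le_of_tendsto' (tendsto_finsetSum (Finset.range m) fun i _ =>
    (hlim (u (i + 1))).edist (hlim (u i))) fun n => ?_
  refine (sum_edist_monotone_le (fun j => f ((j : ℝ≥0) / (n + 1)))
    (k := fun i => ⌈u i * (n + 1)⌉₊) (fun i j hij => Nat.ceil_mono (by gcongr; exact hu hij)) m).trans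
    ?_
  exact le_iSup_of_le n (le_iSup (fun m : ℕ => ∑ j ∈ Finset.range m,
    edist (f (((j + 1 : ℕ) : ℝ≥0) / (n + 1))) (f ((j : ℝ≥0) / (n + 1)))) _)

/-- Square integrable total variation makes almost every path of bounded variation.  The grid
variation supplies the measurability that the total variation of an arbitrary family of paths
lacks. -/
lemma ae_boundedVariationOn {T : ℝ≥0} {A A' : ℝ≥0 → Ω → ℝ} (hA : CadlagL2 μ 𝓕 T A')
    (hAA : ∀ᵐ ω ∂μ, ∀ t ≤ T, A t ω = A' t ω)
    (hv : ∫⁻ ω, (eVariationOn (fun t => A t ω) (Set.Iic T)) ^ 2 ∂μ < ∞) :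
    ∀ᵐ ω ∂μ, BoundedVariationOn (fun t => A t ω) (Set.Iic T) := by
  have hm : Measurable fun ω => gridVariation fun t => A' t ω := by
    have hA' : ∀ t, Measurable (A' t) := fun t => ((hA.adapted t).mono (𝓕.le t)).measurable
    unfold gridVariation
    exact Measurable.iSup fun n => Measurable.iSup fun m => Finset.measurable_fun_sum _ fun j _ =>
      (hA' _).edist (hA' _)
  have heq : ∀ᵐ ω ∂μ, eVariationOn (fun t => A' t ω) Set.univ ≤
      eVariationOn (fun t => A t ω) (Set.Iic T) := by
    filter_upwards [hAA] with ω h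
    rw [eVariationOn.congr (s := Set.Iic T) (g := fun t => A' t ω) (fun t ht => h t ht)]
    have := eVariationOn.comp_le_of_monotoneOn (fun t => A' t ω) (s := Set.Iic T) (t := Set.univ)
      (fun t => min t T) (fun a _ b _ hab => min_le_min_right T hab) (fun t _ => min_le_right t T)
    refine le_trans (le_of_eq ?_) this
    congr 1
    funext t
    exact (hA.stopped t ω).symm
  have hle : ∀ᵐ ω ∂μ, (gridVariation fun t => A' t ω) ^ 2 ≤
      (eVariationOn (fun t => A t ω) (Set.Iic T)) ^ 2 := by
    filter_upwards [heq] with ω h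
    gcongr
    exact (gridVariation_le _).trans h
  filter_upwards [ae_lt_top (hm.pow_const 2) ((lintegral_mono_ae hle).trans_lt hv).ne, hAA]
    with ω h1 h2
  have h3 : gridVariation (fun t => A' t ω) < ∞ := by
    by_contra h
    rw [not_lt_top_iff.1 h] at h1
    simp at h1
  rw [BoundedVariationOn, eVariationOn.congr (s := Set.Iic T) (g := fun t => A' t ω) (fun t ht => h2 t ht)]
  exact ((eVariationOn.mono _ (Set.subset_univ _)).trans
    (eVariationOn_le_gridVariation fun t => (hA.cadlag ω t).1) |>.trans_lt h3).ne

lemma boundedVariationOn_sub_const_mul {s : Set ℝ≥0} {f g : ℝ≥0 → ℝ} (c : ℝ)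
    (hf : BoundedVariationOn f s) (hg : BoundedVariationOn g s) :
    BoundedVariationOn (fun t => f t - c * g t) s := by
  have hg' : BoundedVariationOn (fun t => -c * g t) s := by
    have := (LipschitzWith.of_dist_le_mul (K := ‖-c‖₊) (f := fun x : ℝ => -c * x) fun x y => by
      rw [Real.dist_eq, ← mul_sub, abs_mul]; rfl).comp_boundedVariationOn hg
    exact this
  refine ne_top_of_le_ne_top (ENNReal.add_ne_top.2 ⟨hf, hg'⟩) (iSup_le fun ⟨n, u, hu, us⟩ => ?_)
  refine le_trans ?_ (add_le_add (eVariationOn.sum_le (n := n) hu us)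
    (eVariationOn.sum_le (n := n) hu us))
  rw [← Finset.sum_add_distrib]
  refine Finset.sum_le_sum fun i _ => ?_
  simp only [sub_eq_add_neg, ← neg_mul]
  exact edist_add_add_le _ _ _ _

lemma boundedVariationOn_primitive {T : ℝ≥0} {f : ℝ → ℝ} {φ : ℝ≥0 → ℝ} {c : ℝ}
    (hf : IntervalIntegrable f volume 0 T) (hφ : ∀ t ≤ T, φ t = c + ∫ s in (0 : ℝ)..t, f s) :
    BoundedVariationOn φ (Set.Iic T) := by
  have h1 := (hf.absolutelyContinuousOnInterval_intervalIntegral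
    (c := 0) Set.left_mem_uIcc).boundedVariationOn
  have h2 := eVariationOn.comp_le_of_monotoneOn (fun t : ℝ => ∫ s in (0 : ℝ)..t, f s)
    (s := Set.uIcc 0 (T : ℝ)) (t := Set.Iic T) (fun t : ℝ≥0 => (t : ℝ))
    (fun a _ b _ hab => NNReal.coe_le_coe.2 hab) (fun t ht => by
      rw [Set.uIcc_of_le T.coe_nonneg]; exact ⟨t.coe_nonneg, NNReal.coe_le_coe.2 ht⟩)
  have h3 : eVariationOn φ (Set.Iic T) =
      eVariationOn ((fun t : ℝ => ∫ s in (0 : ℝ)..t, f s) ∘ fun t : ℝ≥0 => (t : ℝ)) (Set.Iic T) := by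
    rw [eVariationOn.congr (s := Set.Iic T) (f := φ) (g := fun t : ℝ≥0 => c + ∫ s in (0 : ℝ)..t, f s) fun t ht => hφ t ht]
    simp [eVariationOn]
  rw [BoundedVariationOn, h3]
  exact ne_top_of_le_ne_top h1 h2

/-- Fubini for a `C¹` function integrated against a finite measure on an interval. -/
lemma setIntegral_C1_eq (ν : Measure ℝ≥0) [IsFiniteMeasure ν] {g g' : ℝ → ℝ}
    (hg : ∀ r, HasDerivAt g (g' r) r) (hg' : Continuous g') {t T : ℝ≥0} (htT : t ≤ T) :
    ∫ s in Set.Ioc t T, g s ∂ν =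
      g T * ν.real (Set.Ioc t T) - ∫ r in (t : ℝ)..T, g' r * ν.real (Set.Ioc t r.toNNReal) := by
  have hgc : Continuous g := continuous_iff_continuousAt.2 fun r => (hg r).continuousAt
  set D : Set (ℝ × ℝ≥0) := {z | (z.2 : ℝ) ≤ z.1} with hD
  have hDm : MeasurableSet D := measurableSet_le (by fun_prop) (by fun_prop)
  have hi : Integrable (D.indicator fun z : ℝ × ℝ≥0 => g' z.1)
      ((volume.restrict (Set.Ioc (t : ℝ) T)).prod (ν.restrict (Set.Ioc t T))) := by
    refine Integrable.indicator ?_ hDm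
    exact Integrable.comp_fst (hg'.integrableOn_Ioc (a := (t : ℝ)) (b := T)) _
  have hsw := integral_integral_swap (f := fun r s => D.indicator (fun z : ℝ × ℝ≥0 => g' z.1) (r, s))
    hi
  have e1 : ∫ r in Set.Ioc (t : ℝ) T, ∫ s in Set.Ioc t T,
      D.indicator (fun z : ℝ × ℝ≥0 => g' z.1) (r, s) ∂ν =
      ∫ r in (t : ℝ)..T, g' r * ν.real (Set.Ioc t r.toNNReal) := by
    rw [intervalIntegral.integral_of_le (NNReal.coe_le_coe.2 htT)]
    refine setIntegral_congr_fun measurableSet_Ioc fun r hr => ?_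
    have hr0 : 0 ≤ r := t.coe_nonneg.trans hr.1.le
    have : ∀ s, D.indicator (fun z : ℝ × ℝ≥0 => g' z.1) (r, s) =
        (Set.Iic r.toNNReal).indicator (fun _ => g' r) s := fun s => by
      simp only [Set.indicator_apply, hD, Set.mem_ofPred_eq, Set.mem_Iic,
        Real.le_toNNReal_iff_coe_le hr0]
    simp only [this]
    rw [setIntegral_indicator measurableSet_Iic, setIntegral_const, smul_eq_mul, mul_comm]
    congr 2
    ext s
    simp only [Set.mem_inter_iff, Set.mem_Ioc, Set.mem_Iic]
    exact ⟨fun h => ⟨h.1.1, h.2⟩, fun h => ⟨⟨h.1, h.2.trans (Real.toNNReal_le_iff_le_coe.2 hr.2)⟩, h.2⟩⟩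
  have e2 : ∫ s in Set.Ioc t T, (∫ r in Set.Ioc (t : ℝ) T,
      D.indicator (fun z : ℝ × ℝ≥0 => g' z.1) (r, s)) ∂ν = ∫ s in Set.Ioc t T, (g T - g s) ∂ν := by
    refine setIntegral_congr_fun measurableSet_Ioc fun s hs => ?_
    have hsT : (s : ℝ) ≤ T := NNReal.coe_le_coe.2 hs.2
    have hts : (t : ℝ) < s := NNReal.coe_lt_coe.2 hs.1
    have : ∀ r, D.indicator (fun z : ℝ × ℝ≥0 => g' z.1) (r, s) =
        (Set.Ici (s : ℝ)).indicator g' r := fun r => by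
      simp only [Set.indicator_apply, hD, Set.mem_ofPred_eq, Set.mem_Ici]
    simp only [this]
    rw [setIntegral_indicator measurableSet_Ici, ← intervalIntegral.integral_eq_sub_of_hasDerivAt
      (fun r _ => hg r) (hg'.intervalIntegrable _ _), intervalIntegral.integral_of_le hsT,
      ← integral_Icc_eq_integral_Ioc]
    congr 2
    ext r
    simp only [Set.mem_inter_iff, Set.mem_Ioc, Set.mem_Ici, Set.mem_Icc]
    exact ⟨fun h => ⟨h.2, h.1.2⟩, fun h => ⟨⟨hts.trans_le h.1, h.2⟩, h.1⟩⟩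
  have hgi : IntegrableOn (fun s : ℝ≥0 => g s) (Set.Ioc t T) ν := by
    refine (ContinuousOn.integrableOn_compact isCompact_Icc (μ := ν)
      (Continuous.continuousOn (by fun_prop)) : IntegrableOn (fun s : ℝ≥0 => g s) (Set.Icc t T) ν).mono_set
      Set.Ioc_subset_Icc_self
  rw [e1, e2, integral_sub (integrable_const _) hgi, setIntegral_const, smul_eq_mul] at hsw
  rw [hsw]; ring

/-- Integration by parts for the Stieltjes integral of a `C¹` function against a càdlàg path of
bounded variation. -/
lemma stieltjesIntegral_eq {g g' : ℝ → ℝ} (hg : ∀ r, HasDerivAt g (g' r) r) (hg' : Continuous g')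
    {f : ℝ≥0 → ℝ} {t T : ℝ≥0} (htT : t ≤ T) (hbv : BoundedVariationOn f (Set.Iic T))
    (hf : IsCadlag fun s => f (min s T)) :
    stieltjesIntegral (fun s => g s) f t T =
      g T * f T - g t * f t - ∫ r in (t : ℝ)..T, g' r * f r.toNNReal := by
  have hgc : Continuous g := continuous_iff_continuousAt.2 fun r => (hg r).continuousAt
  have hbv' : BoundedVariationOn (fun s => f (min s T)) Set.univ :=
    ne_top_of_le_ne_top hbv (eVariationOn.comp_le_of_monotoneOn f (s := Set.Iic T) (t := Set.univ)
      (fun t => min t T) (fun a _ b _ hab => min_le_min_right T hab) (fun t _ => min_le_right t T))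
  rw [stieltjesIntegral, dif_pos hbv']
  set m : SignedMeasure ℝ≥0 := hbv'.vectorMeasure with hm
  have hmI : ∀ r, t ≤ r → r ≤ T → m (Set.Ioc t r) = f r - f t := fun r h1 h2 => by
    rw [hm, hbv'.vectorMeasure_Ioc h1, (hf r).1.rightLim_eq, (hf t).1.rightLim_eq,
      min_eq_left h2, min_eq_left htT]
  set j := m.toJordanDecomposition with hj
  have hreal : ∀ r, t ≤ r → r ≤ T →
      j.posPart.real (Set.Ioc t r) - j.negPart.real (Set.Ioc t r) = f r - f t := fun r h1 h2 => by
    rw [← hmI r h1 h2, m.apply_eq_posPart_real_sub_negPart_real measurableSet_Ioc]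
  have hgi : ∀ ν : Measure ℝ≥0, IsFiniteMeasure ν →
      IntegrableOn (fun s : ℝ≥0 => g s) (Set.Ioc t T) ν := fun ν _ =>
    (ContinuousOn.integrableOn_compact isCompact_Icc (μ := ν)
      (Continuous.continuousOn (by fun_prop)) : IntegrableOn (fun s : ℝ≥0 => g s) (Set.Icc t T) ν).mono_set
      Set.Ioc_subset_Icc_self
  have hint : ∫ᵛ s in Set.Ioc t T, g s ∂•m =
      (∫ s in Set.Ioc t T, g s ∂j.posPart) - ∫ s in Set.Ioc t T, g s ∂j.negPart := by
    have hmj : m = j.posPart.toSignedMeasure - j.negPart.toSignedMeasure :=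
      m.toSignedMeasure_toJordanDecomposition.symm
    have hmr : m.restrict (Set.Ioc t T) = (j.posPart.restrict (Set.Ioc t T)).toSignedMeasure -
        (j.negPart.restrict (Set.Ioc t T)).toSignedMeasure := by
      ext B hB
      rw [VectorMeasure.restrict_apply _ measurableSet_Ioc hB, hmj, _root_.sub_apply,
        _root_.sub_apply, Measure.toSignedMeasure_apply_measurable hB,
        Measure.toSignedMeasure_apply_measurable hB,
        Measure.toSignedMeasure_apply_measurable (hB.inter measurableSet_Ioc),
        Measure.toSignedMeasure_apply_measurable (hB.inter measurableSet_Ioc),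
        measureReal_restrict_apply hB, measureReal_restrict_apply hB]
    have hfl : (ContinuousLinearMap.lsmul ℝ ℝ : ℝ →L[ℝ] ℝ →L[ℝ] ℝ) =
        (ContinuousLinearMap.lsmul ℝ ℝ).flip := by
      ext; simp
    rw [hmr, VectorMeasure.integral_sub_vectorMeasure, hfl, VectorMeasure.integral_toSignedMeasure,
      VectorMeasure.integral_toSignedMeasure]
    · rw [VectorMeasure.Integrable, Measure.variation_toSignedMeasure]; exact hgi _ inferInstance
    · rw [VectorMeasure.Integrable, Measure.variation_toSignedMeasure]; exact hgi _ inferInstance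
  have hmono : ∀ ν : Measure ℝ≥0, IsFiniteMeasure ν →
      IntervalIntegrable (fun r : ℝ => g' r * ν.real (Set.Ioc t r.toNNReal)) volume t T :=
    fun ν _ => by
      refine IntervalIntegrable.continuousOn_mul (Monotone.intervalIntegrable fun a b hab =>
        measureReal_mono (Set.Ioc_subset_Ioc_right (Real.toNNReal_le_toNNReal hab)))
        hg'.continuousOn
  rw [hint, setIntegral_C1_eq _ hg hg' htT, setIntegral_C1_eq _ hg hg' htT]
  have e : (∫ r in (t : ℝ)..T, g' r * j.posPart.real (Set.Ioc t r.toNNReal)) -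
      ∫ r in (t : ℝ)..T, g' r * j.negPart.real (Set.Ioc t r.toNNReal) =
      (∫ r in (t : ℝ)..T, g' r * f r.toNNReal) - f t * (g T - g t) := by
    have hfi : IntervalIntegrable (fun r : ℝ => g' r * f r.toNNReal) volume t T := by
      refine IntervalIntegrable.continuousOn_mul ?_ hg'.continuousOn
      refine (hf.intervalIntegrable t T).congr fun r hr => ?_
      rw [Set.uIoc_of_le (NNReal.coe_le_coe.2 htT)] at hr
      rw [min_eq_left (Real.toNNReal_le_iff_le_coe.2 hr.2)]
    rw [← intervalIntegral.integral_sub (hmono _ inferInstance) (hmono _ inferInstance),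
      ← intervalIntegral.integral_eq_sub_of_hasDerivAt (fun r _ => hg r)
        (hg'.intervalIntegrable _ _), ← intervalIntegral.integral_const_mul,
      ← intervalIntegral.integral_sub hfi ((hg'.intervalIntegrable _ _).const_mul _)]
    refine intervalIntegral.integral_congr fun r hr => ?_
    rw [Set.uIcc_of_le (NNReal.coe_le_coe.2 htT)] at hr
    have := hreal r.toNNReal (by rw [← Real.toNNReal_coe (r := t)]; exact Real.toNNReal_le_toNNReal hr.1)
      (Real.toNNReal_le_iff_le_coe.2 hr.2)
    rw [← mul_sub, this]; ring
  have := hreal T htT le_rfl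
  linear_combination g T * this - e

end

section

variable {Ω : Type*} {mΩ : MeasurableSpace Ω} {μ : Measure Ω} {𝓕 : Filtration ℝ≥0 mΩ}
variable {p : Params} {N : ℕ}

/-! ### The feedback form -/

lemma hasDerivAt_mul_flow_entry {ι : Type*} [Fintype ι] [DecidableEq ι] (C F : Matrix ι ι ℝ)
    (t : ℝ) (i j : ι) :
    HasDerivAt (fun r => (C * flow F r) i j) (((C * flow F t) * F) i j) t := by
  simp only [Matrix.mul_assoc, Matrix.mul_apply (M := C)]
  exact HasDerivAt.fun_sum fun k _ => (hasDerivAt_flow_entry' F t k j).const_mul _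

lemma hasDerivAt_G (t : ℝ) (j : Fin 3) :
    HasDerivAt (fun r => G p N r j) (Matrix.vecMul (G p N t) (F p N) j) t := by
  have := hasDerivAt_mul_flow_entry (playerTerminal p) (F p N) t 1 j
  simp only [playerTerminal_mul_flow_one, Matrix.mul_apply_eq_vecMul _ (F p N)] at this
  rwa [show (playerTerminal p * flow (F p N) t) 1 = G p N t from
    funext (playerTerminal_mul_flow_one t)] at this

lemma hasDerivAt_H (t : ℝ) (j : Fin 3) :
    HasDerivAt (fun r => H p N r j) (Matrix.vecMul (H p N t) (F p N) j) t := by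
  have := hasDerivAt_mul_flow_entry (playerTerminal p) (F p N) t 2 j
  simp only [playerTerminal_mul_flow_two, Matrix.mul_apply_eq_vecMul _ (F p N)] at this
  rwa [show (playerTerminal p * flow (F p N) t) 2 = H p N t from
    funext (playerTerminal_mul_flow_two t)] at this

lemma continuous_vecMul_G (j : Fin 3) : Continuous fun r => Matrix.vecMul (G p N r) (F p N) j := by
  have : ∀ k, Continuous fun r => G p N r k := fun k =>
    continuous_iff_continuousAt.2 fun r => (hasDerivAt_G r k).continuousAt
  simp only [Matrix.vecMul, dotProduct, Fin.sum_univ_three]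
  exact (((this 0).mul_const _).add ((this 1).mul_const _)).add ((this 2).mul_const _)

lemma continuous_vecMul_H (j : Fin 3) : Continuous fun r => Matrix.vecMul (H p N r) (F p N) j := by
  have : ∀ k, Continuous fun r => H p N r k := fun k =>
    continuous_iff_continuousAt.2 fun r => (hasDerivAt_H r k).continuousAt
  simp only [Matrix.vecMul, dotProduct, Fin.sum_univ_three]
  exact (((this 0).mul_const _).add ((this 1).mul_const _)).add ((this 2).mul_const _)

lemma G_zero : G p N 0 1 = -1 := by simp [G, Q]

lemma H_zero : H p N 0 1 = 0 := by simp [H, Q]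

/-- The Stieltjes integral of a time-reversed and normalised `C¹` kernel, integrated by parts. -/
lemma stieltjesIntegral_reversed {k k' : ℝ → ℝ} (hk : ∀ r, HasDerivAt k (k' r) r)
    (hk' : Continuous k') (c : ℝ) {f : ℝ≥0 → ℝ} {t T : ℝ≥0} (htT : t ≤ T)
    (hbv : BoundedVariationOn f (Set.Iic T)) (hf : IsCadlag fun s => f (min s T)) :
    stieltjesIntegral (fun s => k ((T : ℝ) - s) / c) f t T =
      (k 0 * f T - k ((T : ℝ) - t) * f t + ∫ r in (t : ℝ)..T, k' (T - r) * f r.toNNReal) / c := by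
  have hd : ∀ r, HasDerivAt (fun r => k ((T : ℝ) - r) / c) (-k' (T - r) / c) r := fun r => by
    have := ((hk (T - r)).comp r ((hasDerivAt_id r).const_sub (T : ℝ))).div_const c
    simpa using this
  rw [stieltjesIntegral_eq hd (by fun_prop) htT hbv hf, sub_self]
  have : ∫ r in (t : ℝ)..T, -k' (T - r) / c * f r.toNNReal =
      -(1 / c) * ∫ r in (t : ℝ)..T, k' (T - r) * f r.toNNReal := by
    rw [← intervalIntegral.integral_const_mul]
    exact intervalIntegral.integral_congr fun r _ => by ring
  rw [this]; ring

lemma CadlagL2.integrable_kernel_integral [IsFiniteMeasure μ] {T : ℝ≥0} {S : ℝ≥0 → Ω → ℝ}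
    (hS : CadlagL2 μ 𝓕 T S) {k : ℝ → ℝ} (hk : Continuous k) {t : ℝ≥0} (ht : t ≤ T) :
    Integrable (fun ω => ∫ r in (t : ℝ)..T, k r * S r.toNNReal ω) μ := by
  have hc := hS.mul_deterministic (c := k) hk.continuousOn
  have := (hc.primitive.integrable T).sub (hc.primitive.integrable t)
  refine this.congr (ae_of_all _ fun ω => ?_)
  simp only [Pi.sub_apply]
  rw [hc.primitive_increment ω ht le_rfl, add_sub_cancel_left]
  refine intervalIntegral.integral_congr fun r hr => ?_
  rw [Set.uIcc_of_le (NNReal.coe_le_coe.2 ht)] at hr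
  rw [min_eq_left (Real.toNNReal_le_iff_le_coe.2 hr.2), Real.coe_toNNReal _
    (t.coe_nonneg.trans hr.1)]

lemma condExp_affine [IsFiniteMeasure μ] {m : MeasurableSpace Ω} (hm : m ≤ mΩ) {Φ S ξ : Ω → ℝ}
    (a c : ℝ) (hS : StronglyMeasurable[m] S) (hSi : Integrable S μ) (hξ : Integrable ξ μ)
    (h : Φ =ᵐ[μ] fun ω => a * S ω + c * ξ ω) :
    Integrable Φ μ ∧ μ[Φ|m] =ᵐ[μ] fun ω => a * S ω + c * (μ[ξ|m]) ω := by
  refine ⟨((hSi.const_mul a).add (hξ.const_mul c)).congr h.symm, (condExp_congr_ae h).trans ?_⟩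
  have h1 := condExp_add (hSi.const_mul a) (hξ.const_mul c) m
  have h2 : μ[fun ω => c * ξ ω|m] =ᵐ[μ] c • μ[ξ|m] := condExp_smul c ξ m
  have h3 : μ[fun ω => a * S ω|m] = fun ω => a * S ω :=
    condExp_of_stronglyMeasurable hm (hS.const_mul a) (hSi.const_mul a)
  filter_upwards [h1, h2] with ω e1 e2
  refine e1.trans ?_
  rw [Pi.add_apply, e2, h3]
  rfl

lemma SolvesPlayerFBSDE.congr_input {x : ℝ} {P Y Y' X u Z : ℝ≥0 → Ω → ℝ}
    (h : SolvesPlayerFBSDE p μ 𝓕 N x P Y X u Z) (hY : Indist μ p.T Y Y') :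
    SolvesPlayerFBSDE p μ 𝓕 N x P Y' X u Z := by
  obtain ⟨M, K, hM, hK, eu, eZ⟩ := h.eq_u_Z
  refine ⟨h.admissible, h.adapted_Z, h.cadlag_X, h.cadlag_u, h.cadlag_Z, h.eq_X,
    ⟨M, K, hM, hK, ?_, eZ⟩, ?_, h.terminal_Z⟩
  · filter_upwards [eu, hY] with ω h1 h2 t ht
    rw [h1 t ht, h2 t ht, h2 0 zero_le]
  · filter_upwards [h.terminal_u, hY] with ω h1 h2
    rw [h1, h2 _ le_rfl]

/-- The elimination of the adjoint variable from the two propagated terminal conditions. -/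
lemma feedback_algebra {G0 G1 G2 H0 H1 H2 X u Z eG eH l : ℝ} (hG : G1 ≠ 0) (hH : H2 ≠ 0)
    (hd : G1 * H2 - G2 * H1 ≠ 0)
    (e1 : G0 * X + G1 * u + G2 * Z = -(G1 * l * eG)) (e2 : H0 * X + H1 * u + H2 * Z = -(H2 * l * eH)) :
    u = (1 - G2 / G1 * (H1 / H2))⁻¹ *
      ((G2 / G1 * (H0 / H2) - G0 / G1) * X + G2 / G1 * l * eH - l * eG) := by
  have h1 : 1 - G2 / G1 * (H1 / H2) = (G1 * H2 - G2 * H1) / (G1 * H2) := by field_simp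
  rw [h1, inv_div, eq_comm, div_mul_eq_mul_div, div_eq_iff hd]
  field_simp
  linear_combination (-H2) * e1 + G2 * e2

/-- The feedback form of the solution of a player's system. -/
theorem SolvesPlayerFBSDE.hasFeedbackForm [IsFiniteMeasure μ] (h𝓕 : UsualConditions 𝓕 μ)
    (hN : 1 ≤ N) (hF : PlayerNondegenerate p N) {P W A A' Y Y' X u Z : ℝ≥0 → Ω → ℝ} {x : ℝ}
    (hPc : AeCadlag μ p.T P) (hW : CadlagL2 μ 𝓕 p.T W) (hWm : Martingale W 𝓕 μ)
    (hA : CadlagL2 μ 𝓕 p.T A') (hY : CadlagL2 μ 𝓕 p.T Y')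
    (hP : ∀ᵐ ω ∂μ, ∀ t ≤ p.T, P t ω - P 0 ω = W t ω - W 0 ω + (A' t ω - A' 0 ω))
    (hAA : Indist μ p.T A A') (hYY : Indist μ p.T Y Y')
    (hbv : ∀ᵐ ω ∂μ, BoundedVariationOn (fun s => A s ω - p.kappa * Y s ω) (Set.Iic p.T))
    (h : SolvesPlayerFBSDE p μ 𝓕 N x P Y X u Z) : HasFeedbackForm p N μ 𝓕 x A Y u := by
  refine ⟨hbv, fun t _ htT => ?_⟩
  have hl := p.lam_pos.ne'
  obtain ⟨X₁, u₁, Z₁, h₁, hlin⟩ := exists_solvesPlayerFBSDE h𝓕 hF hW hWm hA hY hP x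
  obtain ⟨eG, eH⟩ := hlin t htT.le
  obtain ⟨hX, hu, -⟩ := SolvesPlayerFBSDE.unique h𝓕 hN hPc hY.aeCadlag (h.congr_input hYY) h₁
  have ht : (p.T : ℝ) - t ∈ Set.Icc 0 (p.T : ℝ) :=
    ⟨sub_nonneg.2 (NNReal.coe_le_coe.2 htT.le), by linarith [t.coe_nonneg]⟩
  have hG := ne_zero_of_sInf_abs_pos hF.G2 ht
  have hH := ne_zero_of_sInf_abs_pos hF.H3 ht
  have hd := ne_zero_of_sInf_abs_pos hF.det ht
  have hS : CadlagL2 μ 𝓕 p.T fun t ω => A' t ω - p.kappa * Y' t ω := hA.sub (hY.const_mul _)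
  have hS' : CadlagL2 μ 𝓕 p.T fun t ω => 1 / (2 * p.lam) * (A' t ω - p.kappa * Y' t ω) :=
    hS.const_mul _
  have hSS : ∀ᵐ ω ∂μ, ∀ r ≤ p.T, A r ω - p.kappa * Y r ω = A' r ω - p.kappa * Y' r ω := by
    filter_upwards [hAA, hYY] with ω h1 h2 r hr
    rw [h1 r hr, h2 r hr]
  -- both Stieltjes integrals are affine in the terminal data that occur in the linear relations
  have key : ∀ {k k' : ℝ → ℝ} (hk : ∀ r, HasDerivAt k (k' r) r) (hk' : Continuous k') (c : ℝ),
      ∀ᵐ ω ∂μ, stieltjesIntegral (fun s => k ((p.T : ℝ) - s) / c)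
        (fun s => A s ω - p.kappa * Y s ω) t p.T =
        (k 0 * (A' p.T ω - p.kappa * Y' p.T ω) -
          k ((p.T : ℝ) - t) * (A' t ω - p.kappa * Y' t ω) +
          2 * p.lam * ∫ r in (t : ℝ)..p.T, k' (p.T - r) *
            (1 / (2 * p.lam) * (A' r.toNNReal ω - p.kappa * Y' r.toNNReal ω))) / c := by
    intro k k' hk hk' c
    filter_upwards [hSS, hbv] with ω h1 h2
    rw [stieltjesIntegral_reversed hk hk' c htT.le h2, h1 _ le_rfl, h1 _ htT.le]
    · congr 2
      rw [← intervalIntegral.integral_const_mul]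
      refine intervalIntegral.integral_congr fun r hr => ?_
      rw [Set.uIcc_of_le (NNReal.coe_le_coe.2 htT.le)] at hr
      rw [h1 _ (Real.toNNReal_le_iff_le_coe.2 hr.2)]
      field_simp
    · have : (fun s => A (min s p.T) ω - p.kappa * Y (min s p.T) ω) =
          fun s => A' s ω - p.kappa * Y' s ω := by
        funext s
        rw [h1 _ (min_le_right _ _)]
        exact hS.stopped s ω
      rw [this]
      exact hS.cadlag ω
  have iG := hS'.integrable_kernel_integral
    (k := fun r => Matrix.vecMul (G p N (p.T - r)) (F p N) 1)
    ((continuous_vecMul_G (p := p) (N := N) 1).comp (by fun_prop)) htT.le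
  have iH := hS'.integrable_kernel_integral
    (k := fun r => Matrix.vecMul (H p N (p.T - r)) (F p N) 1)
    ((continuous_vecMul_H (p := p) (N := N) 1).comp (by fun_prop)) htT.le
  obtain ⟨jG, cG⟩ := condExp_affine (Φ := futureG p N A Y t) (𝓕.le t) (-1)
    (-(2 * p.lam) / G p N (p.T - t) 1) (hS.adapted t) (hS.integrable t)
    ((((hY.integrable p.T).const_mul (p.kappa / (2 * p.lam))).add (hS'.integrable p.T)).sub iG) (by
      filter_upwards [key (fun r => hasDerivAt_G (p := p) (N := N) r 1) (continuous_vecMul_G 1)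
        (G p N (p.T - t) 1), hYY] with ω h1 h2
      simp only [Pi.sub_apply, Pi.add_apply]
      rw [futureG, h1, h2 _ le_rfl, G_zero]
      field_simp
      ring)
  obtain ⟨jH, cH⟩ := condExp_affine (Φ := futureH p N A Y t) (𝓕.le t)
    (-(H p N (p.T - t) 1 / H p N (p.T - t) 2))
    (-(2 * p.lam) / H p N (p.T - t) 2) (hS.adapted t) (hS.integrable t) iH.neg (by
      filter_upwards [key (fun r => hasDerivAt_H (p := p) (N := N) r 1) (continuous_vecMul_H 1)
        (H p N (p.T - t) 2)] with ω h1
      simp only [Pi.neg_apply]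
      rw [futureH, h1, H_zero]
      field_simp
      ring)
  refine ⟨jH, jG, ?_⟩
  filter_upwards [eG, eH, cG, cH, hX, hu, h.eq_X] with ω a1 a2 a3 a4 a5 a6 a7
  rw [← a5 t htT.le, ← a6 t htT.le] at a1 a2
  have hinv : inventory x u t ω = X t ω := (a7 t htT.le).symm
  rw [hinv, v0, v1, v2, div_eq_mul_one_div (G p N (p.T - t) 2 / G p N (p.T - t) 1) (2 * p.lam)]
  refine feedback_algebra hG hH hd (Z := Z₁ t ω) (a1.trans ?_) (a2.trans ?_)
  · rw [a3]
    have : ∀ e : ℝ, G p N (p.T - t) 1 * (1 / (2 * p.lam) * (A' t ω - p.kappa * Y' t ω)) + e =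
        -(G p N (p.T - t) 1 * (1 / (2 * p.lam)) * (-1 * (A' t ω - p.kappa * Y' t ω) +
          -(2 * p.lam) / G p N (p.T - t) 1 * e)) := fun e => by
      field_simp
      ring
    exact this _
  · rw [a4]
    have : ∀ e : ℝ, H p N (p.T - t) 1 * (1 / (2 * p.lam) * (A' t ω - p.kappa * Y' t ω)) + e =
        -(H p N (p.T - t) 2 * (1 / (2 * p.lam)) * (-(H p N (p.T - t) 1 / H p N (p.T - t) 2) *
          (A' t ω - p.kappa * Y' t ω) + -(2 * p.lam) / H p N (p.T - t) 2 * e)) := fun e => by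
      field_simp
      ring
    exact this _

end

end CrowdedGame

end

theorem theorem2p7 {Ω : Type*} [mΩ : MeasurableSpace Ω] (μ : Measure Ω) [IsProbabilityMeasure μ]
    (𝓕 : Filtration ℝ≥0 mΩ) (h𝓕 : CrowdedGame.UsualConditions 𝓕 μ)
    (p : CrowdedGame.Params) (N : ℕ) (hN : 1 ≤ N)
    (x : Fin N → ℝ) (y : ℝ) (hy : 0 < y)
    (P L A : ℝ≥0 → Ω → ℝ) (hP : CrowdedGame.IsH2Semimartingale μ 𝓕 p.T P L A)
    (hmean : CrowdedGame.MeanNondegenerate p N)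
    (hplayer : CrowdedGame.PlayerNondegenerate p N) :
    -- the aggregated FBSDE has a solution, unique up to indistinguishability
    (∃ X Y u Z : ℝ≥0 → Ω → ℝ,
      CrowdedGame.SolvesMeanFBSDE p μ 𝓕 N ((1 / (N : ℝ)) * ∑ i, x i) y P X Y u Z ∧
      ∀ X' Y' u' Z' : ℝ≥0 → Ω → ℝ,
        CrowdedGame.SolvesMeanFBSDE p μ 𝓕 N ((1 / (N : ℝ)) * ∑ i, x i) y P X' Y' u' Z' →
        CrowdedGame.Indist μ p.T X' X ∧ CrowdedGame.Indist μ p.T Y' Y ∧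
          CrowdedGame.Indist μ p.T u' u ∧ CrowdedGame.Indist μ p.T Z' Z) ∧
    ∀ Xbar Ybar ubar Zbar : ℝ≥0 → Ω → ℝ,
      CrowdedGame.SolvesMeanFBSDE p μ 𝓕 N ((1 / (N : ℝ)) * ∑ i, x i) y P Xbar Ybar ubar Zbar →
      -- given its `Ybar`, every player's FBSDE has a unique solution
      (∀ i, ∃ X u Z : ℝ≥0 → Ω → ℝ,
        CrowdedGame.SolvesPlayerFBSDE p μ 𝓕 N (x i) P Ybar X u Z ∧
        ∀ X' u' Z' : ℝ≥0 → Ω → ℝ,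
          CrowdedGame.SolvesPlayerFBSDE p μ 𝓕 N (x i) P Ybar X' u' Z' →
          CrowdedGame.Indist μ p.T X' X ∧ CrowdedGame.Indist μ p.T u' u ∧
            CrowdedGame.Indist μ p.T Z' Z) ∧
      -- these solutions have the feedback form and are the unique Nash equilibrium
      ∀ u : Fin N → ℝ≥0 → Ω → ℝ,
        (∀ i, ∃ X Z : ℝ≥0 → Ω → ℝ,
          CrowdedGame.SolvesPlayerFBSDE p μ 𝓕 N (x i) P Ybar X (u i) Z) →
        (∀ i, CrowdedGame.HasFeedbackForm p N μ 𝓕 (x i) A Ybar (u i)) ∧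
        CrowdedGame.IsNash p μ 𝓕 x y P u ∧
        ∀ w : Fin N → ℝ≥0 → Ω → ℝ, CrowdedGame.IsNash p μ 𝓕 x y P w →
          ∀ i, ∀ᵐ z ∂(μ.prod (volume.restrict (Set.Icc (0 : ℝ) p.T))),
            w i z.2.toNNReal z.1 = u i z.2.toNNReal z.1 := by
  have hPc : CrowdedGame.AeCadlag μ p.T P := by
    filter_upwards [hP.decomposition, hP.cadlag_L, hP.cadlag_A] with ω h1 h2 h3
    have : (fun t => CrowdedGame.stopAt p.T P t ω) = fun t =>
        CrowdedGame.stopAt p.T L t ω + CrowdedGame.stopAt p.T A t ω :=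
      funext fun t => h1 _ (min_le_right _ _)
    rw [this]
    exact h2.add h3
  obtain ⟨B, hB, hBT⟩ := hP.bracket
  obtain ⟨W, hW, hWm, hLW⟩ := CrowdedGame.exists_martingale_version h𝓕 hP.cadlag_L hB hBT
  obtain ⟨A', hA, hAA⟩ := CrowdedGame.exists_finiteVariation_version h𝓕 hP
  have hinc : ∀ᵐ ω ∂μ, ∀ t ≤ p.T, P t ω - P 0 ω = W t ω - W 0 ω + (A' t ω - A' 0 ω) := by
    filter_upwards [hP.decomposition, hLW, hAA] with ω h1 h2 h3 t ht
    rw [h1 t ht, h1 0 zero_le, ← h2 t ht, ← h2 0 zero_le, h3 t ht, h3 0 zero_le]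
    ring
  have hS := (hW.sub hW.initial).add (hA.sub hA.initial)
  have hPS : ∀ᵐ ω ∂μ, ∀ t ≤ p.T,
      P t ω = P 0 ω + ((W t ω - W 0 ω) + (A' t ω - A' 0 ω)) := by
    filter_upwards [hinc] with ω h t ht
    rw [← h t ht]; ring
  obtain ⟨X₀, Y₀, u₀, Z₀, hY₀, h₀⟩ := CrowdedGame.exists_solvesMeanFBSDE h𝓕 hN hmean hW hWm hA hinc
    ((1 / (N : ℝ)) * ∑ i, x i) y
  refine ⟨⟨X₀, Y₀, u₀, Z₀, h₀, fun X' Y' u' Z' h' =>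
    CrowdedGame.SolvesMeanFBSDE.unique h𝓕 hN hPc h' h₀⟩, fun Xbar Ybar ubar Zbar hbar => ?_⟩
  have hYY : CrowdedGame.Indist μ p.T Ybar Y₀ :=
    (CrowdedGame.SolvesMeanFBSDE.unique h𝓕 hN hPc hbar h₀).2.1
  have hYY' : CrowdedGame.Indist μ p.T Y₀ Ybar :=
    (CrowdedGame.SolvesMeanFBSDE.unique h𝓕 hN hPc h₀ hbar).2.1
  refine ⟨fun i => ?_, fun u hu => ?_⟩
  · obtain ⟨X, u, Z, h, -⟩ :=
      CrowdedGame.exists_solvesPlayerFBSDE h𝓕 hplayer hW hWm hA hY₀ hinc (x i)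
    exact ⟨X, u, Z, h.congr_input hYY', fun X' u' Z' h' =>
      CrowdedGame.SolvesPlayerFBSDE.unique h𝓕 hN hPc hbar.cadlag_Y h' (h.congr_input hYY')⟩
  choose X Z hXZ using hu
  have hu : ∀ i, CrowdedGame.Admissible μ 𝓕 p.T (u i) := fun i => (hXZ i).admissible
  have hstat : ∀ i, CrowdedGame.IsStationary p μ 𝓕 N (x i) P Ybar (u i) := fun i =>
    (hXZ i).isStationary h𝓕 hN
  have hstat' : ∀ i, CrowdedGame.IsStationary p μ 𝓕 N (x i) P (CrowdedGame.impact p y u) (u i) :=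
    fun i => (hstat i).congr_impact (CrowdedGame.indist_impact h𝓕 hN hPc hbar hu hstat)
  have hbv : ∀ᵐ ω ∂μ, BoundedVariationOn (fun s => A s ω - p.kappa * Ybar s ω) (Set.Iic p.T) := by
    filter_upwards [CrowdedGame.ae_boundedVariationOn hA hAA hP.variation, hbar.eq_Y,
      hbar.cadlag_Y.ae_pathL2, hbar.admissible.ae_pathL2] with ω h1 h2 lY lu
    exact CrowdedGame.boundedVariationOn_sub_const_mul p.kappa h1
      (CrowdedGame.boundedVariationOn_primitive
        ((lY.interval.const_mul (-p.rho)).add (lu.interval.const_mul p.gamma)) h2)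
  refine ⟨fun i => (hXZ i).hasFeedbackForm h𝓕 hN hplayer hPc hW hWm hA hY₀ hinc hAA hYY hbv,
    CrowdedGame.isNash_of_isStationary hN hPc hS hPS hP.integrable_zero hu hstat',
    fun w hw i => ?_⟩
  exact CrowdedGame.ae_eq_of_isStationary_impact hN hPc hu hw.1 hstat'
    (fun i => hw.isStationary hN hPc hS hPS hP.integrable_zero i) i
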